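/- \textbf{Setting.} A network is a connected, locally finite simple graph $G$ with a port numbering: at each vertex $v$ the edges at $v$ carry pairwise distinct numbers $\delta_v(w)\in\mathbb N$ ($w$ adjacent to $v$). Vertices are anonymous, but each vertex $v$ carries a binoculars label $\nu(v)$: the subgraph induced by $v$ and its neighbours with all its port numbers, rooted at $v$, up to isomorphism. In each step a mobile agent (a Turing machine with unbounded memory) reads the label of its location and the port through which it entered it, updates its memory, and then moves through a port, stays, or halts. An \emph{Exploration algorithm} is an agent that, on every network and from every starting vertex $v_0$, either visits every vertex and halts, or never halts. The clique complex of $G$ is denoted by $X(G)$. A simplicial covering is a simplicial map that restricts to a bijection from each star onto the star of the image vertex; the universal cover of a connected complex is its covering by a connected complex that factors, by a covering, through every covering by a connected complex. Let $\mathrm{FNT}$ be the class of graphs $G$ such that the universal cover of $X(G)$ is finite. A cycle $(u_0,\dots,u_m)$, $u_m=u_0$, is simple if $u_0,\dots,u_{m-1}$ are distinct. A loop in $X(H)$ is $k$-contractible if it can be reduced to a single vertex by at most $k$ elementary homotopies (inserting or deleting a backtrack $(u,v,u)$, pushing a subpath across a triangle, inserting or deleting a repetition of a vertex). The view of $v$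 at depth $d$ is the rooted tree of all paths of length at most $d$ from $v$, with the port numbers at both ends of each edge and the binoculars label of each vertex. \textbf{Algorithm.} For $k=1,2,\dots$: follow, in breadth-first order, all paths of length at most $2k$ from the homebase $v_0$, recording the view of $v_0$ at depth $2k$, and return to $v_0$; then search, in a fixed enumeration of all finite networks, for a network $H$ with $|V(H)|<k$ that has a vertex $h_0$ whose view at depth $2k$ equals that of $v_0$, and all of whose simple cycles are $k$-contractible. If there is such an $H$, halt with the first one; otherwise go on to $k+1$. \textbf{Theorem.} This algorithm (whose transition function is computable) is an Exploration algorithm, and it halts on every graph of $\mathrm{FNT}$, for every port numbering and every starting vertex. On networks whose graph is not in $\mathrm{FNT}$ it never halts. Whenever it halts on a network $G$, every vertex of $G$ has been visited, and the network $H$ that it found (with $k$ the last phase, it has $|V(H)|<k$, a vertex whose view at depth $2k$ equals that of $v_0$, and only $k$-contractible simple cycles) is the universal cover of $G$: there is a map $\mu:V(H)\to V(G)$ that preserves port numbers and exhibits $X(H)$ as the universal cover of $X(G)$. -/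

import Mathlib

universe u v w

/-! ### Abstract simplicial complexes, coverings, universal covers -/

namespace BinocularExploration

/-- The 1-skeleton of a simplicial complex. -/
def edgeGraph {V : Type u} (K : AbstractSimplicialComplex V) : SimpleGraph V where
  Adj x y := x ≠ y ∧ ∃ s ∈ K.faces, x ∈ s ∧ y ∈ s
  symm := ⟨fun _ _ h => ⟨h.1.symm, let ⟨s, hs, hx, hy⟩ := h.2; ⟨s, hs, hy, hx⟩⟩⟩
  loopless := ⟨fun _ h => h.1 rfl⟩

/-- A complex is connected if its 1-skeleton is (in particular it is nonempty). -/
def IsConnectedComplex {V : Type u} (K : AbstractSimplicialComplex V) : Prop :=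
  (edgeGraph K).Connected

/-- The simplices of the star of `x`: the simplices containing `x` and their subsimplices. -/
def star {V : Type u} (K : AbstractSimplicialComplex V) (x : V) : Set (Finset V) :=
  {s | s.Nonempty ∧ ∃ t ∈ K.faces, x ∈ t ∧ s ⊆ t}

open Classical in
/-- Simplicial coverings: simplicial maps that restrict to a bijection from (the simplices of)
each star onto (the simplices of) the star of the image vertex. -/
structure IsSimplicialCovering {V : Type u} {W : Type v} (K : AbstractSimplicialComplex V)
    (L : AbstractSimplicialComplex W) (φ : V → W) : Prop where
  map_face : ∀ s ∈ K.faces, s.image φ ∈ L.faces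
  bijOn_star : ∀ x, Set.BijOn (fun s : Finset V => s.image φ) (star K x) (star L (φ x))

/-- `μ : K' → K` exhibits `K'` as the universal cover of the connected complex `K`: it is a
covering by a connected complex that factors through every covering of `K` by a connected complex.
(A connected covering of a complex with vertex type in `Type u` has, up to isomorphism, its vertex
type in `Type u`.) -/
structure IsUniversalCover {W : Type v} {V : Type u} (K' : AbstractSimplicialComplex W)
    (K : AbstractSimplicialComplex V) (μ : W → V) : Prop where
  connected : IsConnectedComplex K'
  covering : IsSimplicialCovering K' K μ
  universal : ∀ {U : Type u} (L : AbstractSimplicialComplex U) (φ : U → V),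
    IsConnectedComplex L → IsSimplicialCovering L K φ →
      ∃ γ : W → U, IsSimplicialCovering K' L γ ∧ φ ∘ γ = μ

/-- The clique complex of a graph. -/
def cliqueComplex {V : Type u} (G : SimpleGraph V) : AbstractSimplicialComplex V where
  faces := {s | s.Nonempty ∧ G.IsClique (s : Set V)}
  isRelLowerSet_faces := fun _ hs =>
    ⟨hs.1, fun _ hts ht => ⟨ht, hs.2.subset (Finset.coe_subset.2 hts)⟩⟩
  singleton_mem := fun x => ⟨Finset.singleton_nonempty x, by simp⟩

/-- The class FNT: graphs whose clique complex has a finite universal cover. -/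
def FNT {V : Type u} (G : SimpleGraph V) : Prop :=
  ∃ (W : Type u) (K' : AbstractSimplicialComplex W) (μ : W → V),
    Finite W ∧ IsUniversalCover K' (cliqueComplex G) μ

/-! ### Loops, elementary homotopies, contractibility in the clique complex of a graph -/

/-- Elementary homotopies between paths or loops (given by their vertex sequences), in the
direction that makes the sequence longer or replaces one edge by two. -/
inductive ElementaryMove {V : Type u} (G : SimpleGraph V) : List V → List V → Prop
  /-- insert a subpath `(a, b, a)` -/
  | backtrack (x y : List V) {a b : V} (hab : G.Adj a b) :
      ElementaryMove G (x ++ a :: y) (x ++ a :: b :: a :: y)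
  /-- push an empty subpath across a triangle -/
  | pushVertex (x y : List V) {a b c : V} (hab : G.Adj a b) (hbc : G.Adj b c) (hca : G.Adj c a) :
      ElementaryMove G (x ++ a :: y) (x ++ a :: b :: c :: a :: y)
  /-- push an edge across a triangle -/
  | pushEdge (x y : List V) {a b c : V} (hab : G.Adj a b) (hbc : G.Adj b c) (hca : G.Adj c a) :
      ElementaryMove G (x ++ a :: b :: y) (x ++ a :: c :: b :: y)
  /-- repeat a vertex -/
  | stutter (x y : List V) (a : V) :
      ElementaryMove G (x ++ a :: y) (x ++ a :: a :: y)

/-- The (symmetric) relation of being related by one elementary homotopy. -/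
def ElementaryHomotopy {V : Type u} (G : SimpleGraph V) (c c' : List V) : Prop :=
  ElementaryMove G c c' ∨ ElementaryMove G c' c

/-- `KContractible G k c`: the loop `c` can be reduced to a vertex by a sequence of at most `k`
elementary homotopies. -/
inductive KContractible {V : Type u} (G : SimpleGraph V) : ℕ → List V → Prop
  | vertex (k : ℕ) (a : V) : KContractible G k [a]
  | step {k : ℕ} {c c' : List V} (h : ElementaryHomotopy G c c') (h' : KContractible G k c') :
      KContractible G (k + 1) c

/-- Simple cycles, as vertex sequences `(v₀, …, vₘ)` with `v₀ = vₘ`, consecutive vertices adjacent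
and `v₀, …, vₘ₋₁` pairwise distinct (`m = 0` and `m = 2` are allowed). -/
structure IsSimpleCycle {V : Type u} (G : SimpleGraph V) (c : List V) : Prop where
  ne_nil : c ≠ []
  closed : c.head? = c.getLast?
  chain : c.IsChain G.Adj
  nodup : c.dropLast.Nodup

/-! ### Networks with port numbers, binoculars labels, views -/

/-- A connected, locally finite simple graph with a port numbering: `port x y` is the port number
at `x` of the edge `xy` (only its values on edges matter). -/
structure Network (V : Type u) where
  graph : SimpleGraph V
  connected : graph.Connected
  locallyFinite : ∀ x, (graph.neighborSet x).Finite
  port : V → V → ℕ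
  port_injOn : ∀ x, Set.InjOn (port x) (graph.neighborSet x)

/-- Anonymous binoculars labels. The label of `x` lists the arcs of the subgraph induced by `x`
and its neighbours, where `x` is called `none` and the neighbour of `x` behind port `p` is called
`some p`; an arc from `a` to `b` whose port number at `a` is `p` is the triple `(a, b, p)`. -/
abbrev Label : Type := List (Option ℕ × Option ℕ × ℕ)

/-- A path, anonymously: for each of its edges the port numbers at its source and at its target. -/
abbrev PortPath : Type := List (ℕ × ℕ)

namespace Network

variable {V : Type u} (N : Network V)

open Classical in
/-- The name of `y` as seen from `x`. -/
noncomputable def name (x y : V) : Option ℕ := if y = x then none else some (N.port x y)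

/-- The vertices at distance at most 1 from `x`. -/
def closedNbhd (x : V) : Set V := insert x (N.graph.neighborSet x)

/-- The arcs of the subgraph induced by the closed neighbourhood of `x`, in anonymous form. -/
def arcs (x : V) : Set (Option ℕ × Option ℕ × ℕ) :=
  {a | ∃ y ∈ N.closedNbhd x, ∃ z ∈ N.closedNbhd x,
    N.graph.Adj y z ∧ a = (N.name x y, N.name x z, N.port y z)}

theorem arcs_finite (x : V) : (N.arcs x).Finite := by
  have h : (N.closedNbhd x).Finite := (N.locallyFinite x).insert x
  refine ((h.prod h).image
    (fun q : V × V => (N.name x q.1, N.name x q.2, N.port q.1 q.2))).subset ?_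
  rintro _ ⟨y, hy, z, hz, -, rfl⟩
  exact ⟨(y, z), ⟨hy, hz⟩, rfl⟩

/-- The binoculars label of `x`. The arcs are listed without repetition in the increasing order of
the numbers that encode the triples. -/
noncomputable def label (x : V) : Label :=
  (N.arcs_finite x).toFinset.sort (Encodable.encode' _ ⁻¹'o (· ≤ ·))

/-- The view of `x` truncated at depth `d`: a rooted tree whose nodes carry labels and whose edges
carry two port numbers. Since distinct edges at a node of the tree carry distinct port numbers,
the tree is given by the set of its nodes, each represented by the sequence of port numbers that
leads to it from the root, together with its label. -/
noncomputable def view : ℕ → V → Set (PortPath × Label)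
  | 0, x => {([], N.label x)}
  | d + 1, x => insert ([], N.label x)
      {e | ∃ y, N.graph.Adj x y ∧ ∃ e' ∈ view d y, e = ((N.port x y, N.port y x) :: e'.1, e'.2)}

open Classical in
/-- The matrix of port numbers of a finite network (`none` for non-adjacent vertices). -/
noncomputable def code {n : ℕ} (H : Network (Fin n)) : List (List (Option ℕ)) :=
  List.ofFn fun x => List.ofFn fun y => if H.graph.Adj x y then some (H.port x y) else none

end Network

/-! ### Mobile agents -/

/-- The decision taken by an agent at the end of a step. -/
inductive Action
  | halt
  | stay
  | move (p : ℕ)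

/-- Encoding of actions. -/
def Action.equiv : Action ≃ Option (Option ℕ) where
  toFun a := match a with
    | halt => none
    | stay => some none
    | move p => some (some p)
  invFun a := match a with
    | none => halt
    | some none => stay
    | some (some p) => move p
  left_inv a := by cases a <;> rfl
  right_inv a := by rcases a with _ | _ | _ <;> rfl

instance : Primcodable Action := Primcodable.ofEquiv _ Action.equiv

/-- A mobile agent. In each step, its memory, the port through which it entered its current
location (if any) and the label of this location determine its new memory and its action. -/
structure Agent where
  Memory : Type
  [memoryCode : Primcodable Memory]
  init : Memory
  step : Memory → Option ℕ → Label → Memory × Action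

attribute [instance] Agent.memoryCode

namespace Agent

/-- The agent is implementable by a Turing machine. -/
def IsComputable (A : Agent) : Prop :=
  Computable fun x : A.Memory × Option ℕ × Label => A.step x.1 x.2.1 x.2.2

/-- State of an execution on a network with vertex type `V`. -/
structure Config (A : Agent) (V : Type u) where
  memory : A.Memory
  pos : V
  entry : Option ℕ
  halted : Bool

open Classical in
/-- One step of an execution. (Choosing a port that does not exist leaves the agent in place.) -/
noncomputable def next (A : Agent) {V : Type u} (N : Network V) (c : A.Config V) : A.Config V :=
  if c.halted then c else
    match A.step c.memory c.entry (N.label c.pos) with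
    | (m, .halt) => ⟨m, c.pos, c.entry, true⟩
    | (m, .stay) => ⟨m, c.pos, c.entry, false⟩
    | (m, .move p) =>
      if h : ∃ y, N.graph.Adj c.pos y ∧ N.port c.pos y = p then
        ⟨m, h.choose, some (N.port h.choose c.pos), false⟩
      else ⟨m, c.pos, c.entry, false⟩

/-- The execution on the network `N` starting from `x₀`. -/
noncomputable def run (A : Agent) {V : Type u} (N : Network V) (x₀ : V) (t : ℕ) : A.Config V :=
  (A.next N)^[t] ⟨A.init, x₀, none, false⟩

/-- The execution on `N` from `x₀` halts. -/
def Halts (A : Agent) {V : Type u} (N : Network V) (x₀ : V) : Prop :=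
  ∃ t, (A.run N x₀ t).halted

/-- Exploration algorithms: on every network and from every homebase, either the agent terminates
after having visited every vertex, or it never halts. -/
structure IsExplorationAlgorithm (A : Agent) : Prop where
  computable : A.IsComputable
  explores_or_never_halts : ∀ {V : Type u} (N : Network V) (x₀ : V),
    (∃ t, (A.run N x₀ t).halted ∧ ∀ y, ∃ s ≤ t, (A.run N x₀ s).pos = y) ∨
      ∀ t, ¬ (A.run N x₀ t).halted

/-- `A` explores the class `F` of graphs: it is an Exploration algorithm, and it halts on every
graph of the class, for every port numbering and every homebase. -/
structure Explores (A : Agent) (F : ∀ {V : Type u}, SimpleGraph V → Prop) : Prop where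
  isExplorationAlgorithm : IsExplorationAlgorithm.{u} A
  halts : ∀ {V : Type u} (N : Network V) (x₀ : V), F N.graph → A.Halts N x₀

end Agent

/-! ### The algorithm -/

/-- The finite network `H` passes the test of phase `k` with respect to the recorded view `seen`:
it has less than `k` vertices, one of its vertices has the recorded view as view at depth `2k`, and
all its simple cycles are `k`-contractible. -/
def PassesTest (k : ℕ) (seen : List (PortPath × Label)) {n : ℕ} (H : Network (Fin n)) : Prop :=
  n < k ∧ (∃ x, H.view (2 * k) x = {e | e ∈ seen}) ∧
    ∀ c, IsSimpleCycle H.graph c → KContractible H.graph k c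

open Classical in
/-- Enumerate all finite networks and return (the matrix of) the first one that passes the test,
if there is one. -/
noncomputable def search (k : ℕ) (seen : List (PortPath × Label)) :
    Option (List (List (Option ℕ))) :=
  if h : ∃ C, ∃ (n : ℕ) (H : Network (Fin n)), H.code = C ∧ PassesTest k seen H then
    some (Encodable.choose h)
  else none

/-- The memory of the agent. -/
structure Memory where
  /-- the number of the current phase -/
  phase : ℕ
  /-- the paths from the homebase whose end is still to be inspected in this phase -/
  queue : List PortPath
  /-- the part of the view of the homebase recorded in this phase -/
  seen : List (PortPath × Label)
  /-- the ports to follow next -/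
  todo : List ℕ
  /-- whether the agent is following the first path of the queue (or else returning home) -/
  outbound : Bool
  /-- the finite network found by the agent -/
  found : Option (List (List (Option ℕ)))

/-- Encoding of memories. -/
def Memory.equiv : Memory ≃ ℕ × List PortPath × List (PortPath × Label) × List ℕ × Bool ×
    Option (List (List (Option ℕ))) where
  toFun m := (m.phase, m.queue, m.seen, m.todo, m.outbound, m.found)
  invFun a := ⟨a.1, a.2.1, a.2.2.1, a.2.2.2.1, a.2.2.2.2.1, a.2.2.2.2.2⟩
  left_inv _ := rfl
  right_inv _ := rfl

instance : Primcodable Memory := Primcodable.ofEquiv _ Memory.equiv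

/-- The memory at the beginning of phase `k`. -/
def Memory.start (k : ℕ) : Memory := ⟨k, [[]], [], [], true, none⟩

/-- The edges at a vertex, read off from its label: pairs of the port numbers at the vertex itself
and at the neighbour. -/
def Label.edges (L : Label) : List (ℕ × ℕ) :=
  L.flatMap fun a => L.filterMap fun b =>
    match a, b with
    | (none, some p, _), (some p', none, q) => if p = p' then some (p, q) else none
    | _, _ => none

/-- The exploration algorithm for FNT. In phase `k = 1, 2, …` the agent follows, in breadth-first
order, all paths of length at most `2k` from the homebase; at the end of each path it records the
path and the label seen there, and it backtracks to the homebase. The record is then the view of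
the homebase at depth `2k`. At the end of the phase the agent searches for a finite network that
passes the test; it halts if there is one, and starts phase `k + 1` otherwise. -/
noncomputable def fntAgent : Agent where
  Memory := Memory
  init := Memory.start 1
  step m _ L :=
    match m.todo, m.queue, m.outbound with
    | p :: ps, _, _ => ({m with todo := ps}, .move p)
    | [], path :: rest, true =>
      ({m with
          queue := rest ++ if path.length < 2 * m.phase
            then (Label.edges L).map (fun e => path ++ [e]) else []
          seen := m.seen ++ [(path, L)]
          todo := (path.map Prod.snd).reverse
          outbound := false}, .stay)
    | [], path :: _, false => ({m with todo := path.map Prod.fst, outbound := true}, .stay)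
    | [], [], _ =>
      match search m.phase m.seen with
      | some C => ({m with found := some C}, .halt)
      | none => (Memory.start (m.phase + 1), .stay)

end BinocularExploration

/-! Soundness is a monodromy argument. Suppose phase k accepts H. A path of H from `h₀` has at most
one lift to G from `x₀` with the same port numbers, since ports at a vertex are distinct, and a
simple path from `h₀` does lift, because it stays within the depth 2k to which the two views agree.
The end of the lift depends only on the end of the path: two simple paths with the same end split
into simple cycles, these are k-contractible, and a contraction can be lifted move by move
(`exists_closed_lift`), because each elementary homotopy takes place among a vertex and its
neighbours, which its binoculars label describes completely. So pairing the ends of the two paths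
defines a covering H → G (`path_lift_unique`, `exists_isPortCovering`).

The constants fit for the following reason. A simple path in H has fewer than k edges, so a view of
depth at least k is left where a simple cycle starts. The cycle has at most k entries. A loop that
occurs in its contraction has at most 3 entries more per move already made, and at most 3 more than
a single vertex per move still to be made; averaging the two bounds shows that every vertex of the
loop is within distance k of the base point along the loop, where labels still agree.

Every connected covering of G, with ports pulled back, has the same views as G, so the same
construction maps H to it; maps preserving ports are rigid, so these maps are compatible. Hence H is
the universal cover (`exists_isUniversalCover`). In particular halting implies FNT. All of G has
also been visited, since H is connected, has fewer than k vertices and covers G.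

Completeness: a finite universal cover, with ports pulled back, has the views of G at every depth.
It maps to the cover by homotopy classes of paths, so its closed paths have contractible images in
G, and contractions lift through coverings (`IsUniversalCover.exists_kContractible`). It has
finitely many simple cycles, so a single k serves for all of them.

Computability: a contraction in k moves uses only lists of at most 3k + 1 vertices, and every port
number of H occurs in the recorded view. The search over all networks thus agrees with a bounded,
primitive recursive one (`search_eq_firstCandidate`). -/

namespace BinocularExploration

/-! ### Coverings of clique complexes -/

/-- The graph maps that induce coverings of clique complexes. -/
structure IsCliqueCovering {W : Type v} {V : Type u} (G : SimpleGraph W) (G' : SimpleGraph V)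
    (φ : W → V) : Prop where
  adj : ∀ {x y}, G.Adj x y → G'.Adj (φ x) (φ y)
  inj : ∀ {x y z}, G.Adj x y → G.Adj x z → φ y = φ z → y = z
  surj : ∀ {x b}, G'.Adj (φ x) b → ∃ y, G.Adj x y ∧ φ y = b
  triangle : ∀ {x y z}, G.Adj x y → G.Adj x z → G'.Adj (φ y) (φ z) → G.Adj y z

section

variable {W : Type v} {V : Type u} {U : Type w}

theorem IsCliqueCovering.comp {G : SimpleGraph W} {G' : SimpleGraph V} {G'' : SimpleGraph U}
    {ψ : V → U} {φ : W → V} (hψ : IsCliqueCovering G' G'' ψ) (hφ : IsCliqueCovering G G' φ) :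
    IsCliqueCovering G G'' (ψ ∘ φ) where
  adj h := hψ.adj (hφ.adj h)
  inj h h' e := hφ.inj h h' (hψ.inj (hφ.adj h) (hφ.adj h') e)
  surj h := by
    obtain ⟨b, hb, rfl⟩ := hψ.surj h
    obtain ⟨y, hy, rfl⟩ := hφ.surj hb
    exact ⟨y, hy, rfl⟩
  triangle h h' e := hφ.triangle h h' (hψ.triangle (hφ.adj h) (hφ.adj h') e)

theorem IsCliqueCovering.comap_equiv (G : SimpleGraph V) (e : W ≃ V) :
    IsCliqueCovering (G.comap e) G e where
  adj h := h
  inj _ _ h := e.injective h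
  surj {x b} h := ⟨e.symm b, by simpa using h, by simp⟩
  triangle _ _ h := h

/-- The image is nonempty and closed under adjacency, and the base is connected. -/
theorem IsCliqueCovering.surjective {G : SimpleGraph W} {G' : SimpleGraph V} {φ : W → V}
    (hφ : IsCliqueCovering G G' φ) (hG : Nonempty W) (hG' : G'.Connected) :
    Function.Surjective φ := by
  obtain ⟨w⟩ := hG
  intro y
  obtain ⟨p⟩ := hG'.preconnected (φ w) y
  generalize hb : φ w = b at p
  induction p generalizing w with
  | nil => exact ⟨w, hb⟩
  | cons h p ih =>
    subst hb
    obtain ⟨w', -, h'⟩ := hφ.surj h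
    exact ih w' h'

theorem edgeGraph_cliqueComplex (G : SimpleGraph V) : edgeGraph (cliqueComplex G) = G := by
  ext x y
  constructor
  · rintro ⟨hne, s, ⟨-, hs⟩, hx, hy⟩
    exact hs hx hy hne
  · intro h
    classical
    refine ⟨h.ne, {x, y}, ⟨⟨x, by simp⟩, ?_⟩, by simp, by simp⟩
    simp only [Finset.coe_insert, Finset.coe_singleton]
    exact (SimpleGraph.isClique_pair).2 fun _ => h

theorem isConnectedComplex_cliqueComplex {G : SimpleGraph V} :
    IsConnectedComplex (cliqueComplex G) ↔ G.Connected := by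
  rw [IsConnectedComplex, edgeGraph_cliqueComplex]

theorem mem_star_cliqueComplex {G : SimpleGraph V} {x : V} {s : Finset V} :
    s ∈ star (cliqueComplex G) x ↔
      s.Nonempty ∧ G.IsClique (s : Set V) ∧ ∀ y ∈ s, y = x ∨ G.Adj x y := by
  classical
  constructor
  · rintro ⟨hs, t, ⟨-, ht⟩, hx, hst⟩
    refine ⟨hs, ht.subset (Finset.coe_subset.2 hst), fun y hy => ?_⟩
    by_cases h : y = x
    · exact Or.inl h
    · exact Or.inr (ht hx (hst hy) (Ne.symm h))
  · rintro ⟨hs, hc, hx⟩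
    refine ⟨hs, insert x s, ⟨⟨x, by simp⟩, ?_⟩, by simp, Finset.subset_insert x s⟩
    rw [Finset.coe_insert, SimpleGraph.isClique_insert]
    refine ⟨hc, fun y hy hne => ?_⟩
    rcases hx y hy with rfl | h
    · exact (hne rfl).elim
    · exact h

/-- The bijection between neighbourhoods extends to closed neighbourhoods, and `triangle` reflects
adjacency inside them. Cliques of a star therefore lift vertex by vertex. -/
theorem IsCliqueCovering.isSimplicialCovering {G : SimpleGraph W} {G' : SimpleGraph V} {φ : W → V}
    (hφ : IsCliqueCovering G G' φ) :
    IsSimplicialCovering (cliqueComplex G) (cliqueComplex G') φ := by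
  classical
  have himg : ∀ s : Finset W, G.IsClique (s : Set W) → G'.IsClique (s.image φ : Set V) := by
    intro s hs
    rw [Finset.coe_image]
    rintro _ ⟨y, hy, rfl⟩ _ ⟨z, hz, rfl⟩ hne
    exact hφ.adj (hs hy hz fun h => hne (h ▸ rfl))
  have hinj : ∀ {x y z}, (y = x ∨ G.Adj x y) → (z = x ∨ G.Adj x z) → φ y = φ z → y = z := by
    rintro x y z (rfl | hy) (rfl | hz) h
    · rfl
    · exact ((hφ.adj hz).ne h).elim
    · exact ((hφ.adj hy).ne h.symm).elim
    · exact hφ.inj hy hz h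
  have hsurj : ∀ {x b}, (b = φ x ∨ G'.Adj (φ x) b) → ∃ y, (y = x ∨ G.Adj x y) ∧ φ y = b := by
    rintro x b (rfl | h)
    · exact ⟨x, Or.inl rfl, rfl⟩
    · obtain ⟨y, hy, h⟩ := hφ.surj h
      exact ⟨y, Or.inr hy, h⟩
  have hadj : ∀ {x y z}, (y = x ∨ G.Adj x y) → (z = x ∨ G.Adj x z) → G'.Adj (φ y) (φ z) →
      G.Adj y z := by
    rintro x y z (rfl | hy) (rfl | hz) h
    · exact (h.ne rfl).elim
    · exact hz
    · exact hy.symm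
    · exact hφ.triangle hy hz h
  refine ⟨fun s hs => ⟨?_, ?_⟩, fun x => ⟨?_, ?_, ?_⟩⟩
  · obtain ⟨y, hy⟩ := hs.1
    exact ⟨φ y, Finset.mem_image.2 ⟨y, hy, rfl⟩⟩
  · simpa using himg s hs.2
  · intro s hs
    rw [mem_star_cliqueComplex] at hs ⊢
    obtain ⟨⟨y, hy⟩, hc, hx⟩ := hs
    refine ⟨⟨φ y, Finset.mem_image.2 ⟨y, hy, rfl⟩⟩, by simpa using himg s hc, fun b hb => ?_⟩
    obtain ⟨z, hz, rfl⟩ := Finset.mem_image.1 hb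
    rcases hx z hz with rfl | h
    · exact Or.inl rfl
    · exact Or.inr (hφ.adj h)
  · have key : ∀ s t : Finset W, s ∈ star (cliqueComplex G) x → t ∈ star (cliqueComplex G) x →
        s.image φ = t.image φ → s ⊆ t := by
      intro s t hs ht h y hy
      rw [mem_star_cliqueComplex] at hs ht
      have : φ y ∈ t.image φ := h ▸ Finset.mem_image.2 ⟨y, hy, rfl⟩
      obtain ⟨z, hz, hzy⟩ := Finset.mem_image.1 this
      rwa [← hinj (ht.2.2 z hz) (hs.2.2 y hy) hzy]
    intro s hs t ht h
    simp only at h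
    exact Finset.Subset.antisymm (key s t hs ht (by convert h)) (key t s ht hs (by convert h.symm))
  · intro t ht
    rw [mem_star_cliqueComplex] at ht
    obtain ⟨⟨b, hb⟩, hc, hx⟩ := ht
    have : Nonempty W := ⟨x⟩
    choose! g hg hg' using fun b hb => hsurj (hx b hb)
    have him : (t.image g).image φ = t := by
      rw [Finset.image_image]
      ext b
      simp only [Finset.mem_image, Function.comp_apply]
      constructor
      · rintro ⟨b', h, rfl⟩
        rwa [hg' b' h]
      · exact fun h => ⟨b, h, hg' b h⟩
    refine ⟨t.image g, ?_, by convert him⟩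
    rw [mem_star_cliqueComplex]
    refine ⟨⟨g b, Finset.mem_image.2 ⟨b, hb, rfl⟩⟩, ?_, ?_⟩
    · rw [Finset.coe_image]
      rintro _ ⟨y, hy, rfl⟩ _ ⟨z, hz, rfl⟩ hne
      refine hadj (hg y hy) (hg z hz) ?_
      rw [hg' y hy, hg' z hz]
      exact hc hy hz fun h => hne (h ▸ rfl)
    · intro y hy
      obtain ⟨b, hb, rfl⟩ := Finset.mem_image.1 hy
      exact hg b hb

theorem singleton_mem_star {K : AbstractSimplicialComplex V} {x y : V} {t : Finset V}
    (ht : t ∈ K.faces) (hx : x ∈ t) (hy : y ∈ t) : {y} ∈ star K x :=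
  ⟨⟨y, by simp⟩, t, ht, hx, by simpa using hy⟩

section

variable {L : AbstractSimplicialComplex W} {K : AbstractSimplicialComplex V} {φ : W → V}

theorem IsSimplicialCovering.eq_of_mem_face (h : IsSimplicialCovering L K φ) {x y z : W}
    (hy : {y} ∈ star L x) (hz : {z} ∈ star L x) (e : φ y = φ z) : y = z :=
  Finset.singleton_injective ((h.bijOn_star x).injOn hy hz (by simp [e]))

theorem edgeGraph_adj_singleton {x y : W} (h : (edgeGraph L).Adj x y) : {y} ∈ star L x :=
  let ⟨_, _, hs, hx, hy⟩ := h
  singleton_mem_star hs hx hy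

theorem self_mem_star (L : AbstractSimplicialComplex W) (x : W) : {x} ∈ star L x :=
  singleton_mem_star (L.singleton_mem x) (by simp) (by simp)

/-- A neighbour lifts as a vertex of the star, a triangle as a simplex with three vertices. Whatever
lies over them is contained in a face through x, and this face supplies the edges upstairs. -/
theorem IsSimplicialCovering.isCliqueCovering_edgeGraph {G : SimpleGraph V}
    (h : IsSimplicialCovering L (cliqueComplex G) φ) : IsCliqueCovering (edgeGraph L) G φ := by
  classical
  have hadj : ∀ {x y}, (edgeGraph L).Adj x y → G.Adj (φ x) (φ y) := by
    intro x y hxy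
    have hne : φ x ≠ φ y := fun e =>
      hxy.1 (h.eq_of_mem_face (self_mem_star L x) (edgeGraph_adj_singleton hxy) e)
    obtain ⟨-, s, hs, hx, hy⟩ := hxy
    exact (h.map_face s hs).2 (by simpa using ⟨x, hx, rfl⟩) (by simpa using ⟨y, hy, rfl⟩) hne
  refine ⟨hadj, fun hy hz e => h.eq_of_mem_face (edgeGraph_adj_singleton hy)
    (edgeGraph_adj_singleton hz) e, ?_, ?_⟩
  · intro x b hb
    have hmem : {b} ∈ star (cliqueComplex G) (φ x) := by
      rw [mem_star_cliqueComplex]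
      exact ⟨⟨b, by simp⟩, by simp, fun y hy => Or.inr (by rwa [Finset.mem_singleton.1 hy])⟩
    obtain ⟨s, ⟨⟨y, hy⟩, t, ht, hx, hst⟩, e⟩ := (h.bijOn_star x).surjOn hmem
    simp only at e
    have hyb : φ y = b := by
      have : φ y ∈ ({b} : Finset V) := by rw [← e]; exact Finset.mem_image.2 ⟨y, hy, rfl⟩
      simpa using this
    exact ⟨y, ⟨fun e => hb.ne (e ▸ hyb), t, ht, hx, hst hy⟩, hyb⟩
  · intro x y z hy hz hyz
    have hmem : {φ x, φ y, φ z} ∈ star (cliqueComplex G) (φ x) := by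
      rw [mem_star_cliqueComplex]
      refine ⟨⟨φ x, by simp⟩, ?_, ?_⟩
      · have h1 := hadj hy
        have h2 := hadj hz
        simp only [Finset.coe_insert, Finset.coe_singleton, SimpleGraph.isClique_insert,
          SimpleGraph.isClique_singleton, Set.mem_singleton_iff, Set.mem_insert_iff]
        refine ⟨⟨trivial, ?_⟩, ?_⟩
        · rintro b rfl -; exact hyz
        · rintro b (rfl | rfl) -
          exacts [h1, h2]
      · intro b hb
        simp only [Finset.mem_insert, Finset.mem_singleton] at hb
        rcases hb with rfl | rfl | rfl
        exacts [Or.inl rfl, Or.inr (hadj hy), Or.inr (hadj hz)]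
    obtain ⟨s, ⟨-, t, ht, hx, hst⟩, e⟩ := (h.bijOn_star x).surjOn hmem
    simp only at e
    have key : ∀ {w}, (edgeGraph L).Adj x w → φ w ∈ ({φ x, φ y, φ z} : Finset V) → w ∈ t := by
      intro w hw hmem
      rw [← e] at hmem
      obtain ⟨w', hw', e'⟩ := Finset.mem_image.1 hmem
      rw [← h.eq_of_mem_face (singleton_mem_star ht hx (hst hw')) (edgeGraph_adj_singleton hw) e']
      exact hst hw'
    exact ⟨fun e => hyz.ne (e ▸ rfl), t, ht, key hy (by simp), key hz (by simp)⟩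

/-- A covering of a flag complex is flag. The image of a clique through x is a simplex of the star
below; the simplex over it lies in a face, and injectivity on the star identifies its vertices with
those of the clique. Arbitrary coverings of clique complexes thereby reduce to graph maps. -/
theorem IsSimplicialCovering.eq_cliqueComplex {G : SimpleGraph V}
    (h : IsSimplicialCovering L (cliqueComplex G) φ) : L = cliqueComplex (edgeGraph L) := by
  classical
  have hg := h.isCliqueCovering_edgeGraph
  refine AbstractSimplicialComplex.ext (Set.ext fun s => ⟨fun hs => ?_, fun hs => ?_⟩)
  · exact ⟨(L.isRelLowerSet_faces hs).1, fun x hx y hy hne => ⟨hne, s, hs, hx, hy⟩⟩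
  · obtain ⟨⟨x, hx⟩, hc⟩ := hs
    have hxs : ∀ y ∈ s, {y} ∈ star L x := by
      intro y hy
      by_cases e : x = y
      · subst e; exact self_mem_star L x
      · exact edgeGraph_adj_singleton (hc hx hy e)
    have hmem : s.image φ ∈ star (cliqueComplex G) (φ x) := by
      have hs : s ∈ star (cliqueComplex (edgeGraph L)) x := by
        refine mem_star_cliqueComplex.2 ⟨⟨x, hx⟩, hc, fun y hy => ?_⟩
        by_cases e : y = x
        · exact Or.inl e
        · exact Or.inr (hc hx hy (Ne.symm e))
      convert (hg.isSimplicialCovering.bijOn_star x).mapsTo hs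
    obtain ⟨s', ⟨-, t, ht, hxt, hst⟩, e⟩ := (h.bijOn_star x).surjOn hmem
    simp only at e
    refine (L.isRelLowerSet_faces ht).2 (fun y hy => ?_) ⟨x, hx⟩
    have hy' : φ y ∈ s.image φ := Finset.mem_image.2 ⟨y, hy, rfl⟩
    have : φ y ∈ s'.image φ := by convert hy'
    obtain ⟨y', hy', e'⟩ := Finset.mem_image.1 this
    rw [← h.eq_of_mem_face (singleton_mem_star ht hxt (hst hy')) (hxs y hy) e']
    exact hst hy'

theorem IsSimplicialCovering.comp {M : AbstractSimplicialComplex U} {ψ : V → U}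
    (hψ : IsSimplicialCovering K M ψ) (hφ : IsSimplicialCovering L K φ) :
    IsSimplicialCovering L M (ψ ∘ φ) := by
  classical
  constructor
  · intro s hs
    have := hψ.map_face _ (hφ.map_face s hs)
    rw [Finset.image_image] at this
    convert this
  · intro x
    refine ((hψ.bijOn_star (φ x)).comp (hφ.bijOn_star x)).congr fun s _ => ?_
    simp only [Function.comp_apply, Finset.image_image]

end

/-! ### Elementary homotopies and graph maps -/

theorem ElementaryMove.map {G : SimpleGraph W} {G' : SimpleGraph V} {φ : W → V}
    (hφ : ∀ {x y}, G.Adj x y → G'.Adj (φ x) (φ y)) {c c' : List W} (h : ElementaryMove G c c') :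
    ElementaryMove G' (c.map φ) (c'.map φ) := by
  cases h with
  | backtrack x y hab => simpa using .backtrack _ _ (hφ hab)
  | pushVertex x y hab hbc hca => simpa using .pushVertex _ _ (hφ hab) (hφ hbc) (hφ hca)
  | pushEdge x y hab hbc hca => simpa using .pushEdge _ _ (hφ hab) (hφ hbc) (hφ hca)
  | stutter x y a => simpa using .stutter _ _ (φ a)

theorem KContractible.map {G : SimpleGraph W} {G' : SimpleGraph V} {φ : W → V}
    (hφ : ∀ {x y}, G.Adj x y → G'.Adj (φ x) (φ y)) {k : ℕ} {c : List W} (h : KContractible G k c) :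
    KContractible G' k (c.map φ) := by
  induction h with
  | vertex k a => exact .vertex k (φ a)
  | step h _ ih => exact .step (h.imp (.map hφ) (.map hφ)) ih

theorem KContractible.mono {G : SimpleGraph V} {k l : ℕ} (hkl : k ≤ l) {c : List V}
    (h : KContractible G k c) : KContractible G l c := by
  induction h generalizing l with
  | vertex k a => exact .vertex l a
  | step h _ ih =>
    obtain ⟨l, rfl⟩ := Nat.exists_eq_add_of_le' (Nat.succ_le_iff.1 hkl |> Nat.succ_le_of_lt)
    exact .step h (ih (l := l + _) (by omega))

/-- Paths that may stop for a while at a vertex. -/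
abbrev IsLazyPath (G : SimpleGraph V) (c : List V) : Prop :=
  c.IsChain fun a b => a = b ∨ G.Adj a b

/-- A move changes a path only inside the star of one of its vertices. Insertions lift by `surj` and
`triangle`; a deleted closed subpath has a closed lift by `inj`. Lazy paths are needed because
stutters leave the class of paths. -/
theorem IsCliqueCovering.lift_homotopy {G : SimpleGraph W} {G' : SimpleGraph V} {φ : W → V}
    (hφ : IsCliqueCovering G G' φ) {c : List W} {d : List V} (hc : IsLazyPath G c)
    (h : ElementaryHomotopy G' (c.map φ) d) :
    ∃ c', c'.map φ = d ∧ IsLazyPath G c' ∧ ElementaryHomotopy G c c' := by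
  -- A pause upstairs cannot lie over an edge.
  have hadj : ∀ {a b}, (a = b ∨ G.Adj a b) → G'.Adj (φ a) (φ b) → G.Adj a b := by
    rintro a b (rfl | h) h'
    exacts [(h'.ne rfl).elim, h]
  generalize hd : c.map φ = e at h
  rcases h with h | h
  · cases h with
    | backtrack x y hab' =>
      obtain ⟨x, y0, rfl, rfl, hy0⟩ := List.map_eq_append_iff.1 hd
      obtain ⟨a, y, rfl, rfl, rfl⟩ := List.map_eq_cons_iff.1 hy0
      obtain ⟨b, hab, rfl⟩ := hφ.surj hab'
      refine ⟨x ++ a :: b :: a :: y, by simp, ?_, Or.inl (.backtrack x y hab)⟩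
      rw [IsLazyPath, List.isChain_split] at hc ⊢
      exact ⟨hc.1, by simpa [hab, hab.symm] using hc.2⟩
    | pushVertex x y hab' hbc' hca' =>
      obtain ⟨x, y0, rfl, rfl, hy0⟩ := List.map_eq_append_iff.1 hd
      obtain ⟨a, y, rfl, rfl, rfl⟩ := List.map_eq_cons_iff.1 hy0
      obtain ⟨b, hab, rfl⟩ := hφ.surj hab'
      obtain ⟨c, hac, rfl⟩ := hφ.surj hca'.symm
      have hbc := hφ.triangle hab hac hbc'
      refine ⟨x ++ a :: b :: c :: a :: y, by simp, ?_, Or.inl (.pushVertex x y hab hbc hac.symm)⟩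
      rw [IsLazyPath, List.isChain_split] at hc ⊢
      exact ⟨hc.1, by simpa [hab, hbc, hac.symm] using hc.2⟩
    | pushEdge x y hab' hbc' hca' =>
      obtain ⟨x, y0, rfl, rfl, hy0⟩ := List.map_eq_append_iff.1 hd
      obtain ⟨a, y1, rfl, rfl, hy1⟩ := List.map_eq_cons_iff.1 hy0
      obtain ⟨b, y, rfl, rfl, rfl⟩ := List.map_eq_cons_iff.1 hy1
      obtain ⟨c, hac, rfl⟩ := hφ.surj hca'.symm
      rw [IsLazyPath, List.isChain_split] at hc
      have h2 := hc.2
      rw [List.isChain_cons_cons] at h2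
      have hab := hadj h2.1 hab'
      have hbc := hφ.triangle hab hac hbc'
      refine ⟨x ++ a :: c :: b :: y, by simp, ?_, Or.inl (.pushEdge x y hab hbc hac.symm)⟩
      rw [IsLazyPath, List.isChain_split]
      exact ⟨hc.1, by simpa [hac, hbc.symm] using h2.2⟩
    | stutter x y a =>
      obtain ⟨x, y0, rfl, rfl, hy0⟩ := List.map_eq_append_iff.1 hd
      obtain ⟨a, y, rfl, rfl, rfl⟩ := List.map_eq_cons_iff.1 hy0
      refine ⟨x ++ a :: a :: y, by simp, ?_, Or.inl (.stutter x y a)⟩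
      rw [IsLazyPath, List.isChain_split] at hc ⊢
      exact ⟨hc.1, by simpa using hc.2⟩
  · cases h with
    | backtrack x y hab =>
      obtain ⟨x, y0, rfl, rfl, hy0⟩ := List.map_eq_append_iff.1 hd
      obtain ⟨a, y1, rfl, rfl, hy1⟩ := List.map_eq_cons_iff.1 hy0
      obtain ⟨b, y2, rfl, rfl, hy2⟩ := List.map_eq_cons_iff.1 hy1
      obtain ⟨a', y, rfl, ha, rfl⟩ := List.map_eq_cons_iff.1 hy2
      rw [IsLazyPath, List.isChain_split] at hc
      have h2 := hc.2
      rw [List.isChain_cons_cons, List.isChain_cons_cons] at h2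
      obtain ⟨h3, h4, h5⟩ := h2
      have h3 := hadj h3 hab
      have h4 := hadj h4 (by rw [ha]; exact hab.symm)
      obtain rfl := hφ.inj h4 h3.symm ha
      refine ⟨x ++ a' :: y, by simp, ?_, Or.inr (.backtrack x y h3)⟩
      rw [IsLazyPath, List.isChain_split]
      exact ⟨hc.1, h5⟩
    | pushVertex x y hab hbc hca =>
      obtain ⟨x, y0, rfl, rfl, hy0⟩ := List.map_eq_append_iff.1 hd
      obtain ⟨a, y1, rfl, rfl, hy1⟩ := List.map_eq_cons_iff.1 hy0
      obtain ⟨b, y2, rfl, rfl, hy2⟩ := List.map_eq_cons_iff.1 hy1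
      obtain ⟨c, y3, rfl, rfl, hy3⟩ := List.map_eq_cons_iff.1 hy2
      obtain ⟨a', y, rfl, ha, rfl⟩ := List.map_eq_cons_iff.1 hy3
      rw [IsLazyPath, List.isChain_split] at hc
      have h2 := hc.2
      rw [List.isChain_cons_cons, List.isChain_cons_cons, List.isChain_cons_cons] at h2
      obtain ⟨h3, h4, h5, h6⟩ := h2
      have h3 := hadj h3 hab
      have h4 := hadj h4 hbc
      have h5 := hadj h5 (by rwa [ha])
      have h7 := hφ.triangle h4 h3.symm hca
      obtain rfl := hφ.inj h5 h7 ha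
      refine ⟨x ++ a' :: y, by simp, ?_, Or.inr (.pushVertex x y h3 h4 h7)⟩
      rw [IsLazyPath, List.isChain_split]
      exact ⟨hc.1, h6⟩
    | pushEdge x y hab hbc hca =>
      obtain ⟨x, y0, rfl, rfl, hy0⟩ := List.map_eq_append_iff.1 hd
      obtain ⟨a, y1, rfl, rfl, hy1⟩ := List.map_eq_cons_iff.1 hy0
      obtain ⟨c, y2, rfl, rfl, hy2⟩ := List.map_eq_cons_iff.1 hy1
      obtain ⟨b, y, rfl, rfl, rfl⟩ := List.map_eq_cons_iff.1 hy2
      rw [IsLazyPath, List.isChain_split] at hc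
      have h2 := hc.2
      rw [List.isChain_cons_cons, List.isChain_cons_cons] at h2
      obtain ⟨h3, h4, h5⟩ := h2
      have h3 := hadj h3 hca.symm
      have h4 := hadj h4 hbc.symm
      have h6 := hφ.triangle h3.symm h4 hab
      refine ⟨x ++ a :: b :: y, by simp, ?_, Or.inr (.pushEdge x y h6 h4.symm h3.symm)⟩
      rw [IsLazyPath, List.isChain_split]
      exact ⟨hc.1, by simpa [h6] using h5⟩
    | stutter x y a =>
      obtain ⟨x, y0, rfl, rfl, hy0⟩ := List.map_eq_append_iff.1 hd
      obtain ⟨a, y1, rfl, rfl, hy1⟩ := List.map_eq_cons_iff.1 hy0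
      obtain ⟨a', y, rfl, ha, rfl⟩ := List.map_eq_cons_iff.1 hy1
      rw [IsLazyPath, List.isChain_split] at hc
      have h2 := hc.2
      rw [List.isChain_cons_cons] at h2
      obtain rfl : a = a' := h2.1.resolve_right fun h => (hφ.adj h).ne ha.symm
      refine ⟨x ++ a :: y, by simp, ?_, Or.inr (.stutter x y a)⟩
      rw [IsLazyPath, List.isChain_split]
      exact ⟨hc.1, h2.2⟩

/-- The lifted contraction ends in a list over a single vertex, hence in a single vertex. That c is
closed is a consequence and need not be assumed. -/
theorem IsCliqueCovering.kContractible_of_map {G : SimpleGraph W} {G' : SimpleGraph V} {φ : W → V}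
    (hφ : IsCliqueCovering G G' φ) {k : ℕ} {c : List W} (hc : IsLazyPath G c)
    (h : KContractible G' k (c.map φ)) : KContractible G k c := by
  generalize hd : c.map φ = d at h
  induction h generalizing c with
  | vertex k a =>
    obtain ⟨b, l, rfl, rfl, hl⟩ := List.map_eq_cons_iff.1 hd
    rw [List.map_eq_nil_iff] at hl
    subst hl
    exact .vertex k b
  | step h _ ih =>
    subst hd
    obtain ⟨c', rfl, hc', h'⟩ := hφ.lift_homotopy hc h
    exact .step h' (ih hc' rfl)

/-- A move changes the length by at most 3. The bound controls both the depth needed for lifting and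
the size of the search for contractions. -/
theorem KContractible.length_le {G : SimpleGraph V} {k : ℕ} {c : List V}
    (h : KContractible G k c) : c.length ≤ 3 * k + 1 := by
  induction h with
  | vertex k a => simp
  | step h _ ih => rcases h with h | h <;> cases h <;> simp at ih ⊢ <;> omega

theorem IsSimpleCycle.isLazyPath {G : SimpleGraph V} {c : List V} (h : IsSimpleCycle G c) :
    IsLazyPath G c :=
  h.chain.imp fun _ _ => Or.inr

end

/-! ### Labels and views -/

namespace Network

section

variable {V : Type u} {W : Type v} {N : Network V} {M : Network W}

theorem mem_label {x : V} {a : Option ℕ × Option ℕ × ℕ} : a ∈ N.label x ↔ a ∈ N.arcs x := by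
  rw [label, Finset.mem_sort, Set.Finite.mem_toFinset]

/-- A label is the sorted list of a set of arcs, so comparing labels amounts to comparing these
sets. -/
theorem label_eq_iff {x : V} {y : W} : N.label x = M.label y ↔ N.arcs x = M.arcs y := by
  constructor
  · intro h
    ext a
    rw [← mem_label, ← mem_label, h]
  · intro h
    unfold label
    congr 1
    ext a
    simp [h]

theorem mem_closedNbhd {x y : V} : y ∈ N.closedNbhd x ↔ y = x ∨ N.graph.Adj x y := Iff.rfl

theorem name_self (x : V) : N.name x x = none := by simp [name]

theorem name_of_adj {x y : V} (h : N.graph.Adj x y) : N.name x y = some (N.port x y) := by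
  simp [name, h.ne']

theorem name_eq_none {x y : V} : N.name x y = none ↔ y = x := by
  unfold name; split_ifs with h <;> simp [h]

theorem name_eq_some {x y : V} {p : ℕ} (hy : y ∈ N.closedNbhd x) (h : N.name x y = some p) :
    N.graph.Adj x y ∧ N.port x y = p := by
  rcases hy with rfl | hy
  · rw [name_self] at h; cases h
  · rw [name_of_adj hy] at h
    exact ⟨hy, Option.some.inj h⟩

theorem eq_of_port_eq {x y z : V} (hy : N.graph.Adj x y) (hz : N.graph.Adj x z)
    (h : N.port x y = N.port x z) : y = z :=
  N.port_injOn x hy hz h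

theorem mem_arcs_from {x y : V} (h : N.graph.Adj x y) :
    (none, some (N.port x y), N.port x y) ∈ N.arcs x :=
  ⟨x, Or.inl rfl, y, Or.inr h, h, by rw [name_self, name_of_adj h]⟩

theorem mem_arcs_to {x y : V} (h : N.graph.Adj x y) :
    (some (N.port x y), none, N.port y x) ∈ N.arcs x :=
  ⟨y, Or.inr h, x, Or.inl rfl, h.symm, by rw [name_self, name_of_adj h]⟩

theorem mem_arcs_between {x a b : V} (ha : N.graph.Adj x a) (hb : N.graph.Adj x b)
    (h : N.graph.Adj a b) : (some (N.port x a), some (N.port x b), N.port a b) ∈ N.arcs x :=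
  ⟨a, Or.inr ha, b, Or.inr hb, h, by rw [name_of_adj ha, name_of_adj hb]⟩

theorem exists_of_mem_arcs_from {x : V} {p r : ℕ} (h : (none, some p, r) ∈ N.arcs x) :
    ∃ y, N.graph.Adj x y ∧ N.port x y = p ∧ r = p := by
  obtain ⟨u, -, y, hy, huy, e⟩ := h
  simp only [Prod.mk.injEq] at e
  obtain rfl := name_eq_none.1 e.1.symm
  obtain ⟨h1, h2⟩ := name_eq_some hy e.2.1.symm
  exact ⟨y, h1, h2, e.2.2.trans h2⟩

theorem port_of_mem_arcs_to {x y : V} {r : ℕ} (hy : N.graph.Adj x y)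
    (h : (some (N.port x y), none, r) ∈ N.arcs x) : N.port y x = r := by
  obtain ⟨u, hu, z, hz, huz, e⟩ := h
  simp only [Prod.mk.injEq] at e
  obtain rfl := name_eq_none.1 e.2.1.symm
  obtain ⟨h1, h2⟩ := name_eq_some hu e.1.symm
  rw [← eq_of_port_eq h1 hy h2, e.2.2]

theorem adj_of_mem_arcs_between {x a b : V} {r : ℕ} (ha : N.graph.Adj x a) (hb : N.graph.Adj x b)
    (h : (some (N.port x a), some (N.port x b), r) ∈ N.arcs x) :
    N.graph.Adj a b ∧ N.port a b = r := by
  obtain ⟨u, hu, z, hz, huz, e⟩ := h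
  simp only [Prod.mk.injEq] at e
  obtain ⟨h1, h2⟩ := name_eq_some hu e.1.symm
  obtain ⟨h3, h4⟩ := name_eq_some hz e.2.1.symm
  rw [← eq_of_port_eq h1 ha h2, ← eq_of_port_eq h3 hb h4]
  exact ⟨huz, e.2.2.symm⟩

/-- Adjacent pairs of `N` and of `M` with the same port numbers. -/
def SamePorts (N : Network V) (M : Network W) (a b : V × W) : Prop :=
  N.graph.Adj a.1 b.1 ∧ M.graph.Adj a.2 b.2 ∧ N.port a.1 b.1 = M.port a.2 b.2 ∧
    N.port b.1 a.1 = M.port b.2 a.2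

theorem SamePorts.symm {a b : V × W} (h : SamePorts N M a b) : SamePorts N M b a :=
  ⟨h.1.symm, h.2.1.symm, h.2.2.2, h.2.2.1⟩

theorem SamePorts.eq_snd {a b c : V × W} (h : SamePorts N M a b) (h' : SamePorts N M a c)
    (e : b.1 = c.1) : b.2 = c.2 :=
  eq_of_port_eq h.2.1 h'.2.1 (by rw [← h.2.2.1, ← h'.2.2.1, e])

/-- The arc that leaves the centre provides a neighbour behind the same port; the arc that returns
fixes the port number at its other end. -/
theorem exists_samePorts {x a : V} {y : W} (h : N.label x = M.label y) (ha : N.graph.Adj x a) :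
    ∃ b, SamePorts N M (x, y) (a, b) := by
  rw [label_eq_iff] at h
  obtain ⟨b, hb, hp, -⟩ := exists_of_mem_arcs_from (h ▸ mem_arcs_from ha)
  have := mem_arcs_to ha
  rw [h, ← hp] at this
  exact ⟨b, ha, hb, hp.symm, (port_of_mem_arcs_to hb this).symm⟩

/-- This is where binoculars matter: an edge between two neighbours of x appears in the label of x,
in both directions. -/
theorem samePorts_triangle {x a b : V} {y a' b' : W} (h : N.label x = M.label y)
    (ha : SamePorts N M (x, y) (a, a')) (hb : SamePorts N M (x, y) (b, b'))
    (hab : N.graph.Adj a b) : SamePorts N M (a, a') (b, b') := by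
  rw [label_eq_iff] at h
  have h1 := mem_arcs_between ha.1 hb.1 hab
  have h2 := mem_arcs_between hb.1 ha.1 hab.symm
  have ea : N.port x a = M.port y a' := ha.2.2.1
  have eb : N.port x b = M.port y b' := hb.2.2.1
  rw [ea, eb, h] at h1 h2
  obtain ⟨h3, h4⟩ := adj_of_mem_arcs_between ha.2.1 hb.2.1 h1
  obtain ⟨-, h5⟩ := adj_of_mem_arcs_between hb.2.1 ha.2.1 h2
  exact ⟨hab, h3, h4.symm, h5.symm⟩

/-- `N.Follows x p y`: the path from `x` with port numbers `p` ends at `y`. -/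
def Follows (N : Network V) : V → PortPath → V → Prop
  | x, [], y => x = y
  | x, e :: p, y => ∃ z, N.graph.Adj x z ∧ (N.port x z, N.port z x) = e ∧ Follows N z p y

theorem Follows.unique {x y z : V} {p : PortPath} (hy : N.Follows x p y) (hz : N.Follows x p z) :
    y = z := by
  induction p generalizing x with
  | nil => exact hy.symm.trans hz
  | cons e p ih =>
    obtain ⟨a, ha, rfl, hy⟩ := hy
    obtain ⟨b, hb, h, hz⟩ := hz
    obtain rfl := eq_of_port_eq hb ha (Prod.mk.inj h).1
    exact ih hy hz

theorem follows_append {x z : V} {p q : PortPath} :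
    N.Follows x (p ++ q) z ↔ ∃ y, N.Follows x p y ∧ N.Follows y q z := by
  induction p generalizing x with
  | nil => simp [Follows]
  | cons e p ih =>
    simp only [List.cons_append, Follows, ih]
    constructor
    · rintro ⟨a, h1, h2, b, h3, h4⟩; exact ⟨b, ⟨a, h1, h2, h3⟩, h4⟩
    · rintro ⟨b, ⟨a, h1, h2, h3⟩, h4⟩; exact ⟨a, h1, h2, b, h3, h4⟩

theorem follows_singleton {x y : V} {e : ℕ × ℕ} :
    N.Follows x [e] y ↔ N.graph.Adj x y ∧ (N.port x y, N.port y x) = e := by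
  simp only [Follows]
  constructor
  · rintro ⟨_, h, h', rfl⟩; exact ⟨h, h'⟩
  · rintro ⟨h, h'⟩; exact ⟨y, h, h', rfl⟩

/-- Replaces the recursive tree by paths, the form in which views are used below. -/
theorem mem_view {d : ℕ} {x : V} {p : PortPath} {L : Label} :
    (p, L) ∈ N.view d x ↔ p.length ≤ d ∧ ∃ y, N.Follows x p y ∧ L = N.label y := by
  induction d generalizing x p with
  | zero =>
    simp only [view, Set.mem_singleton_iff, Prod.mk.injEq, Nat.le_zero_eq, List.length_eq_zero_iff]
    constructor
    · rintro ⟨rfl, rfl⟩; exact ⟨rfl, x, rfl, rfl⟩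
    · rintro ⟨rfl, y, rfl, rfl⟩; exact ⟨rfl, rfl⟩
  | succ d ih =>
    simp only [view, Set.mem_insert_iff, Set.mem_ofPred_eq]
    cases p with
    | nil =>
      simp only [Prod.mk.injEq, true_and, List.length_nil, Nat.zero_le, Follows]
      constructor
      · rintro (h | ⟨y, hy, e', he', h, -⟩)
        · exact ⟨x, rfl, h⟩
        · simp at h
      · rintro ⟨y, rfl, h⟩; exact Or.inl h
    | cons e p =>
      simp only [Prod.mk.injEq, reduceCtorEq, false_and, false_or, List.length_cons,
        Nat.add_le_add_iff_right, Follows, List.cons.injEq]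
      constructor
      · rintro ⟨y, hy, ⟨p', L'⟩, he', ⟨rfl, rfl⟩, rfl⟩
        obtain ⟨h, z, hz, h'⟩ := ih.1 he'
        exact ⟨h, z, ⟨y, hy, rfl, hz⟩, h'⟩
      · rintro ⟨h, z, ⟨y, hy, rfl, hz⟩, h'⟩
        exact ⟨y, hy, (p, L), ih.2 ⟨h, z, hz, h'⟩, ⟨rfl, rfl⟩, rfl⟩

theorem label_eq_of_view_eq {d : ℕ} {x : V} {y : W} (h : N.view d x = M.view d y) :
    N.label x = M.label y := by
  have : ([], N.label x) ∈ M.view d y := h ▸ mem_view.2 ⟨by simp, x, rfl, rfl⟩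
  obtain ⟨-, z, rfl, h⟩ := mem_view.1 this
  exact h

theorem view_eq_of_le {d d' : ℕ} {x : V} {y : W} (hd : d' ≤ d) (h : N.view d x = M.view d y) :
    N.view d' x = M.view d' y := by
  ext ⟨p, L⟩
  have := Set.ext_iff.1 h (p, L)
  rw [mem_view, mem_view] at this ⊢
  by_cases hp : p.length ≤ d'
  · simpa [hp, hp.trans hd] using this
  · simp [hp]

/-- Prepending the edge to a path shows that moving along an edge costs one level of the view. -/
theorem SamePorts.view_eq {d : ℕ} {a b : V × W} (hab : SamePorts N M a b)
    (h : N.view (d + 1) a.1 = M.view (d + 1) a.2) : N.view d b.1 = M.view d b.2 := by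
  ext ⟨p, L⟩
  have := Set.ext_iff.1 h ((N.port a.1 b.1, N.port b.1 a.1) :: p, L)
  rw [mem_view, mem_view] at this ⊢
  simp only [List.length_cons, Nat.add_le_add_iff_right, Follows] at this
  have h1 : ∀ y, (∃ z, N.graph.Adj a.1 z ∧ (N.port a.1 z, N.port z a.1) =
      (N.port a.1 b.1, N.port b.1 a.1) ∧ N.Follows z p y) ↔ N.Follows b.1 p y := by
    intro y
    constructor
    · rintro ⟨z, hz, e, hy⟩
      rwa [← eq_of_port_eq hz hab.1 (Prod.mk.inj e).1]
    · intro hy; exact ⟨b.1, hab.1, rfl, hy⟩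
  have h2 : ∀ y, (∃ z, M.graph.Adj a.2 z ∧ (M.port a.2 z, M.port z a.2) =
      (N.port a.1 b.1, N.port b.1 a.1) ∧ M.Follows z p y) ↔ M.Follows b.2 p y := by
    intro y
    rw [hab.2.2.1, hab.2.2.2]
    constructor
    · rintro ⟨z, hz, e, hy⟩
      rwa [← eq_of_port_eq hz hab.2.1 (Prod.mk.inj e).1]
    · intro hy; exact ⟨b.2, hab.2.1, rfl, hy⟩
  simpa only [h1, h2] using this

end

/-! ### Coverings of networks -/

/-- Maps between networks that preserve edges, port numbers and labels. -/
structure IsPortCovering {W : Type v} {V : Type u} (H : Network W) (N : Network V) (μ : W → V) :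
    Prop where
  adj : ∀ {x y}, H.graph.Adj x y → N.graph.Adj (μ x) (μ y)
  port : ∀ {x y}, H.graph.Adj x y → N.port (μ x) (μ y) = H.port x y
  label : ∀ x, H.label x = N.label (μ x)

section

variable {V : Type u} {W : Type v} {H : Network W} {N : Network V} {μ : W → V}

/-- Injectivity on neighbours comes from the port numbers, surjectivity and triangles from the
labels. -/
theorem IsPortCovering.isCliqueCovering (h : IsPortCovering H N μ) :
    IsCliqueCovering H.graph N.graph μ where
  adj := h.adj
  inj hy hz e := eq_of_port_eq hy hz (by rw [← h.port hy, ← h.port hz, e])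
  surj {x b} hb := by
    obtain ⟨y, hy⟩ := exists_samePorts (h.label x).symm hb
    exact ⟨y, hy.2.1, eq_of_port_eq (h.adj hy.2.1) hb ((h.port hy.2.1).trans hy.2.2.1.symm)⟩
  triangle {x y z} hy hz hyz :=
    (samePorts_triangle (h.label x).symm ⟨h.adj hy, hy, h.port hy, h.port hy.symm⟩
      ⟨h.adj hz, hz, h.port hz, h.port hz.symm⟩ hyz).2.1

theorem IsPortCovering.view_eq (h : IsPortCovering H N μ) (d : ℕ) (x : W) :
    H.view d x = N.view d (μ x) := by
  induction d generalizing x with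
  | zero => rw [view, view, h.label]
  | succ d ih =>
    rw [view, view, h.label]
    congr 1
    ext e
    constructor
    · rintro ⟨y, hy, e', he', rfl⟩
      exact ⟨μ y, h.adj hy, e', ih y ▸ he', by rw [h.port hy, h.port hy.symm]⟩
    · rintro ⟨b, hb, e', he', rfl⟩
      obtain ⟨y, hy, rfl⟩ := h.isCliqueCovering.surj hb
      exact ⟨y, hy, e', by rwa [ih y], by rw [h.port hy, h.port hy.symm]⟩

/-- The network structure on a covering graph. -/
def pullback (N : Network V) {G : SimpleGraph W} (hG : G.Connected)
    (hμ : IsCliqueCovering G N.graph μ) : Network W where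
  graph := G
  connected := hG
  locallyFinite x := by
    refine Set.Finite.of_finite_image (f := μ) ((N.locallyFinite (μ x)).subset ?_)
      fun y hy z hz e => hμ.inj hy hz e
    rintro _ ⟨y, hy, rfl⟩
    exact hμ.adj hy
  port x y := N.port (μ x) (μ y)
  port_injOn x y hy z hz e := hμ.inj hy hz (eq_of_port_eq (hμ.adj hy) (hμ.adj hz) e)

/-- Ports agree by construction; labels agree because a clique covering is an isomorphism between
the graphs induced on closed neighbourhoods. -/
theorem isPortCovering_pullback (N : Network V) {G : SimpleGraph W} (hG : G.Connected)
    (hμ : IsCliqueCovering G N.graph μ) : IsPortCovering (N.pullback hG hμ) N μ where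
  adj := hμ.adj
  port _ := rfl
  label x := by
    rw [label_eq_iff]
    have hname : ∀ y ∈ (N.pullback hG hμ).closedNbhd x,
        (N.pullback hG hμ).name x y = N.name (μ x) (μ y) := by
      rintro y (rfl | hy)
      · rw [name_self, name_self]
      · rw [name_of_adj hy, name_of_adj (hμ.adj hy)]; rfl
    have hmem : ∀ y ∈ (N.pullback hG hμ).closedNbhd x, μ y ∈ N.closedNbhd (μ x) := by
      rintro y (rfl | hy)
      exacts [Or.inl rfl, Or.inr (hμ.adj hy)]
    have hsurj : ∀ b ∈ N.closedNbhd (μ x), ∃ y ∈ (N.pullback hG hμ).closedNbhd x, μ y = b := by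
      rintro b (rfl | hb)
      · exact ⟨x, Or.inl rfl, rfl⟩
      · obtain ⟨y, hy, rfl⟩ := hμ.surj hb
        exact ⟨y, Or.inr hy, rfl⟩
    ext a
    constructor
    · rintro ⟨y, hy, z, hz, hyz, rfl⟩
      exact ⟨μ y, hmem y hy, μ z, hmem z hz, hμ.adj hyz, by rw [hname y hy, hname z hz]; rfl⟩
    · rintro ⟨b, hb, c, hc, hbc, rfl⟩
      obtain ⟨y, hy, rfl⟩ := hsurj b hb
      obtain ⟨z, hz, rfl⟩ := hsurj c hc
      refine ⟨y, hy, z, hz, ?_, by rw [hname y hy, hname z hz]; rfl⟩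
      rcases hy with rfl | hy <;> rcases hz with rfl | hz
      · exact (hbc.ne rfl).elim
      · exact hz
      · exact hy.symm
      · exact hμ.triangle hy hz hbc

/-- Port-preserving maps that agree at one vertex are equal. -/
theorem eq_of_port_preserving {μ' : W → V}
    (h : ∀ {x y}, H.graph.Adj x y → N.graph.Adj (μ x) (μ y) ∧ N.port (μ x) (μ y) = H.port x y)
    (h' : ∀ {x y}, H.graph.Adj x y → N.graph.Adj (μ' x) (μ' y) ∧ N.port (μ' x) (μ' y) = H.port x y)
    {x₀ : W} (h₀ : μ x₀ = μ' x₀) : μ = μ' := by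
  funext x
  obtain ⟨p⟩ := H.connected.preconnected x₀ x
  induction p with
  | nil => exact h₀
  | cons hxy p ih =>
    apply ih
    have h1 := h hxy
    have h2 := h' hxy
    rw [← h₀] at h2
    exact eq_of_port_eq h1.1 h2.1 (h1.2.trans h2.2.symm)

end

end Network

namespace Network

section

variable {W : Type v} {V : Type u} {H : Network W} {N : Network V}

/-! ### Lifting contractible loops through equal views -/

/-- Pairs of lazy paths with the same port numbers. -/
abbrev IsLazyPair (H : Network W) (N : Network V) (l : List (W × V)) : Prop :=
  l.IsChain fun a b => a = b ∨ SamePorts H N a b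

/-- Pairs of paths with the same port numbers. -/
abbrev IsPathPair (H : Network W) (N : Network V) (l : List (W × V)) : Prop :=
  l.IsChain (SamePorts H N)

theorem IsPathPair.isLazyPair {l : List (W × V)} (h : IsPathPair H N l) : IsLazyPair H N l :=
  h.imp fun _ _ => Or.inr

theorem IsPathPair.chain_fst {l : List (W × V)} (h : IsPathPair H N l) :
    (l.map Prod.fst).IsChain H.graph.Adj :=
  (List.isChain_map _).2 (h.imp fun _ _ h => h.1)

theorem IsLazyPair.reverse {l : List (W × V)} (h : IsLazyPair H N l) :
    IsLazyPair H N l.reverse :=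
  List.isChain_reverse.2 (h.imp fun _ _ h => h.imp Eq.symm SamePorts.symm)

/-- Each step costs at most one level; a pause costs none, but is charged all the same. -/
theorem IsLazyPair.view_eq {x y : List (W × V)} {s t : W × V}
    (h : IsLazyPair H N (x ++ t :: y)) (hs : (x ++ t :: y).head? = some s) {D : ℕ}
    (hv : H.view D s.1 = N.view D s.2) (hD : x.length ≤ D) :
    H.view (D - x.length) t.1 = N.view (D - x.length) t.2 := by
  induction x generalizing s D with
  | nil =>
    obtain rfl : t = s := by simpa using hs
    exact hv
  | cons a x ih =>
    obtain rfl : a = s := by simpa using hs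
    obtain ⟨D, rfl⟩ : ∃ D', D = D' + 1 := ⟨D - 1, by simp at hD; omega⟩
    obtain ⟨b, hb⟩ : ∃ b, (x ++ t :: y).head? = some b := by cases x <;> simp
    have h2 : (a = b ∨ SamePorts H N a b) ∧ IsLazyPair H N (x ++ t :: y) := by
      cases hxy : x ++ t :: y with
      | nil => simp at hxy
      | cons b' z =>
        rw [List.cons_append, hxy, IsLazyPair, List.isChain_cons_cons] at h
        obtain rfl : b' = b := by simpa [hxy] using hb
        exact h
    have hv' : H.view D b.1 = N.view D b.2 := by
      rcases h2.1 with rfl | h3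
      · exact view_eq_of_le (Nat.le_succ D) hv
      · exact h3.view_eq hv
    simpa using ih h2.2 hb hv' (by simpa using hD)

/-- On a closed path, t can be reached from s in either direction, and the shorter way has at most D
steps. -/
theorem IsLazyPair.label_eq {x y : List (W × V)} {s t : W × V}
    (h : IsLazyPair H N (x ++ t :: y)) (hs : (x ++ t :: y).head? = some s)
    (hs' : (x ++ t :: y).getLast? = some s) {D : ℕ}
    (hv : H.view D s.1 = N.view D s.2) (hD : x.length + y.length ≤ 2 * D + 1) :
    H.label t.1 = N.label t.2 := by
  by_cases hx : x.length ≤ D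
  · exact label_eq_of_view_eq (h.view_eq hs hv hx)
  · have h' := h.reverse
    simp only [List.reverse_append, List.reverse_cons, List.append_assoc, List.cons_append,
      List.nil_append] at h'
    refine label_eq_of_view_eq (h'.view_eq (s := s) ?_ hv (by simp; omega))
    rw [← hs', ← List.head?_reverse]
    simp

theorem head?_append_cons {α : Type*} (x y : List α) (a : α) :
    (x ++ a :: y).head? = (x ++ [a]).head? := by
  cases x <;> rfl

theorem getLast?_append_cons {α : Type*} (x y : List α) (a : α) :
    (x ++ a :: y).getLast? = (a :: y).getLast? := by
  rw [List.getLast?_append, List.getLast?_cons]; rfl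

theorem SamePorts.of_lazy {a b : W × V} (h : a = b ∨ SamePorts H N a b)
    (hab : H.graph.Adj a.1 b.1) : SamePorts H N a b :=
  h.resolve_left fun e => hab.ne (e ▸ rfl)

/-- The contraction is run backwards from the constant loop, which lifts. A move is carried over to
the lift by equality of the labels at the vertex where it happens. The hypothesis `hD` passes from c
to c' because a move adds at most 3 vertices and uses up one of the allowed moves. -/
theorem exists_closed_lift {k : ℕ} {c : List W} (hc : KContractible H.graph k c) {s : W × V}
    (hs : c.head? = some s.1) {D : ℕ} (hD : c.length + 3 * k ≤ 4 * D + 3)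
    (hv : H.view D s.1 = N.view D s.2) :
    ∃ l : List (W × V), l.map Prod.fst = c ∧ l.head? = some s ∧ l.getLast? = some s ∧
      IsLazyPair H N l := by
  induction hc with
  | vertex k a => exact ⟨[s], by simpa using hs.symm, rfl, rfl, by simp⟩
  | @step k c c' h h' ih =>
    have hlen := h'.length_le
    have hhead : c'.head? = c.head? := by
      rcases h with h | h <;> cases h <;> simp only [head?_append_cons]
    have hlen' : c'.length ≤ c.length + 3 := by
      rcases h with h | h <;> cases h <;> simp <;> omega
    obtain ⟨l, hl, hl1, hl2, hl3⟩ := ih (hhead.trans hs) (by omega)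
    -- The average of the bounds 3k + 1 and `c.length + 3` for c' is at most 2D + 2. Hence every
    -- vertex of the loop is within D steps of s along one of its two arcs.
    have hll : l.length ≤ 2 * D + 2 := by
      rw [← hl] at hlen hlen'
      simp only [List.length_map] at hlen hlen'
      omega
    have hlabel : ∀ {x t y}, l = x ++ t :: y → H.label t.1 = N.label t.2 := by
      rintro x t y rfl
      exact hl3.label_eq hl1 hl2 hv (by simp at hll; omega)
    generalize hd : c' = d at h hl
    rcases h with h | h
    · cases h with
      | @backtrack x y a b hab =>
        obtain ⟨x, y0, rfl, rfl, hy0⟩ := List.map_eq_append_iff.1 hl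
        obtain ⟨a, y1, rfl, rfl, hy1⟩ := List.map_eq_cons_iff.1 hy0
        obtain ⟨b, y2, rfl, rfl, hy2⟩ := List.map_eq_cons_iff.1 hy1
        obtain ⟨a', y, rfl, ha, rfl⟩ := List.map_eq_cons_iff.1 hy2
        rw [head?_append_cons] at hl1
        rw [getLast?_append_cons] at hl2
        rw [IsLazyPair, List.isChain_split, List.isChain_cons_cons, List.isChain_cons_cons] at hl3
        obtain ⟨h1, h2, h3, h4⟩ := hl3
        have h2 := SamePorts.of_lazy h2 hab
        have h3 := SamePorts.of_lazy h3 (by rw [ha]; exact hab.symm)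
        obtain rfl : a' = a := Prod.ext ha (h3.eq_snd h2.symm ha)
        refine ⟨x ++ a' :: y, by simp, by rwa [head?_append_cons], ?_, ?_⟩
        · rw [getLast?_append_cons]; simpa using hl2
        · rw [IsLazyPair, List.isChain_split]; exact ⟨h1, h4⟩
      | @pushVertex x y a b c hab hbc hca =>
        obtain ⟨x, y0, rfl, rfl, hy0⟩ := List.map_eq_append_iff.1 hl
        obtain ⟨a, y1, rfl, rfl, hy1⟩ := List.map_eq_cons_iff.1 hy0
        obtain ⟨b, y2, rfl, rfl, hy2⟩ := List.map_eq_cons_iff.1 hy1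
        obtain ⟨c, y3, rfl, rfl, hy3⟩ := List.map_eq_cons_iff.1 hy2
        obtain ⟨a', y, rfl, ha, rfl⟩ := List.map_eq_cons_iff.1 hy3
        have hlab := hlabel rfl
        rw [head?_append_cons] at hl1
        rw [getLast?_append_cons] at hl2
        rw [IsLazyPair, List.isChain_split, List.isChain_cons_cons, List.isChain_cons_cons,
          List.isChain_cons_cons] at hl3
        obtain ⟨h1, h2, h3, h4, h5⟩ := hl3
        have h2 := SamePorts.of_lazy h2 hab
        have h3 := SamePorts.of_lazy h3 hbc
        have h4 := SamePorts.of_lazy h4 (by rwa [ha])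
        -- The neighbour of the partner of a behind the port of c closes a triangle. Uniqueness of
        -- ports makes it the partner of c, so the lifted path does return to a.
        obtain ⟨c', hc'⟩ := exists_samePorts hlab hca.symm
        have h6 := samePorts_triangle hlab h2 hc' hbc
        have h7 : c.2 = c' := h3.eq_snd h6 rfl
        rw [← h7] at hc'
        obtain rfl : a' = a := Prod.ext ha (h4.eq_snd hc'.symm ha)
        refine ⟨x ++ a' :: y, by simp, by rwa [head?_append_cons], ?_, ?_⟩
        · rw [getLast?_append_cons]; simpa using hl2
        · rw [IsLazyPair, List.isChain_split]; exact ⟨h1, h5⟩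
      | @pushEdge x y a b c hab hbc hca =>
        obtain ⟨x, y0, rfl, rfl, hy0⟩ := List.map_eq_append_iff.1 hl
        obtain ⟨a, y1, rfl, rfl, hy1⟩ := List.map_eq_cons_iff.1 hy0
        obtain ⟨c, y2, rfl, rfl, hy2⟩ := List.map_eq_cons_iff.1 hy1
        obtain ⟨b, y, rfl, rfl, rfl⟩ := List.map_eq_cons_iff.1 hy2
        have hlab := hlabel rfl
        rw [head?_append_cons] at hl1
        rw [getLast?_append_cons] at hl2
        rw [IsLazyPair, List.isChain_split, List.isChain_cons_cons, List.isChain_cons_cons] at hl3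
        obtain ⟨h1, h2, h3, h4⟩ := hl3
        have h2 := SamePorts.of_lazy h2 hca.symm
        have h3 := SamePorts.of_lazy h3 hbc.symm
        -- The third vertex of the triangle, as seen from a, has to be the partner of b already
        -- reached through c.
        obtain ⟨b', hb'⟩ := exists_samePorts hlab hab
        have h6 := samePorts_triangle hlab h2 hb' hbc.symm
        have h7 : b.2 = b' := h3.eq_snd h6 rfl
        rw [← h7] at hb'
        refine ⟨x ++ a :: b :: y, by simp, by rwa [head?_append_cons], ?_, ?_⟩
        · rw [getLast?_append_cons]; simpa using hl2
        · rw [IsLazyPair, List.isChain_split, List.isChain_cons_cons]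
          exact ⟨h1, Or.inr hb', h4⟩
      | @stutter x y a =>
        obtain ⟨x, y0, rfl, rfl, hy0⟩ := List.map_eq_append_iff.1 hl
        obtain ⟨a, y1, rfl, rfl, hy1⟩ := List.map_eq_cons_iff.1 hy0
        obtain ⟨a', y, rfl, ha, rfl⟩ := List.map_eq_cons_iff.1 hy1
        rw [head?_append_cons] at hl1
        rw [getLast?_append_cons] at hl2
        rw [IsLazyPair, List.isChain_split, List.isChain_cons_cons] at hl3
        obtain ⟨h1, h2, h3⟩ := hl3
        obtain rfl : a = a' := h2.resolve_right fun h => h.1.ne ha.symm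
        refine ⟨x ++ a :: y, by simp, by rwa [head?_append_cons], ?_, ?_⟩
        · rw [getLast?_append_cons]; simpa using hl2
        · rw [IsLazyPair, List.isChain_split]; exact ⟨h1, h3⟩
    · cases h with
      | @backtrack x y a b hab =>
        obtain ⟨x, y0, rfl, rfl, hy0⟩ := List.map_eq_append_iff.1 hl
        obtain ⟨a, y, rfl, rfl, rfl⟩ := List.map_eq_cons_iff.1 hy0
        have hlab := hlabel rfl
        rw [head?_append_cons] at hl1
        rw [getLast?_append_cons] at hl2
        rw [IsLazyPair, List.isChain_split] at hl3
        obtain ⟨b', hb'⟩ := exists_samePorts hlab hab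
        refine ⟨x ++ a :: (b, b') :: a :: y, by simp, by rwa [head?_append_cons], ?_, ?_⟩
        · rw [getLast?_append_cons]; simpa using hl2
        · rw [IsLazyPair, List.isChain_split, List.isChain_cons_cons, List.isChain_cons_cons]
          exact ⟨hl3.1, Or.inr hb', Or.inr hb'.symm, hl3.2⟩
      | @pushVertex x y a b c hab hbc hca =>
        obtain ⟨x, y0, rfl, rfl, hy0⟩ := List.map_eq_append_iff.1 hl
        obtain ⟨a, y, rfl, rfl, rfl⟩ := List.map_eq_cons_iff.1 hy0
        have hlab := hlabel rfl
        rw [head?_append_cons] at hl1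
        rw [getLast?_append_cons] at hl2
        rw [IsLazyPair, List.isChain_split] at hl3
        obtain ⟨b', hb'⟩ := exists_samePorts hlab hab
        obtain ⟨c', hc'⟩ := exists_samePorts hlab hca.symm
        have h6 := samePorts_triangle hlab hb' hc' hbc
        refine ⟨x ++ a :: (b, b') :: (c, c') :: a :: y, by simp, by rwa [head?_append_cons], ?_, ?_⟩
        · rw [getLast?_append_cons]; simpa using hl2
        · rw [IsLazyPair, List.isChain_split, List.isChain_cons_cons, List.isChain_cons_cons,
            List.isChain_cons_cons]
          exact ⟨hl3.1, Or.inr hb', Or.inr h6, Or.inr hc'.symm, hl3.2⟩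
      | @pushEdge x y a b c hab hbc hca =>
        obtain ⟨x, y0, rfl, rfl, hy0⟩ := List.map_eq_append_iff.1 hl
        obtain ⟨a, y1, rfl, rfl, hy1⟩ := List.map_eq_cons_iff.1 hy0
        obtain ⟨b, y, rfl, rfl, rfl⟩ := List.map_eq_cons_iff.1 hy1
        have hlab := hlabel rfl
        rw [head?_append_cons] at hl1
        rw [getLast?_append_cons] at hl2
        rw [IsLazyPair, List.isChain_split, List.isChain_cons_cons] at hl3
        obtain ⟨h1, h2, h3⟩ := hl3
        have h2 := SamePorts.of_lazy h2 hab
        obtain ⟨c', hc'⟩ := exists_samePorts hlab hca.symm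
        have h6 := samePorts_triangle hlab hc' h2 hbc.symm
        refine ⟨x ++ a :: (c, c') :: b :: y, by simp, by rwa [head?_append_cons], ?_, ?_⟩
        · rw [getLast?_append_cons]; simpa using hl2
        · rw [IsLazyPair, List.isChain_split, List.isChain_cons_cons, List.isChain_cons_cons]
          exact ⟨h1, Or.inr hc', Or.inr h6, h3⟩
      | @stutter x y a =>
        obtain ⟨x, y0, rfl, rfl, hy0⟩ := List.map_eq_append_iff.1 hl
        obtain ⟨a, y, rfl, rfl, rfl⟩ := List.map_eq_cons_iff.1 hy0
        rw [head?_append_cons] at hl1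
        rw [getLast?_append_cons] at hl2
        rw [IsLazyPair, List.isChain_split] at hl3
        refine ⟨x ++ a :: a :: y, by simp, by rwa [head?_append_cons], ?_, ?_⟩
        · rw [getLast?_append_cons]; simpa using hl2
        · rw [IsLazyPair, List.isChain_split, List.isChain_cons_cons]
          exact ⟨hl3.1, Or.inl rfl, hl3.2⟩

/-- Two lifts of the same path that start at the same vertex agree as long as both are defined. -/
theorem IsLazyPair.prefix {l p : List (W × V)} {a : W × V} (hl : IsLazyPair H N (a :: l))
    (hp : IsPathPair H N (a :: p)) {x : List W} (h : l.map Prod.fst = p.map Prod.fst ++ x) :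
    ∃ r, l = p ++ r := by
  induction p generalizing a l with
  | nil => exact ⟨l, rfl⟩
  | cons b p ih =>
    obtain ⟨b', l, rfl, hb, hl'⟩ := List.map_eq_cons_iff.1 h
    rw [IsLazyPair, List.isChain_cons_cons] at hl
    rw [IsPathPair, List.isChain_cons_cons] at hp
    have h1 : SamePorts H N a b' := SamePorts.of_lazy hl.1 (by rw [hb]; exact hp.1.1)
    obtain rfl : b' = b := Prod.ext hb (h1.eq_snd hp.1 hb)
    obtain ⟨r, rfl⟩ := ih hl.2 hp.2 hl'
    exact ⟨r, rfl⟩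

end

end Network

theorem exists_first_mem {α : Type*} (p : α → Prop) {l : List α} (h : ∃ a ∈ l, p a) :
    ∃ x a y, l = x ++ a :: y ∧ p a ∧ ∀ b ∈ x, ¬ p b := by
  induction l with
  | nil => simp at h
  | cons b l ih =>
    by_cases hb : p b
    · exact ⟨[], b, l, rfl, hb, by simp⟩
    · obtain ⟨x, a, y, rfl, ha, hx⟩ := ih (by simpa [hb] using h)
      exact ⟨b :: x, a, y, rfl, ha, by simpa [hb] using hx⟩

/-! ### Monodromy: from equal views to a universal covering -/

namespace Network

section

variable {W : Type v} {V : Type u} {H : Network W} {N : Network V} {k : ℕ}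

theorem _root_.BinocularExploration.IsSimpleCycle.length_le {G : SimpleGraph W} [Finite W]
    {c : List W} (h : IsSimpleCycle G c) : c.length ≤ Nat.card W + 1 := by
  have := Fintype.ofFinite W
  have h1 := h.nodup.length_le_card
  rw [List.length_dropLast] at h1
  rw [Nat.card_eq_fintype_card]
  omega

/-- Two simple paths with the same ends have lifts with the same ends. -/
theorem path_lift_unique [Finite W] (hcard : Nat.card W < k)
    (hcyc : ∀ c, IsSimpleCycle H.graph c → KContractible H.graph k c) {n : ℕ}
    {P Q : List (W × V)} {t p q : W × V} {D : ℕ} (hn : P.length ≤ n)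
    (hP : IsPathPair H N (t :: P)) (hQ : IsPathPair H N (t :: Q))
    (hP' : ((t :: P).map Prod.fst).Nodup) (hQ' : ((t :: Q).map Prod.fst).Nodup)
    (hp : (t :: P).getLast? = some p) (hq : (t :: Q).getLast? = some q) (hpq : p.1 = q.1)
    (hv : H.view D t.1 = N.view D t.2) (hD : k + P.length ≤ D) : p = q := by
  induction n generalizing P Q t D with
  | zero =>
    obtain rfl : P = [] := by simpa using hn
    obtain rfl : t = p := by simpa using hp
    cases Q with
    | nil => simpa using hq
    | cons b Q =>
      rw [List.getLast?_cons_cons] at hq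
      have : q.1 ∈ (b :: Q).map Prod.fst := List.mem_map_of_mem (List.mem_of_getLast? hq)
      rw [← hpq] at this
      exact ((List.nodup_cons.1 hQ').1 this).elim
  | succ n ih =>
    cases P with
    | nil => exact ih (by simp) hP hQ hP' hQ' hp hq hv hD
    | cons a P =>
    rw [List.getLast?_cons_cons] at hp
    have hpP := List.mem_of_getLast? hp
    -- Some vertex of P after t lies on Q after t, namely the common end; the first such vertex is
    -- where the paths are cut.
    have hex : ∃ x ∈ a :: P, x.1 ∈ Q.map Prod.fst := by
      refine ⟨p, hpP, ?_⟩
      have hqm := List.mem_of_getLast? hq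
      rw [hpq]
      rcases List.mem_cons.1 hqm with rfl | h
      · rw [List.map_cons, List.nodup_cons, ← hpq] at hP'
        exact (hP'.1 (List.mem_map_of_mem hpP)).elim
      · exact List.mem_map_of_mem h
    generalize a :: P = P at *
    obtain ⟨P1, p', P2, rfl, hp', hP1⟩ := exists_first_mem _ hex
    obtain ⟨q', hq', hpq'⟩ := List.mem_map.1 hp'
    obtain ⟨Q1, Q2, rfl⟩ := List.append_of_mem hq'
    have hPc : IsPathPair H N (t :: (P1 ++ [p'])) ∧ IsPathPair H N (p' :: P2) := by
      rw [← List.cons_append, IsPathPair, List.isChain_split] at hP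
      exact hP
    have hQc : IsPathPair H N (t :: (Q1 ++ [q'])) ∧ IsPathPair H N (q' :: Q2) := by
      rw [← List.cons_append, IsPathPair, List.isChain_split] at hQ
      exact hQ
    -- Along `P1` to the first common vertex and back along `Q1`. The cycle is simple because no
    -- vertex of `P1` lies on Q.
    have hcycle : IsSimpleCycle H.graph
        (t.1 :: (P1.map Prod.fst ++ p'.1 :: ((Q1.map Prod.fst).reverse ++ [t.1]))) := by
      refine ⟨by simp, ?_, ?_, ?_⟩
      · rw [List.head?_cons, ← List.cons_append, getLast?_append_cons, ← List.cons_append,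
          List.getLast?_concat]
      · rw [← List.cons_append, List.isChain_split]
        refine ⟨by simpa using hPc.1.chain_fst, ?_⟩
        have := hQc.1.chain_fst
        have := List.isChain_reverse.2 (this.imp fun _ _ h => h.symm)
        simpa [hpq'] using this
      · have e : (t.1 :: (P1.map Prod.fst ++ p'.1 :: ((Q1.map Prod.fst).reverse ++ [t.1]))).dropLast
            = t.1 :: (P1.map Prod.fst ++ p'.1 :: (Q1.map Prod.fst).reverse) := by
          rw [show t.1 :: (P1.map Prod.fst ++ p'.1 :: ((Q1.map Prod.fst).reverse ++ [t.1])) =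
            (t.1 :: (P1.map Prod.fst ++ p'.1 :: (Q1.map Prod.fst).reverse)) ++ [t.1] by simp]
          exact List.dropLast_concat
        rw [e]
        simp only [List.map_cons, List.map_append, List.nodup_cons, List.mem_append, List.mem_cons,
          List.nodup_append, List.mem_reverse, List.nodup_reverse] at hP' hQ' ⊢
        refine ⟨fun h => ?_, hP'.2.1, ⟨?_, hQ'.2.1⟩, ?_⟩
        · rcases h with h | h | h
          · exact hP'.1 (Or.inl h)
          · exact hP'.1 (Or.inr (Or.inl h))
          · exact hQ'.1 (Or.inl h)
        · intro h
          exact hQ'.2.2.2 _ h _ (Or.inl rfl) hpq'.symm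
        · rintro x hx y (rfl | hy)
          · exact hP'.2.2.2 x hx _ (Or.inl rfl)
          · rintro rfl
            obtain ⟨z, hz, rfl⟩ := List.mem_map.1 hx
            exact hP1 z hz (by rw [List.map_append]; exact List.mem_append_left _ hy)
    have hlen := hcycle.length_le
    simp only [List.length_append, List.length_cons] at hD
    -- The cycle has at most |W| + 1 ≤ k entries and k ≤ D, so length plus 3k is at most 4D.
    obtain ⟨l, hl, hl1, hl2, hl3⟩ := exists_closed_lift (N := N) (s := t) (D := D)
      (hcyc _ hcycle) rfl (by omega) hv
    -- By unique lifting, the closed lift starts with the lift of `P1` when read forwards and with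
    -- that of `Q1` when read backwards. Both descriptions apply to the same entry.
    have hpq : p' = q' := by
      obtain ⟨l1, rfl⟩ : ∃ l1, l = t :: l1 := by
        cases l with
        | nil => simp at hl1
        | cons b l => exact ⟨l, by simpa using hl1⟩
      have hl1' : l1.map Prod.fst = (P1 ++ [p']).map Prod.fst ++
          ((Q1.map Prod.fst).reverse ++ [t.1]) := by simpa using hl
      obtain ⟨r, rfl⟩ := hl3.prefix hPc.1 hl1'
      have hr : r.map Prod.fst = (Q1.map Prod.fst).reverse ++ [t.1] := by
        rw [List.map_append] at hl1'
        exact List.append_cancel_left hl1'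
      obtain ⟨r, rfl⟩ : ∃ r', r = r' ++ [t] := by
        rcases List.eq_nil_or_concat' r with rfl | ⟨r', b, rfl⟩
        · simp at hr
        · refine ⟨r', ?_⟩
          have : (t :: (P1 ++ [p'] ++ (r' ++ [b]))).getLast? = some b := by
            rw [show t :: (P1 ++ [p'] ++ (r' ++ [b])) = (t :: (P1 ++ [p'] ++ r')) ++ [b] by simp,
              List.getLast?_concat]
          rw [this] at hl2
          rw [Option.some.inj hl2]
      have hr' : r.reverse.map Prod.fst = Q1.map Prod.fst := by
        rw [List.map_append, List.map_cons, List.map_nil] at hr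
        rw [List.map_reverse, List.append_cancel_right hr, List.reverse_reverse]
      have hrev := hl3.reverse
      rw [show (t :: (P1 ++ [p'] ++ (r ++ [t]))).reverse = t :: (r.reverse ++ p' ::
        (P1.reverse ++ [t])) by simp] at hrev
      obtain ⟨r', e⟩ := hrev.prefix hQc.1 (x := (P1.reverse ++ [t]).map Prod.fst)
        (by simp [← hr', hpq'])
      rw [List.append_assoc] at e
      have := (List.append_inj e (by simpa using congrArg List.length hr')).2
      exact (List.cons.inj this).1
    subst hpq
    -- Moving the base point to p' costs `P1.length + 1` levels and shortens P by as much, so `k +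
    -- P.length ≤ D` is maintained.
    have hv' := IsLazyPair.view_eq (x := t :: P1) (y := P2) (t := p') hP.isLazyPair rfl hv
      (by rw [List.length_cons]; omega)
    refine ih (P := P2) (Q := Q2) (by simp at hn; omega) hPc.2 hQc.2 ?_ ?_ ?_ ?_ hv'
      (by simp; omega)
    · rw [← List.cons_append, List.map_append] at hP'
      exact hP'.of_append_right
    · rw [← List.cons_append, List.map_append] at hQ'
      exact hQ'.of_append_right
    · rwa [getLast?_append_cons] at hp
    · rwa [← List.cons_append, getLast?_append_cons] at hq

/-- A finite network with contractible simple cycles covers every network with the same view. -/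
theorem exists_isPortCovering [Finite W] (hcard : Nat.card W < k)
    (hcyc : ∀ c, IsSimpleCycle H.graph c → KContractible H.graph k c) {h₀ : W} {x₀ : V}
    (hv : H.view (2 * k) h₀ = N.view (2 * k) x₀) :
    ∃ μ : W → V, IsPortCovering H N μ ∧ μ h₀ = x₀ := by
  -- The graph of the covering to be built.
  let E : W × V → Prop := fun p => ∃ P, IsPathPair H N ((h₀, x₀) :: P) ∧
    (((h₀, x₀) :: P).map Prod.fst).Nodup ∧ ((h₀, x₀) :: P).getLast? = some p
  have hlen : ∀ {P : List (W × V)}, (P.map Prod.fst).Nodup → P.length ≤ Nat.card W := by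
    intro P hP
    have := Fintype.ofFinite W
    simpa using hP.length_le_card
  have huniq : ∀ {p q}, E p → E q → p.1 = q.1 → p = q := by
    rintro p q ⟨P, hP, hP', hp⟩ ⟨Q, hQ, hQ', hq⟩ e
    refine path_lift_unique hcard hcyc le_rfl hP hQ hP' hQ' hp hq e hv ?_
    have := hlen hP'
    simp at this
    omega
  have hlabel : ∀ {p}, E p → H.label p.1 = N.label p.2 := by
    rintro p ⟨P, hP, hP', hp⟩
    have := hlen hP'
    obtain ⟨Q, hQ⟩ := List.getLast?_eq_some_iff.1 hp
    rw [hQ] at hP this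
    refine label_eq_of_view_eq (hP.isLazyPair.view_eq (by rw [← hQ]; rfl) hv ?_)
    simp at this
    omega
  -- If q lies over a new vertex, the path is extended. Otherwise the edge closes a simple cycle
  -- through a vertex of the path; its lift is closed, so q is the pair already on the path.
  have hstep : ∀ {p q}, E p → SamePorts H N p q → E q := by
    rintro p q ⟨P, hP, hP', hp⟩ hpq
    have hPlen := hlen hP'
    by_cases hmem : q.1 ∈ ((h₀, x₀) :: P).map Prod.fst
    · obtain ⟨q', hq', e⟩ := List.mem_map.1 hmem
      obtain ⟨P1, P2, hPe⟩ := List.append_of_mem hq'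
      have hhead : (P1 ++ q' :: P2).head? = some (h₀, x₀) := by rw [← hPe]; rfl
      rw [hPe] at hP hP' hp hPlen
      have hEq' : E q' := by
        obtain ⟨R, hR⟩ : ∃ R, P1 ++ [q'] = (h₀, x₀) :: R := by
          cases P1 with
          | nil => exact ⟨[], by simpa using hhead⟩
          | cons b P1 => exact ⟨P1 ++ [q'], by simpa using hhead⟩
        refine ⟨R, ?_, ?_, ?_⟩
        · rw [← hR]; exact ((List.isChain_split).1 hP).1
        · rw [← hR]
          refine hP'.sublist (List.Sublist.map _ ?_)
          simp
        · rw [← hR, List.getLast?_concat]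
      have hv' := hP.isLazyPair.view_eq hhead hv (by simp at hPlen; omega)
      rw [getLast?_append_cons] at hp
      have hc2 := ((List.isChain_split).1 hP).2
      have hchain : IsPathPair H N (q' :: (P2 ++ [q])) := by
        rw [← List.cons_append, IsPathPair, List.isChain_append]
        refine ⟨hc2, by simp, fun a ha b hb => ?_⟩
        rw [Option.mem_def, hp] at ha
        obtain rfl := Option.some.inj ha
        obtain rfl : q = b := by simpa using hb
        exact hpq
      have hcycle : IsSimpleCycle H.graph (q'.1 :: (P2.map Prod.fst ++ [q'.1])) := by
        refine ⟨by simp, ?_, ?_, ?_⟩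
        · rw [← List.cons_append, List.getLast?_concat]; rfl
        · have := hchain.chain_fst
          simpa [← e] using this
        · rw [← List.cons_append, List.dropLast_concat]
          rw [List.map_append] at hP'
          exact hP'.of_append_right
      have hclen := hcycle.length_le
      -- The path has fewer than k edges, so at q' a view of depth at least k is left, enough for a
      -- cycle with at most k entries.
      obtain ⟨l, hl, hl1, hl2, hl3⟩ := exists_closed_lift (N := N) (s := q')
        (D := 2 * k - P1.length) (hcyc _ hcycle) rfl (by simp at hPlen; omega) hv'
      obtain ⟨l1, rfl⟩ : ∃ l1, l = q' :: l1 := by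
        cases l with
        | nil => simp at hl1
        | cons b l => exact ⟨l, by simpa using hl1⟩
      obtain ⟨r, rfl⟩ := hl3.prefix hchain (x := []) (by simpa [e] using hl)
      obtain rfl : r = [] := by simpa using congrArg List.length hl
      rw [List.append_nil, ← List.cons_append, List.getLast?_concat] at hl2
      rwa [Option.some.inj hl2]
    · refine ⟨P ++ [q], ?_, ?_, ?_⟩
      · rw [← List.cons_append, IsPathPair, List.isChain_append]
        refine ⟨hP, by simp, fun a ha b hb => ?_⟩
        rw [Option.mem_def, hp] at ha
        obtain rfl := Option.some.inj ha
        obtain rfl : q = b := by simpa using hb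
        exact hpq
      · rw [← List.cons_append, List.map_append, List.nodup_append]
        refine ⟨hP', by simp, ?_⟩
        rintro a ha b hb rfl
        obtain rfl : a = q.1 := by simpa using hb
        exact hmem ha
      · rw [← List.cons_append, List.getLast?_concat]
  have hE₀ : E (h₀, x₀) := ⟨[], by simp, by simp, rfl⟩
  have hex : ∀ h, ∃ y, E (h, y) := by
    intro h
    obtain ⟨w⟩ := H.connected.preconnected h₀ h
    have key : ∀ {a b : W} (w : H.graph.Walk a b) y, E (a, y) → ∃ z, E (b, z) := by
      intro a b w
      induction w with
      | nil => exact fun y hy => ⟨y, hy⟩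
      | cons hab _ ih =>
        intro y hy
        obtain ⟨z, hz⟩ := exists_samePorts (hlabel hy) hab
        exact ih z (hstep hy hz)
    exact key w x₀ hE₀
  choose μ hμ using hex
  have hsame : ∀ {x y}, H.graph.Adj x y → SamePorts H N (x, μ x) (y, μ y) := by
    intro x y hxy
    obtain ⟨z, hz⟩ := exists_samePorts (hlabel (hμ x)) hxy
    obtain rfl : μ y = z := congrArg Prod.snd (huniq (hμ y) (hstep (hμ x) hz) rfl)
    exact hz
  exact ⟨μ, ⟨fun h => (hsame h).2.1, fun h => (hsame h).2.2.1.symm, fun x => hlabel (hμ x)⟩,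
    congrArg Prod.snd (huniq (hμ h₀) hE₀ rfl)⟩

/-- A finite network with contractible simple cycles is the universal cover of every network with
the same view. -/
theorem exists_isUniversalCover [Finite W] (hcard : Nat.card W < k)
    (hcyc : ∀ c, IsSimpleCycle H.graph c → KContractible H.graph k c) {h₀ : W} {x₀ : V}
    (hv : H.view (2 * k) h₀ = N.view (2 * k) x₀) :
    ∃ μ : W → V, IsPortCovering H N μ ∧ μ h₀ = x₀ ∧
      IsUniversalCover (cliqueComplex H.graph) (cliqueComplex N.graph) μ := by
  obtain ⟨μ, hμ, h0⟩ := exists_isPortCovering hcard hcyc hv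
  refine ⟨μ, hμ, h0, isConnectedComplex_cliqueComplex.2 H.connected,
    hμ.isCliqueCovering.isSimplicialCovering, ?_⟩
  -- With the ports pulled back, L is a network with the same views, so the construction applies to
  -- L. The resulting triangle of maps commutes because both sides preserve ports and agree at `h₀`.
  intro U L φ hL hφ
  have hg := hφ.isCliqueCovering_edgeGraph
  obtain ⟨u₀, hu₀⟩ := hg.surjective hL.nonempty N.connected x₀
  have hpull := isPortCovering_pullback N hL hg
  obtain ⟨γ, hγ, hγ0⟩ := exists_isPortCovering (N := N.pullback hL hg) (x₀ := u₀) hcard hcyc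
    (by rw [hpull.view_eq, hu₀, hv])
  refine ⟨γ, ?_, ?_⟩
  · rw [hφ.eq_cliqueComplex]
    exact hγ.isCliqueCovering.isSimplicialCovering
  · refine eq_of_port_preserving (H := H) (N := N) (x₀ := h₀)
      (fun h => ⟨hpull.adj (hγ.adj h), (hpull.port (hγ.adj h)).trans (hγ.port h)⟩)
      (fun h => ⟨hμ.adj h, hμ.port h⟩) ?_
    rw [Function.comp_apply, hγ0, hu₀, h0]

end

end Network

section

variable {V : Type u} {W : Type v}

/-! ### The simply connected cover -/

/-- Homotopy of vertex sequences. -/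
abbrev Homotopic (G : SimpleGraph V) : List V → List V → Prop :=
  Relation.ReflTransGen (ElementaryHomotopy G)

namespace Homotopic

variable {G : SimpleGraph V} {c d : List V}

protected theorem symm (h : Homotopic G c d) : Homotopic G d c :=
  have : Std.Symm (ElementaryHomotopy G) := ⟨fun _ _ h => Or.symm h⟩
  (Relation.ReflTransGen.stdSymm).symm _ _ h

theorem _root_.BinocularExploration.ElementaryMove.append_left {c d : List V}
    (h : ElementaryMove G c d) (z : List V) : ElementaryMove G (z ++ c) (z ++ d) := by
  cases h with
  | backtrack x y hab => simpa using ElementaryMove.backtrack (z ++ x) y hab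
  | pushVertex x y hab hbc hca => simpa using ElementaryMove.pushVertex (z ++ x) y hab hbc hca
  | pushEdge x y hab hbc hca => simpa using ElementaryMove.pushEdge (z ++ x) y hab hbc hca
  | stutter x y a => simpa using ElementaryMove.stutter (z ++ x) y a

theorem _root_.BinocularExploration.ElementaryMove.append_right {c d : List V}
    (h : ElementaryMove G c d) (z : List V) : ElementaryMove G (c ++ z) (d ++ z) := by
  cases h with
  | backtrack x y hab => simpa using ElementaryMove.backtrack x (y ++ z) hab
  | pushVertex x y hab hbc hca => simpa using ElementaryMove.pushVertex x (y ++ z) hab hbc hca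
  | pushEdge x y hab hbc hca => simpa using ElementaryMove.pushEdge x (y ++ z) hab hbc hca
  | stutter x y a => simpa using ElementaryMove.stutter x (y ++ z) a

theorem append_left (h : Homotopic G c d) (z : List V) : Homotopic G (z ++ c) (z ++ d) :=
  h.lift (z ++ ·) fun _ _ h => h.imp (·.append_left z) (·.append_left z)

theorem append_right (h : Homotopic G c d) (z : List V) : Homotopic G (c ++ z) (d ++ z) :=
  h.lift (· ++ z) fun _ _ h => h.imp (·.append_right z) (·.append_right z)

theorem of_move (h : ElementaryMove G c d) : Homotopic G c d := .single (Or.inl h)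

/-- Moves fix the last vertex, which makes the projection of the cover well defined. -/
theorem getLast?_eq (h : Homotopic G c d) : c.getLast? = d.getLast? := by
  have key : ∀ {c d : List V}, ElementaryMove G c d → c.getLast? = d.getLast? := by
    intro c d h
    cases h <;> simp only [Network.getLast?_append_cons,
      List.getLast?_cons_cons]
  induction h with
  | refl => rfl
  | tail _ h ih => exact ih.trans (h.elim key fun h => (key h).symm)

theorem exists_kContractible {a : V} (h : Homotopic G c [a]) : ∃ k, KContractible G k c := by
  induction h using Relation.ReflTransGen.head_induction_on with
  | refl => exact ⟨0, .vertex 0 a⟩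
  | head h _ ih =>
    obtain ⟨k, hk⟩ := ih
    exact ⟨k + 1, .step h hk⟩

/-- A path preceded by its inverse is homotopic to its end. -/
theorem reverse_append (a : V) {p : List V} (h : (a :: p).IsChain G.Adj) :
    ∃ b, (a :: p).getLast? = some b ∧ Homotopic G (p.reverse ++ a :: p) [b] := by
  induction p generalizing a with
  | nil => exact ⟨a, rfl, .refl⟩
  | cons c p ih =>
    rw [List.isChain_cons_cons] at h
    obtain ⟨b, hb, h'⟩ := ih c h.2
    refine ⟨b, by rwa [List.getLast?_cons_cons], ?_⟩
    refine .head (Or.inr ?_) h'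
    simpa using ElementaryMove.backtrack p.reverse p h.1.symm

end Homotopic

/-- Paths from `x₀`. -/
abbrev PathFrom (G : SimpleGraph V) (x₀ : V) : Type u :=
  {c : List V // c.head? = some x₀ ∧ c.IsChain G.Adj}

namespace PathFrom

variable {G : SimpleGraph V} {x₀ : V}

instance homotopySetoid (G : SimpleGraph V) (x₀ : V) : Setoid (PathFrom G x₀) where
  r p q := Homotopic G p.1 q.1
  iseqv := ⟨fun _ => .refl, Homotopic.symm, .trans⟩

/-- The end of a path. -/
def last (p : PathFrom G x₀) : V := (p.1.getLast?).getD x₀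

theorem getLast?_eq (p : PathFrom G x₀) : p.1.getLast? = some p.last := by
  obtain ⟨p, hp⟩ := p
  cases h : p.getLast? with
  | none =>
    rw [List.getLast?_eq_none_iff] at h
    simp [h] at hp
  | some a => simp [last, h]

/-- Extension of a path by an edge. -/
def snoc (p : PathFrom G x₀) {b : V} (h : G.Adj p.last b) : PathFrom G x₀ :=
  ⟨p.1 ++ [b], by simp [List.head?_append, p.2.1], by
    rw [List.isChain_append]
    refine ⟨p.2.2, by simp, fun x hx y hy => ?_⟩
    rw [Option.mem_def, p.getLast?_eq] at hx
    obtain rfl := Option.some.inj hx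
    obtain rfl : b = y := by simpa using hy
    exact h⟩

theorem last_snoc (p : PathFrom G x₀) {b : V} (h : G.Adj p.last b) : (p.snoc h).last = b := by
  simp [last, snoc]

end PathFrom

/-- Homotopy classes of paths from `x₀`. -/
abbrev HomotopyCover (G : SimpleGraph V) (x₀ : V) : Type u :=
  Quotient (PathFrom.homotopySetoid G x₀)

namespace HomotopyCover

variable {G : SimpleGraph V} {x₀ : V}

/-- The projection of the cover. -/
def proj : HomotopyCover G x₀ → V :=
  Quotient.lift PathFrom.last fun p q h => by
    simpa [PathFrom.getLast?_eq] using Homotopic.getLast?_eq h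

theorem last_out (u : HomotopyCover G x₀) : u.out.last = proj u := by
  conv_rhs => rw [← Quotient.out_eq u]
  rfl

theorem exists_concat (p : PathFrom G x₀) : ∃ c, p.1 = c ++ [p.last] :=
  List.getLast?_eq_some_iff.1 p.getLast?_eq

/-- The edges of the cover. -/
def graph (G : SimpleGraph V) (x₀ : V) : SimpleGraph (HomotopyCover G x₀) where
  Adj u v := G.Adj (proj u) (proj v) ∧ Homotopic G v.out.1 (u.out.1 ++ [proj v])
  -- Returning along the edge just added is a backtrack.
  symm := ⟨fun u v h => by
    refine ⟨h.1.symm, ?_⟩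
    refine .trans ?_ (h.2.append_right [proj u]).symm
    obtain ⟨c, hc⟩ := exists_concat u.out
    rw [hc, last_out]
    simpa using Homotopic.of_move (.backtrack c [] h.1)⟩
  loopless := ⟨fun u h => h.1.ne rfl⟩

/-- Adjacency, defined through chosen representatives, does not depend on them. -/
theorem adj_mk {p q : PathFrom G x₀} : (graph G x₀).Adj ⟦p⟧ ⟦q⟧ ↔
    G.Adj p.last q.last ∧ Homotopic G q.1 (p.1 ++ [q.last]) := by
  have hp : Homotopic G (⟦p⟧ : HomotopyCover G x₀).out.1 p.1 := Quotient.mk_out p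
  have hq : Homotopic G (⟦q⟧ : HomotopyCover G x₀).out.1 q.1 := Quotient.mk_out q
  refine and_congr Iff.rfl ⟨fun h => ?_, fun h => ?_⟩
  · exact hq.symm.trans (h.trans (hp.append_right _))
  · exact hq.trans (h.trans (hp.append_right _).symm)

theorem adj_snoc (p : PathFrom G x₀) {b : V} (h : G.Adj p.last b) :
    (graph G x₀).Adj ⟦p⟧ ⟦p.snoc h⟧ := by
  rw [adj_mk, PathFrom.last_snoc]
  exact ⟨h, .refl⟩

/-- A neighbour of a class is its extension by one edge, hence determined by its projection. Over a
triangle, the two extensions are adjacent because the last edge can be pushed across the triangle.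
-/
theorem isCliqueCovering : IsCliqueCovering (graph G x₀) G proj where
  adj h := h.1
  inj {x y z} hy hz e := by
    rw [← Quotient.out_eq y, ← Quotient.out_eq z]
    refine Quotient.sound (hy.2.trans ?_)
    rw [e]
    exact hz.2.symm
  surj {x b} h := by
    induction x using Quotient.inductionOn with
    | h p => exact ⟨⟦p.snoc h⟧, adj_snoc p h, p.last_snoc h⟩
  triangle {x y z} hy hz h := by
    refine ⟨h, ?_⟩
    refine hz.2.trans (Homotopic.symm ((hy.2.append_right [proj z]).trans ?_))
    obtain ⟨c, hc⟩ := exists_concat x.out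
    rw [hc, last_out]
    refine .single (Or.inr ?_)
    simpa using ElementaryMove.pushEdge c [] hz.1 h.symm hy.1.symm

/-- The initial segments of a path join the constant path to it. -/
theorem connected : (graph G x₀).Connected := by
  have key : ∀ (c : List V) (h : c.head? = some x₀ ∧ c.IsChain G.Adj),
      (graph G x₀).Reachable ⟦⟨[x₀], by simp⟩⟧ ⟦⟨c, h⟩⟧ := by
    intro c
    induction c using List.reverseRecOn with
    | nil => intro h; simp at h
    | append_singleton c b ih =>
      intro h
      rcases List.eq_nil_or_concat' c with rfl | ⟨c', a, rfl⟩
      · obtain rfl : b = x₀ := by simpa using h.1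
        exact .rfl
      · have h1 : (c' ++ [a]).head? = some x₀ ∧ (c' ++ [a]).IsChain G.Adj := by
          rw [List.isChain_append] at h
          exact ⟨by rw [← h.1]; simp, h.2.1⟩
        refine (ih h1).trans (SimpleGraph.Adj.reachable ?_)
        rw [adj_mk]
        have e1 : PathFrom.last ⟨c' ++ [a], h1⟩ = a := by simp [PathFrom.last]
        have e2 : PathFrom.last ⟨c' ++ [a] ++ [b], h⟩ = b := by simp [PathFrom.last]
        rw [e1, e2]
        refine ⟨?_, .refl⟩
        have := h.2
        rw [List.append_assoc, List.cons_append, List.nil_append, List.isChain_split,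
          List.isChain_cons_cons] at this
        exact this.2.1
  have : Nonempty (HomotopyCover G x₀) := ⟨⟦⟨[x₀], by simp⟩⟧⟩
  refine ⟨fun u v => ?_⟩
  obtain ⟨p, rfl⟩ := Quotient.exists_rep u
  obtain ⟨q, rfl⟩ := Quotient.exists_rep v
  exact (key p.1 p.2).symm.trans (key q.1 q.2)

end HomotopyCover

/-- Closed paths of a universal cover are contractible. -/
theorem IsUniversalCover.exists_kContractible {K : AbstractSimplicialComplex W}
    {G : SimpleGraph V} (hG : G.Connected) {μ : W → V}
    (hμ : IsUniversalCover K (cliqueComplex G) μ) {c : List W} (hc : c.IsChain (edgeGraph K).Adj)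
    {w : W} (hw : c.head? = some w) (hw' : c.getLast? = some w) :
    ∃ k, KContractible (edgeGraph K) k c := by
  obtain ⟨x₀⟩ := hG.nonempty
  have hcov := hμ.covering.isCliqueCovering_edgeGraph
  -- The cover by homotopy classes is the test object: a universal cover has to map to it.
  obtain ⟨γ, hγ, hγμ⟩ := hμ.universal (cliqueComplex (HomotopyCover.graph G x₀))
    HomotopyCover.proj (isConnectedComplex_cliqueComplex.2 HomotopyCover.connected)
    HomotopyCover.isCliqueCovering.isSimplicialCovering
  have hγ' := hγ.isCliqueCovering_edgeGraph
  have hproj : ∀ w, HomotopyCover.proj (γ w) = μ w := fun w => congrFun hγμ w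
  -- Walking along r in K multiplies the class attached to its start by the image of r.
  have hpath : ∀ (r : List W) (w w' : W), (w :: r).IsChain (edgeGraph K).Adj →
      (w :: r).getLast? = some w' → Homotopic G (γ w').out.1 ((γ w).out.1 ++ r.map μ) := by
    intro r
    induction r with
    | nil =>
      intro w w' _ h
      obtain rfl : w = w' := by simpa using h
      simpa using Relation.ReflTransGen.refl
    | cons a r ih =>
      intro w w' h h'
      rw [List.isChain_cons_cons] at h
      rw [List.getLast?_cons_cons] at h'
      have h1 := (hγ'.adj h.1).2
      rw [hproj] at h1
      have := (ih a w' h.2 h').trans (h1.append_right (r.map μ))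
      simpa using this
  obtain ⟨r, rfl⟩ : ∃ r, c = w :: r := by
    cases c with
    | nil => simp at hw
    | cons b r => exact ⟨r, by simpa using hw⟩
  have h1 := hpath r w w hc hw'
  have hlast := (γ w).out.getLast?_eq
  rw [HomotopyCover.last_out, hproj] at hlast
  have hp := (γ w).out.2
  generalize (γ w).out.1 = p at h1 hlast hp
  cases p with
  | nil => simp at hp
  | cons a p =>
    obtain ⟨b, hb, h2⟩ := Homotopic.reverse_append a hp.2
    obtain rfl : μ w = b := Option.some.inj (hlast.symm.trans hb)
    -- The path attached to w is homotopic to itself followed by the image of the loop; cancelling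
    -- it against its inverse contracts that image. The contraction then lifts to K.
    have h3 : Homotopic G ((w :: r).map μ) [μ w] := by
      refine .trans ?_ h2
      refine .trans ?_ (h1.append_left p.reverse).symm
      simpa using (h2.append_right (r.map μ)).symm
    obtain ⟨k, hk⟩ := h3.exists_kContractible
    exact ⟨k, hcov.kContractible_of_map (hc.imp fun _ _ => Or.inr) hk⟩

end

/-! ### Finite universal covers as networks -/

namespace Network

variable {V : Type u}

/-- On a graph with finite universal cover, some phase of the algorithm is successful. -/
theorem exists_network_of_FNT (N : Network V) (x₀ : V) (h : FNT N.graph) :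
    ∃ (k n : ℕ) (H : Network (Fin n)) (h₀ : Fin n), n < k ∧ (∀ d, H.view d h₀ = N.view d x₀) ∧
      ∀ c, IsSimpleCycle H.graph c → KContractible H.graph k c := by
  obtain ⟨W, K, μ, hW, hμ⟩ := h
  obtain ⟨n, ⟨e⟩⟩ := Finite.exists_equiv_fin W
  have e := e.symm
  have hcov := hμ.covering.isCliqueCovering_edgeGraph
  have he := IsCliqueCovering.comap_equiv (edgeGraph K) e
  have hconn : ((edgeGraph K).comap e).Connected :=
    (SimpleGraph.Iso.comap e (edgeGraph K)).connected_iff.2 hμ.connected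
  have hcomp := hcov.comp he
  obtain ⟨h₀, hh₀⟩ := hcomp.surjective hconn.nonempty N.connected x₀
  have hpull := isPortCovering_pullback N hconn hcomp
  have hex : ∀ c, IsSimpleCycle ((edgeGraph K).comap e) c →
      ∃ k, KContractible ((edgeGraph K).comap e) k c := by
    intro c hc
    obtain ⟨a, r, rfl⟩ := List.exists_cons_of_ne_nil hc.ne_nil
    have hcl := hc.closed
    obtain ⟨k, hk⟩ := hμ.exists_kContractible N.connected (c := (a :: r).map e) (w := e a)
      ((List.isChain_map _).2 hc.chain) rfl (by rw [List.getLast?_map, ← hcl]; rfl)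
    exact ⟨k, he.kContractible_of_map hc.isLazyPath hk⟩
  choose! f hf using hex
  have hfin : {c : List (Fin n) | IsSimpleCycle ((edgeGraph K).comap e) c}.Finite := by
    refine (List.finite_length_le (Fin n) (n + 1)).subset fun c hc => ?_
    simpa using IsSimpleCycle.length_le hc
  -- There are finitely many simple cycles, so k can exceed both n and the number of moves each of
  -- them needs.
  refine ⟨n + 1 + hfin.toFinset.sup f, n, N.pullback hconn hcomp, h₀, by omega, fun d => ?_, ?_⟩
  · rw [hpull.view_eq, hh₀]
  · intro c hc
    refine (hf c hc).mono (le_trans ?_ (Nat.le_add_left _ _))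
    exact Finset.le_sup (f := f) (hfin.mem_toFinset.2 hc)

/-- A universal cover with vertices in `Fin n` witnesses membership in FNT. -/
theorem FNT_of_isUniversalCover {n : ℕ} {G : SimpleGraph V} {G' : SimpleGraph (Fin n)}
    {μ : Fin n → V} (h : IsUniversalCover (cliqueComplex G') (cliqueComplex G) μ) : FNT G := by
  -- `FNT` asks for a vertex type in the universe of V, hence the lifted copy of `Fin n`.
  have he := IsCliqueCovering.comap_equiv G' (Equiv.ulift.{u} : ULift.{u} (Fin n) ≃ Fin n)
  refine ⟨ULift.{u} (Fin n), cliqueComplex (G'.comap Equiv.ulift), μ ∘ Equiv.ulift, inferInstance,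
    ?_, h.covering.comp he.isSimplicialCovering, ?_⟩
  · rw [isConnectedComplex_cliqueComplex]
    exact (SimpleGraph.Iso.comap Equiv.ulift G').connected_iff.2
      (isConnectedComplex_cliqueComplex.1 h.connected)
  · intro U L φ hL hφ
    obtain ⟨γ, hγ, rfl⟩ := h.universal L φ hL hφ
    exact ⟨γ ∘ Equiv.ulift, hγ.comp he.isSimplicialCovering, rfl⟩

end Network

/-! ### Breadth-first enumeration of the paths from the homebase -/

namespace Network

variable {V : Type u} {N : Network V}

/-- An arc from the centre and an arc back from the neighbour of the same name together carry the
two port numbers of an edge. -/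
theorem mem_edges_label {x : V} {e : ℕ × ℕ} :
    e ∈ Label.edges (N.label x) ↔ ∃ y, N.graph.Adj x y ∧ (N.port x y, N.port y x) = e := by
  rw [Label.edges, List.mem_flatMap]
  constructor
  · rintro ⟨a, ha, h⟩
    obtain ⟨b, hb, h⟩ := List.mem_filterMap.1 h
    split at h
    · split_ifs at h with hp
      subst hp
      rw [mem_label] at ha hb
      obtain ⟨y, hy, hp, -⟩ := exists_of_mem_arcs_from ha
      rw [← hp] at hb
      refine ⟨y, hy, ?_⟩
      rw [port_of_mem_arcs_to hy hb, hp]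
      exact Option.some.inj h
    · simp at h
  · rintro ⟨y, hy, rfl⟩
    refine ⟨_, mem_label.2 (mem_arcs_from hy), List.mem_filterMap.2
      ⟨_, mem_label.2 (mem_arcs_to hy), ?_⟩⟩
    simp

/-- This is the route by which the agent backtracks to the homebase. -/
theorem follows_reverse {x y : V} {p : PortPath} (h : N.Follows x p y) :
    N.Follows y (p.reverse.map Prod.swap) x := by
  induction p generalizing x with
  | nil => exact Eq.symm h
  | cons e p ih =>
    obtain ⟨z, hz, rfl, h⟩ := h
    rw [List.reverse_cons, List.map_append, follows_append]
    exact ⟨z, ih h, follows_singleton.2 ⟨hz.symm, rfl⟩⟩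

open Classical in
/-- The end of the path from `x` with port numbers `p`, if there is one. -/
noncomputable def endpoint (N : Network V) (x : V) (p : PortPath) : V :=
  if h : ∃ y, N.Follows x p y then h.choose else x

theorem Follows.endpoint_eq {x y : V} {p : PortPath} (h : N.Follows x p y) :
    N.endpoint x p = y := by
  have hex : ∃ y, N.Follows x p y := ⟨y, h⟩
  rw [endpoint, dif_pos hex]
  exact hex.choose_spec.unique h

/-- The extensions of the path `p` from `x` by one edge, if they have length at most `d`. -/
noncomputable def children (N : Network V) (d : ℕ) (x : V) (p : PortPath) : List PortPath :=
  if p.length < d then (Label.edges (N.label (N.endpoint x p))).map (fun e => p ++ [e]) else []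

/-- The paths of length `j ≤ d` from `x`. -/
noncomputable def level (N : Network V) (d : ℕ) (x : V) : ℕ → List PortPath
  | 0 => [[]]
  | j + 1 => (level N d x j).flatMap (N.children d x)

/-- Beyond d the levels are empty, as `children` extends only paths of length less than d. This is
what empties the queue. -/
theorem mem_level {d : ℕ} {x : V} {j : ℕ} {p : PortPath} :
    p ∈ N.level d x j ↔ j ≤ d ∧ p.length = j ∧ ∃ y, N.Follows x p y := by
  induction j generalizing p with
  | zero =>
    simp only [level, List.mem_singleton, Nat.zero_le, true_and, List.length_eq_zero_iff]
    constructor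
    · rintro rfl; exact ⟨rfl, x, rfl⟩
    · exact And.left
  | succ j ih =>
    simp only [level, List.mem_flatMap, ih, children]
    constructor
    · rintro ⟨q, ⟨-, rfl, y, hy⟩, h⟩
      split_ifs at h with hlt
      · obtain ⟨e, he, rfl⟩ := List.mem_map.1 h
        rw [hy.endpoint_eq, mem_edges_label] at he
        obtain ⟨z, hz, rfl⟩ := he
        exact ⟨hlt, by simp, z, follows_append.2 ⟨y, hy, follows_singleton.2 ⟨hz, rfl⟩⟩⟩
      · simp at h
    · rintro ⟨hd, hp, z, hz⟩
      rcases List.eq_nil_or_concat' p with rfl | ⟨q, e, rfl⟩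
      · simp at hp
      · obtain ⟨y, hy, he⟩ := follows_append.1 hz
        obtain ⟨hyz, rfl⟩ := follows_singleton.1 he
        have hq : q.length = j := by simpa using hp
        refine ⟨q, ⟨by omega, hq, y, hy⟩, ?_⟩
        rw [if_pos (by omega), hy.endpoint_eq]
        exact List.mem_map.2 ⟨_, mem_edges_label.2 ⟨z, hyz, rfl⟩, rfl⟩

/-- The record of all paths of length at most `j`. -/
noncomputable def record (N : Network V) (d : ℕ) (x : V) (j : ℕ) : List (PortPath × Label) :=
  ((List.range j).flatMap (N.level d x)).map fun p => (p, N.label (N.endpoint x p))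

theorem record_succ (d : ℕ) (x : V) (j : ℕ) : N.record d x (j + 1) =
    N.record d x j ++ (N.level d x j).map fun p => (p, N.label (N.endpoint x p)) := by
  simp [record, List.range_succ]

theorem mem_record (d : ℕ) (x : V) : {e | e ∈ N.record d x (d + 1)} = N.view d x := by
  ext ⟨p, L⟩
  rw [mem_view]
  simp only [record, Set.mem_ofPred_eq, List.mem_map, List.mem_flatMap, List.mem_range, mem_level,
    Prod.mk.injEq]
  constructor
  · rintro ⟨p, ⟨j, -, hj, rfl, y, hy⟩, rfl, rfl⟩
    exact ⟨hj, y, hy, by rw [hy.endpoint_eq]⟩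
  · rintro ⟨hp, y, hy, rfl⟩
    exact ⟨p, ⟨p.length, by omega, hp, rfl, y, hy⟩, rfl, by rw [hy.endpoint_eq]⟩

end Network

/-! ### Executions of the algorithm -/

section

variable {V : Type u}

theorem Agent.next_halted {A : Agent} {N : Network V} {c : A.Config V} (h : c.halted) (t : ℕ) :
    (A.next N)^[t] c = c :=
  Function.iterate_fixed (by rw [Agent.next, if_pos h]) t

/-- The execution leads from `c` to `c'` and visits all vertices of `S` meanwhile. -/
def Leads (N : Network V) (c : fntAgent.Config V) (S : Set V) (c' : fntAgent.Config V) : Prop :=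
  ∃ t, (fntAgent.next N)^[t] c = c' ∧ ∀ y ∈ S, ∃ s ≤ t, ((fntAgent.next N)^[s] c).pos = y

namespace Leads

variable {N : Network V} {c c' c'' : fntAgent.Config V} {S S' : Set V}

protected theorem refl (c : fntAgent.Config V) : Leads N c {c.pos} c :=
  ⟨0, rfl, fun _ hy => ⟨0, le_rfl, hy.symm⟩⟩

protected theorem trans (h : Leads N c S c') (h' : Leads N c' S' c'') :
    Leads N c (S ∪ S') c'' := by
  obtain ⟨t, rfl, ht⟩ := h
  obtain ⟨t', rfl, ht'⟩ := h'
  refine ⟨t' + t, Function.iterate_add_apply _ _ _ _, ?_⟩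
  rintro y (hy | hy)
  · obtain ⟨s, hs, h⟩ := ht y hy
    exact ⟨s, by omega, h⟩
  · obtain ⟨s, hs, h⟩ := ht' y hy
    exact ⟨s + t, by omega, by rwa [Function.iterate_add_apply]⟩

theorem mono (h : Leads N c S c') (hS : S' ⊆ S) : Leads N c S' c' :=
  let ⟨t, ht, h⟩ := h
  ⟨t, ht, fun y hy => h y (hS hy)⟩

theorem single (h : fntAgent.next N c = c') : Leads N c {c'.pos} c' := by
  refine ⟨1, h, fun y hy => ⟨1, le_rfl, ?_⟩⟩
  rw [hy, ← h]; rfl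

end Leads

/-- A running configuration of the agent. -/
abbrev running (m : Memory) (x : V) (e : Option ℕ) : fntAgent.Config V := ⟨m, x, e, false⟩

variable {N : Network V}

theorem next_running (m : Memory) (x : V) (e : Option ℕ) :
    fntAgent.next N (running m x e) = match fntAgent.step m e (N.label x) with
    | (m, .halt) => ⟨m, x, e, true⟩
    | (m, .stay) => ⟨m, x, e, false⟩
    | (m, .move p) =>
      open Classical in
      if h : ∃ y, N.graph.Adj x y ∧ N.port x y = p then
        ⟨m, h.choose, some (N.port h.choose x), false⟩
      else ⟨m, x, e, false⟩ := by
  rw [Agent.next, if_neg (by simp)]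
  rcases fntAgent.step m e (N.label x) with ⟨m', _ | _ | p⟩ <;> simp only [running]

theorem next_move {k : ℕ} {q : List PortPath} {s : List (PortPath × Label)} {x y : V}
    (h : N.graph.Adj x y) (ps : List ℕ) (b : Bool) (f) (e : Option ℕ) :
    fntAgent.next N (running ⟨k, q, s, N.port x y :: ps, b, f⟩ x e) =
      running ⟨k, q, s, ps, b, f⟩ y (some (N.port y x)) := by
  rw [next_running]
  have hex : ∃ z, N.graph.Adj x z ∧ N.port x z = N.port x y := ⟨y, h, rfl⟩
  have hy : hex.choose = y := Network.eq_of_port_eq hex.choose_spec.1 h hex.choose_spec.2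
  simp only [fntAgent]
  rw [dif_pos hex, hy]
  rfl

theorem next_inspect {k : ℕ} {p : PortPath} {q : List PortPath} {s : List (PortPath × Label)}
    {x : V} (f) (e : Option ℕ) :
    fntAgent.next N (running ⟨k, p :: q, s, [], true, f⟩ x e) =
      running ⟨k, q ++ (if p.length < 2 * k
        then (Label.edges (N.label x)).map (fun e => p ++ [e]) else []),
        s ++ [(p, N.label x)], (p.map Prod.snd).reverse, false, f⟩ x e := by
  rw [next_running]; rfl

theorem next_depart {k : ℕ} {p : PortPath} {q : List PortPath} {s : List (PortPath × Label)}
    {x : V} (f) (e : Option ℕ) :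
    fntAgent.next N (running ⟨k, p :: q, s, [], false, f⟩ x e) =
      running ⟨k, p :: q, s, p.map Prod.fst, true, f⟩ x e := by
  rw [next_running]; rfl

theorem next_search_some {k : ℕ} {s : List (PortPath × Label)} {x : V} {b : Bool}
    {f} {C : List (List (Option ℕ))} (h : search k s = some C) (e : Option ℕ) :
    fntAgent.next N (running ⟨k, [], s, [], b, f⟩ x e) =
      ⟨(⟨k, [], s, [], b, some C⟩ : Memory), x, e, true⟩ := by
  rw [next_running]
  simp only [fntAgent, h]

theorem next_search_none {k : ℕ} {s : List (PortPath × Label)} {x : V} {b : Bool}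
    {f} (h : search k s = none) (e : Option ℕ) :
    fntAgent.next N (running ⟨k, [], s, [], b, f⟩ x e) = running (.start (k + 1)) x e := by
  rw [next_running]
  simp only [fntAgent, h]
  rfl

theorem leads_walk {k : ℕ} {q : List PortPath} {s : List (PortPath × Label)} {x y : V}
    {p : PortPath} (h : N.Follows x p y) (b : Bool) (f) (e : Option ℕ) :
    ∃ e', Leads N (running ⟨k, q, s, p.map Prod.fst, b, f⟩ x e) {y}
      (running ⟨k, q, s, [], b, f⟩ y e') := by
  induction p generalizing x e with
  | nil =>
    obtain rfl : x = y := h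
    exact ⟨e, Leads.refl _⟩
  | cons a p ih =>
    obtain ⟨z, hz, rfl, h⟩ := h
    obtain ⟨e', he'⟩ := ih h (some (N.port z x))
    exact ⟨e', ((Leads.single (next_move hz _ b f e)).trans he').mono Set.subset_union_right⟩

/-- Starts at the far end of the path. Kept apart from `leads_path` because a phase opens in this
state, with the empty path already followed. -/
theorem leads_record {k : ℕ} {q : List PortPath} {s : List (PortPath × Label)} {x y : V}
    {p : PortPath} (h : N.Follows x p y) (f) (e : Option ℕ) :
    ∃ e', Leads N (running ⟨k, p :: q, s, [], true, f⟩ y e) {y}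
      (running ⟨k, q ++ N.children (2 * k) x p, s ++ [(p, N.label (N.endpoint x p))], [], false, f⟩
        x e') := by
  rw [Network.children, h.endpoint_eq]
  have e1 : (p.map Prod.snd).reverse = (p.reverse.map Prod.swap).map Prod.fst := by
    simp [Function.comp_def]
  have h1 := next_inspect (N := N) (k := k) (p := p) (q := q) (s := s) (x := y) f e
  rw [e1] at h1
  obtain ⟨e', he'⟩ := leads_walk (N := N) (k := k) (Network.follows_reverse h) false f e
  exact ⟨e', ((Leads.single h1).trans he').mono Set.subset_union_left⟩

theorem leads_path {k : ℕ} {q : List PortPath} {s : List (PortPath × Label)} {x y : V}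
    {p : PortPath} (h : N.Follows x p y) (f) (e : Option ℕ) :
    ∃ e', Leads N (running ⟨k, p :: q, s, [], false, f⟩ x e) {y}
      (running ⟨k, q ++ N.children (2 * k) x p, s ++ [(p, N.label (N.endpoint x p))], [], false, f⟩
        x e') := by
  obtain ⟨e1, h1⟩ := leads_walk (N := N) (k := k) (q := p :: q) (s := s) h true f e
  obtain ⟨e2, h2⟩ := leads_record (N := N) (k := k) (q := q) (s := s) h f e1
  exact ⟨e2, (((Leads.single (next_depart f e)).trans h1).trans h2).mono Set.subset_union_right⟩

/-- New paths queue up behind q, so processing one whole level leaves exactly the next level in the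
queue. -/
theorem leads_paths {k : ℕ} {s : List (PortPath × Label)} {x : V} (l q : List PortPath)
    (hl : ∀ p ∈ l, ∃ y, N.Follows x p y) (f) (e : Option ℕ) :
    ∃ e', Leads N (running ⟨k, l ++ q, s, [], false, f⟩ x e) {y | ∃ p ∈ l, N.Follows x p y}
      (running ⟨k, q ++ l.flatMap (N.children (2 * k) x),
        s ++ l.map (fun p => (p, N.label (N.endpoint x p))), [], false, f⟩ x e') := by
  induction l generalizing q s e with
  | nil => exact ⟨e, by simpa using (Leads.refl _).mono (Set.empty_subset _)⟩
  | cons p l ih =>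
    obtain ⟨y, hy⟩ := hl p (by simp)
    obtain ⟨e1, h1⟩ := leads_path (N := N) (k := k) (q := l ++ q) (s := s) hy f e
    rw [List.append_assoc] at h1
    obtain ⟨e2, h2⟩ := ih (s := s ++ [(p, N.label (N.endpoint x p))]) (q ++ N.children (2 * k) x p)
      (fun p hp => hl p (by simp [hp])) e1
    refine ⟨e2, ?_⟩
    have := (h1.trans h2).mono (S' := {y | ∃ p' ∈ p :: l, N.Follows x p' y}) ?_
    · simpa using this
    · rintro z ⟨p', hp', hz⟩
      rcases List.mem_cons.1 hp' with rfl | hp'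
      · exact Or.inl (hz.unique hy)
      · exact Or.inr ⟨p', hp', hz⟩

/-- The invariant of the breadth-first search. The visited set shrinks to nothing for j > 2k, so no
bound on j is needed as a hypothesis. -/
theorem leads_levels (k : ℕ) (x : V) (e : Option ℕ) (j : ℕ) :
    ∃ e', Leads N (running (.start k) x e)
      {y | ∃ p : PortPath, p.length ≤ j ∧ j ≤ 2 * k ∧ N.Follows x p y}
      (running ⟨k, N.level (2 * k) x (j + 1), N.record (2 * k) x (j + 1), [], false, none⟩
        x e') := by
  induction j with
  | zero =>
    obtain ⟨e', h⟩ := leads_record (N := N) (k := k) (q := []) (s := []) (x := x) (p := []) rfl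
      none e
    refine ⟨e', ?_⟩
    simp only [Network.level, Network.record, List.range_succ, List.range_zero, List.nil_append,
      List.flatMap_cons, List.flatMap_nil, List.append_nil, List.map_cons, List.map_nil]
    refine h.mono ?_
    rintro y ⟨p, hp, -, hy⟩
    obtain rfl : p = [] := by simpa using hp
    exact Eq.symm hy
  | succ j ih =>
    obtain ⟨e1, h1⟩ := ih
    obtain ⟨e2, h2⟩ := leads_paths (N := N) (k := k) (s := N.record (2 * k) x (j + 1)) (x := x)
      (N.level (2 * k) x (j + 1)) [] (fun p hp => (Network.mem_level.1 hp).2.2) none e1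
    rw [List.append_nil, ← Network.record_succ] at h2
    refine ⟨e2, (h1.trans h2).mono ?_⟩
    rintro y ⟨p, hp, hj, hy⟩
    rcases Nat.lt_or_eq_of_le hp with hp | hp
    · exact Or.inl ⟨p, by omega, by omega, hy⟩
    · exact Or.inr ⟨p, Network.mem_level.2 ⟨hj, hp, y, hy⟩, hy⟩

/-- A phase of the algorithm, up to the search. -/
theorem leads_phase (k : ℕ) (x : V) (e : Option ℕ) :
    ∃ e', Leads N (running (.start k) x e)
      {y | ∃ p : PortPath, p.length ≤ 2 * k ∧ N.Follows x p y}
      (running ⟨k, [], N.record (2 * k) x (2 * k + 1), [], false, none⟩ x e') := by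
  obtain ⟨e', h⟩ := leads_levels (N := N) k x e (2 * k)
  have hnil : N.level (2 * k) x (2 * k + 1) = [] :=
    List.eq_nil_iff_forall_not_mem.2 fun p hp => by
      have := (Network.mem_level.1 hp).1
      omega
  rw [hnil] at h
  exact ⟨e', h.mono fun y ⟨p, hp, hy⟩ => ⟨p, hp, le_rfl, hy⟩⟩

/-- If no phase before phase `k` is successful, the algorithm reaches phase `k`. -/
theorem leads_start (x : V) {k : ℕ}
    (h : ∀ j < k, search (j + 1) (N.record (2 * (j + 1)) x (2 * (j + 1) + 1)) = none) :
    ∃ e, ∃ t ≥ k, fntAgent.run N x t = running (.start (k + 1)) x e := by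
  induction k with
  | zero => exact ⟨none, 0, le_rfl, rfl⟩
  | succ k ih =>
    obtain ⟨e, t, ht, h1⟩ := ih fun j hj => h j (by omega)
    obtain ⟨e', t', h2, -⟩ := leads_phase (N := N) (k + 1) x e
    refine ⟨e', t' + t + 1, by omega, ?_⟩
    rw [Agent.run] at h1 ⊢
    rw [Function.iterate_succ_apply', Function.iterate_add_apply, h1, h2]
    exact next_search_none (h k (by omega)) _

theorem run_add_of_halted {A : Agent} {x : V} {s t : ℕ} (h : (A.run N x s).halted) (hst : s ≤ t) :
    A.run N x t = A.run N x s := by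
  obtain ⟨r, rfl⟩ := Nat.exists_eq_add_of_le' hst
  rw [Agent.run, Function.iterate_add_apply]
  exact Agent.next_halted h r

/-- If phase `k` is successful, the algorithm halts. -/
theorem exists_halted (x : V) {k : ℕ} {C : List (List (Option ℕ))}
    (h : ∀ j < k, search (j + 1) (N.record (2 * (j + 1)) x (2 * (j + 1) + 1)) = none)
    (hC : search (k + 1) (N.record (2 * (k + 1)) x (2 * (k + 1) + 1)) = some C) :
    ∃ t, (fntAgent.run N x t).halted = true ∧ (fntAgent.run N x t).memory.phase = k + 1 ∧
      (fntAgent.run N x t).memory.found = some C ∧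
      ∀ y, (∃ p : PortPath, p.length ≤ 2 * (k + 1) ∧ N.Follows x p y) →
        ∃ s ≤ t, (fntAgent.run N x s).pos = y := by
  obtain ⟨e, t, -, h1⟩ := leads_start x h
  obtain ⟨e', t', h2, h3⟩ := leads_phase (N := N) (k + 1) x e
  have key : fntAgent.run N x (t' + t + 1) = ⟨(⟨k + 1, [],
      N.record (2 * (k + 1)) x (2 * (k + 1) + 1), [], false, some C⟩ : Memory), x, e', true⟩ := by
    rw [Agent.run] at h1 ⊢
    rw [Function.iterate_succ_apply', Function.iterate_add_apply, h1, h2]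
    exact next_search_some hC _
  refine ⟨t' + t + 1, by rw [key], by rw [key], by rw [key], ?_⟩
  intro y hy
  obtain ⟨s, hs, hy⟩ := h3 y hy
  refine ⟨s + t, by omega, ?_⟩
  rw [Agent.run] at h1 ⊢
  rwa [Function.iterate_add_apply, h1]

/-- Whenever the algorithm halts, some phase was successful, and the last phase visited all vertices
in its range. -/
theorem exists_search_of_halted {x : V} {t : ℕ} (ht : (fntAgent.run N x t).halted = true) :
    ∃ k C, search k (N.record (2 * k) x (2 * k + 1)) = some C ∧
      (fntAgent.run N x t).memory.phase = k ∧ (fntAgent.run N x t).memory.found = some C ∧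
      ∀ y, (∃ p : PortPath, p.length ≤ 2 * k ∧ N.Follows x p y) →
        ∃ s ≤ t, (fntAgent.run N x s).pos = y := by
  classical
  have hex : ∃ j, search (j + 1) (N.record (2 * (j + 1)) x (2 * (j + 1) + 1)) ≠ none := by
    -- If every search failed, the agent would be entering a new phase at some time not before t,
    -- and so would not have halted.
    by_contra! hnone
    obtain ⟨e, t', ht', h⟩ := leads_start (N := N) x (k := t) fun j _ => hnone j
    rw [← run_add_of_halted ht ht', h] at ht
    simp at ht
  obtain ⟨C, hC⟩ := Option.ne_none_iff_exists'.1 (Nat.find_spec hex)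
  obtain ⟨T, hT, hphase, hfound, hvis⟩ := exists_halted (N := N) x
    (fun j hj => not_not.1 (Nat.find_min hex hj)) hC
  -- A halted configuration is fixed, so the two halting times give the same configuration.
  have hrun : fntAgent.run N x t = fntAgent.run N x T := by
    rcases le_total t T with h | h
    · exact (run_add_of_halted ht h).symm
    · exact run_add_of_halted hT h
  refine ⟨_, C, hC, by rw [hrun, hphase], by rw [hrun, hfound], fun y hy => ?_⟩
  obtain ⟨s, -, hs⟩ := hvis y hy
  rcases le_total s t with h | h
  · exact ⟨s, h, hs⟩
  · exact ⟨t, le_rfl, by rwa [← run_add_of_halted ht h]⟩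

theorem halts_of_search {x : V} {k : ℕ}
    (hk : search (k + 1) (N.record (2 * (k + 1)) x (2 * (k + 1) + 1)) ≠ none) :
    fntAgent.Halts N x := by
  classical
  have hex : ∃ j, search (j + 1) (N.record (2 * (j + 1)) x (2 * (j + 1) + 1)) ≠ none := ⟨k, hk⟩
  obtain ⟨C, hC⟩ := Option.ne_none_iff_exists'.1 (Nat.find_spec hex)
  obtain ⟨T, hT, -⟩ := exists_halted (N := N) x
    (fun j hj => not_not.1 (Nat.find_min hex hj)) hC
  exact ⟨T, hT⟩

/-! ### The result of the search -/

theorem search_eq_some {k : ℕ} {s : List (PortPath × Label)} {C : List (List (Option ℕ))}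
    (h : search k s = some C) : ∃ (n : ℕ) (H : Network (Fin n)), H.code = C ∧ PassesTest k s H := by
  classical
  rw [search] at h
  split_ifs at h with hex
  obtain rfl := Option.some.inj h
  exact Encodable.choose_spec hex

theorem search_ne_none {k n : ℕ} {s : List (PortPath × Label)} {H : Network (Fin n)}
    (h : PassesTest k s H) : search k s ≠ none := by
  classical
  rw [search, dif_pos ⟨_, n, H, rfl, h⟩]
  simp

theorem exists_follows (N : Network V) {x y : V} (w : N.graph.Walk x y) :
    ∃ p : PortPath, p.length = w.length ∧ N.Follows x p y := by
  induction w with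
  | nil => exact ⟨[], rfl, rfl⟩
  | @cons x z y h w ih =>
    obtain ⟨p, hp, h'⟩ := ih
    exact ⟨(N.port x z, N.port z x) :: p, by simp [hp], z, h, rfl, h'⟩

theorem exists_follows_lt {n : ℕ} (H : Network (Fin n)) (x y : Fin n) :
    ∃ p : PortPath, p.length < n ∧ H.Follows x p y := by
  classical
  obtain ⟨w⟩ := H.connected.preconnected x y
  obtain ⟨p, hp, h⟩ := exists_follows H (w.toPath : H.graph.Walk x y)
  refine ⟨p, ?_, h⟩
  have := w.toPath.2.length_lt
  rwa [Fintype.card_fin, ← hp] at this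

theorem Network.IsPortCovering.follows {W : Type v} {H : Network W} {μ : W → V}
    (h : Network.IsPortCovering H N μ) {x y : W} {p : PortPath} (hp : H.Follows x p y) :
    N.Follows (μ x) p (μ y) := by
  induction p generalizing x with
  | nil => exact congrArg μ hp
  | cons e p ih =>
    obtain ⟨z, hz, rfl, hp⟩ := hp
    exact ⟨μ z, h.adj hz, by rw [h.port hz, h.port hz.symm], ih hp⟩

/-- What is true whenever the algorithm halts. -/
theorem result_of_halted {x₀ : V} {t : ℕ} (ht : (fntAgent.run N x₀ t).halted = true) :
    (∀ y, ∃ s ≤ t, (fntAgent.run N x₀ s).pos = y) ∧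
    ∃ (k n : ℕ) (H : Network (Fin n)) (h₀ : Fin n) (μ : Fin n → V),
      (fntAgent.run N x₀ t).memory.phase = k ∧
      (fntAgent.run N x₀ t).memory.found = some H.code ∧
      n < k ∧ H.view (2 * k) h₀ = N.view (2 * k) x₀ ∧
      (∀ c, IsSimpleCycle H.graph c → KContractible H.graph k c) ∧
      IsUniversalCover (cliqueComplex H.graph) (cliqueComplex N.graph) μ ∧
      ∀ x y, H.graph.Adj x y → N.port (μ x) (μ y) = H.port x y := by
  obtain ⟨k, C, hC, hphase, hfound, hvis⟩ := exists_search_of_halted ht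
  obtain ⟨n, H, rfl, hn, ⟨h₀, hv⟩, hcyc⟩ := search_eq_some hC
  rw [Network.mem_record] at hv
  obtain ⟨μ, hμ, hμ₀, huniv⟩ := Network.exists_isUniversalCover (by simpa using hn) hcyc hv
  refine ⟨fun y => hvis y ?_, k, n, H, h₀, μ, hphase, hfound, hn, hv, hcyc, huniv,
    fun x y h => hμ.port h⟩
  -- A path of length less than n < k in H from `h₀` maps to a path from `x₀`, well within the range
  -- 2k explored in the last phase.
  obtain ⟨h, rfl⟩ := hμ.isCliqueCovering.surjective ⟨h₀⟩ N.connected y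
  obtain ⟨p, hp, hf⟩ := exists_follows_lt H h₀ h
  exact ⟨p, by omega, hμ₀ ▸ hμ.follows hf⟩

theorem halts_of_FNT (N : Network V) (x₀ : V) (h : FNT N.graph) : fntAgent.Halts N x₀ := by
  obtain ⟨k, n, H, h₀, hn, hv, hcyc⟩ := N.exists_network_of_FNT x₀ h
  obtain ⟨k, rfl⟩ : ∃ k', k = k' + 1 := ⟨k - 1, by omega⟩
  exact halts_of_search (search_ne_none (H := H) ⟨hn, ⟨h₀, by rw [Network.mem_record, hv]⟩, hcyc⟩)

end

/-! ### Primitive recursive functions -/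

section

variable {α β γ σ : Type*} [Primcodable α] [Primcodable β] [Primcodable γ] [Primcodable σ]

attribute [fun_prop] Primrec

@[fun_prop]
theorem primrec_id : Primrec fun x : α => x := Primrec.id

@[fun_prop]
theorem primrec_const (c : β) : Primrec fun _ : α => c := Primrec.const c

@[fun_prop]
theorem primrec_comp {f : β → γ} {g : α → β} (hf : Primrec f) (hg : Primrec g) :
    Primrec fun x => f (g x) := hf.comp hg

@[fun_prop]
theorem primrec_fst {f : α → β × γ} (hf : Primrec f) : Primrec fun x => (f x).1 :=
  Primrec.fst.comp hf

@[fun_prop]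
theorem primrec_snd {f : α → β × γ} (hf : Primrec f) : Primrec fun x => (f x).2 :=
  Primrec.snd.comp hf

@[fun_prop]
theorem primrec_pair {f : α → β} {g : α → γ} (hf : Primrec f) (hg : Primrec g) :
    Primrec fun x => (f x, g x) := hf.pair hg

@[fun_prop]
theorem primrec_add {f g : α → ℕ} (hf : Primrec f) (hg : Primrec g) :
    Primrec fun x => f x + g x := Primrec.nat_add.comp hf hg

@[fun_prop]
theorem primrec_sub {f g : α → ℕ} (hf : Primrec f) (hg : Primrec g) :
    Primrec fun x => f x - g x := Primrec.nat_sub.comp hf hg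

@[fun_prop]
theorem primrec_mul {f g : α → ℕ} (hf : Primrec f) (hg : Primrec g) :
    Primrec fun x => f x * g x := Primrec.nat_mul.comp hf hg

@[fun_prop]
theorem primrec_encode {f : α → β} (hf : Primrec f) : Primrec fun x => Encodable.encode (f x) :=
  Primrec.encode.comp hf

@[fun_prop]
theorem primrec_cond {c : α → Bool} {f g : α → β} (hc : Primrec c) (hf : Primrec f)
    (hg : Primrec g) : Primrec fun x => bif c x then f x else g x := Primrec.cond hc hf hg

@[fun_prop]
theorem primrec_and {f g : α → Bool} (hf : Primrec f) (hg : Primrec g) :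
    Primrec fun x => f x && g x := Primrec.and.comp hf hg

@[fun_prop]
theorem primrec_or {f g : α → Bool} (hf : Primrec f) (hg : Primrec g) :
    Primrec fun x => f x || g x := Primrec.or.comp hf hg

@[fun_prop]
theorem primrec_not {f : α → Bool} (hf : Primrec f) : Primrec fun x => !f x :=
  Primrec.not.comp hf

@[fun_prop]
theorem primrec_decide_eq [DecidableEq β] {f g : α → β} (hf : Primrec f) (hg : Primrec g) :
    Primrec fun x => decide (f x = g x) :=
  (Primrec.eq.decide : Primrec₂ fun a b : β => decide (a = b)).comp hf hg

@[fun_prop]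
theorem primrec_decide_le {f g : α → ℕ} (hf : Primrec f) (hg : Primrec g) :
    Primrec fun x => decide (f x ≤ g x) :=
  (Primrec.nat_le.decide : Primrec₂ fun a b : ℕ => decide (a ≤ b)).comp hf hg

@[fun_prop]
theorem primrec_decide_lt {f g : α → ℕ} (hf : Primrec f) (hg : Primrec g) :
    Primrec fun x => decide (f x < g x) :=
  (Primrec.nat_lt.decide : Primrec₂ fun a b : ℕ => decide (a < b)).comp hf hg

@[fun_prop]
theorem primrec_some {f : α → β} (hf : Primrec f) : Primrec fun x => some (f x) :=
  Primrec.option_some.comp hf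

@[fun_prop]
theorem primrec_isSome {f : α → Option β} (hf : Primrec f) : Primrec fun x => (f x).isSome :=
  Primrec.option_isSome.comp hf

@[fun_prop]
theorem primrec_option_getD {f : α → Option β} {g : α → β} (hf : Primrec f) (hg : Primrec g) :
    Primrec fun x => (f x).getD (g x) := Primrec.option_getD.comp hf hg

@[fun_prop]
theorem primrec_option_bind {f : α → Option β} {g : α → β → Option γ} (hf : Primrec f)
    (hg : Primrec fun q : α × β => g q.1 q.2) : Primrec fun x => (f x).bind (g x) :=
  Primrec.option_bind hf hg

@[fun_prop]
theorem primrec_append {f g : α → List β} (hf : Primrec f) (hg : Primrec g) :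
    Primrec fun x => f x ++ g x := Primrec.list_append.comp hf hg

@[fun_prop]
theorem primrec_cons {f : α → β} {g : α → List β} (hf : Primrec f) (hg : Primrec g) :
    Primrec fun x => f x :: g x := Primrec.list_cons.comp hf hg

@[fun_prop]
theorem primrec_length {f : α → List β} (hf : Primrec f) : Primrec fun x => (f x).length :=
  Primrec.list_length.comp hf

@[fun_prop]
theorem primrec_head? {f : α → List β} (hf : Primrec f) : Primrec fun x => (f x).head? :=
  Primrec.list_head?.comp hf

@[fun_prop]
theorem primrec_reverse {f : α → List β} (hf : Primrec f) : Primrec fun x => (f x).reverse :=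
  Primrec.list_reverse.comp hf

@[fun_prop]
theorem primrec_getLast? {f : α → List β} (hf : Primrec f) : Primrec fun x => (f x).getLast? :=
  (Primrec.list_head?.comp (Primrec.list_reverse.comp hf)).of_eq fun _ => List.head?_reverse

@[fun_prop]
theorem primrec_range {f : α → ℕ} (hf : Primrec f) : Primrec fun x => List.range (f x) :=
  Primrec.list_range.comp hf

@[fun_prop]
theorem primrec_getElem? {f : α → List β} {g : α → ℕ} (hf : Primrec f) (hg : Primrec g) :
    Primrec fun x => (f x)[g x]? := Primrec.list_getElem?.comp hf hg

-- The inner function has to be primitive recursive jointly in the parameter and the entry; in this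
-- form nested list operations are handled by iteration.
@[fun_prop]
theorem primrec_map {f : α → List β} {g : α → β → γ} (hf : Primrec f)
    (hg : Primrec fun q : α × β => g q.1 q.2) : Primrec fun x => (f x).map (g x) :=
  Primrec.list_map hf hg

@[fun_prop]
theorem primrec_flatMap {f : α → List β} {g : α → β → List γ} (hf : Primrec f)
    (hg : Primrec fun q : α × β => g q.1 q.2) : Primrec fun x => (f x).flatMap (g x) :=
  Primrec.list_flatMap hf hg

@[fun_prop]
theorem primrec_filterMap {f : α → List β} {g : α → β → Option γ} (hf : Primrec f)
    (hg : Primrec fun q : α × β => g q.1 q.2) : Primrec fun x => (f x).filterMap (g x) :=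
  Primrec.listFilterMap hf hg

@[fun_prop]
theorem primrec_filter {f : α → List β} {g : α → β → Bool} (hf : Primrec f)
    (hg : Primrec fun q : α × β => g q.1 q.2) : Primrec fun x => (f x).filter (g x) := by
  have h : Primrec fun x => (f x).filterMap fun b => bif g x b then some b else none := by
    fun_prop
  refine h.of_eq fun x => ?_
  rw [← List.filterMap_eq_filter]
  congr 1
  funext b
  by_cases h : g x b = true <;> simp [h, Option.guard]

@[fun_prop]
theorem primrec_all {f : α → List β} {g : α → β → Bool} (hf : Primrec f)
    (hg : Primrec fun q : α × β => g q.1 q.2) : Primrec fun x => (f x).all (g x) := by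
  have h : Primrec fun x => decide (((f x).filter fun b => !g x b).length = 0) := by fun_prop
  refine h.of_eq fun x => ?_
  rw [Bool.eq_iff_iff]
  simp

@[fun_prop]
theorem primrec_any {f : α → List β} {g : α → β → Bool} (hf : Primrec f)
    (hg : Primrec fun q : α × β => g q.1 q.2) : Primrec fun x => (f x).any (g x) := by
  have h : Primrec fun x => !(f x).all fun b => !g x b := by fun_prop
  refine h.of_eq fun x => ?_
  rw [Bool.eq_iff_iff]
  simp

@[fun_prop]
theorem primrec_foldl {f : α → List β} {g : α → σ} {h : α → σ → β → σ} (hf : Primrec f)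
    (hg : Primrec g) (hh : Primrec fun q : α × σ × β => h q.1 q.2.1 q.2.2) :
    Primrec fun x => (f x).foldl (h x) (g x) :=
  Primrec.list_foldl (h := fun a q => h a q.1 q.2) hf hg hh

theorem primrec_natRec {f : α → ℕ} {g : α → σ} {h : α → ℕ → σ → σ} (hf : Primrec f)
    (hg : Primrec g) (hh : Primrec fun q : α × ℕ × σ => h q.1 q.2.1 q.2.2) :
    Primrec fun x => Nat.rec (motive := fun _ => σ) (g x) (h x) (f x) :=
  Primrec.nat_rec' (h := fun a q => h a q.1 q.2) hf hg hh

/-- The lists of length at most `m` with entries in `l`. -/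
def listsUpTo {δ : Type*} (l : List δ) : ℕ → List (List δ)
  | 0 => [[]]
  | m + 1 => [] :: (listsUpTo l m).flatMap fun c => l.map fun a => a :: c

theorem mem_listsUpTo {δ : Type*} {l : List δ} {m : ℕ} {c : List δ} :
    c ∈ listsUpTo l m ↔ c.length ≤ m ∧ ∀ a ∈ c, a ∈ l := by
  induction m generalizing c with
  | zero =>
    simp only [listsUpTo, List.mem_singleton, Nat.le_zero_eq, List.length_eq_zero_iff]
    constructor
    · rintro rfl; simp
    · exact And.left
  | succ m ih =>
    cases c with
    | nil => simp [listsUpTo]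
    | cons a c => simp [listsUpTo, ih]; tauto

@[fun_prop]
theorem primrec_listsUpTo {f : α → List β} {g : α → ℕ} (hf : Primrec f) (hg : Primrec g) :
    Primrec fun x => listsUpTo (f x) (g x) := by
  refine (primrec_natRec (h := fun x _ r => [] :: r.flatMap fun c => (f x).map fun a => a :: c)
    hg (Primrec.const [[]]) (by fun_prop)).of_eq fun x => ?_
  generalize g x = m
  induction m with
  | zero => rfl
  | succ m ih => simp only [listsUpTo, ← ih]

/-! ### The test of a phase as a primitive recursive function -/

/-- The matrices of port numbers, seen as functions. -/
def entry (C : List (List (Option ℕ))) (i j : ℕ) : Option ℕ := ((C[i]?).getD [])[j]?.getD none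

@[fun_prop]
theorem primrec_entry {C : α → List (List (Option ℕ))} {i j : α → ℕ} (hC : Primrec C)
    (hi : Primrec i) (hj : Primrec j) : Primrec fun x => entry (C x) (i x) (j x) := by
  unfold entry; fun_prop

/-- `C` is the matrix of a graph with port numbers. -/
def isMatrix (C : List (List (Option ℕ))) : Bool :=
  (C.all fun r => decide (r.length = C.length)) &&
  ((List.range C.length).all fun i => decide (entry C i i = none) &&
    (List.range C.length).all fun j => (!(entry C i j).isSome || (entry C j i).isSome) &&
      (List.range C.length).all fun l => !(entry C i j).isSome ||
        !decide (entry C i j = entry C i l) || decide (j = l))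

@[fun_prop]
theorem primrec_isMatrix {C : α → List (List (Option ℕ))} (hC : Primrec C) :
    Primrec fun x => isMatrix (C x) := by
  unfold isMatrix; fun_prop

/-- The end of the path from `i` with port numbers `p`. -/
def walkEnd (C : List (List (Option ℕ))) (i : ℕ) (p : PortPath) : Option ℕ :=
  p.foldl (fun o e => o.bind fun a => ((List.range C.length).filter fun b =>
    decide (entry C a b = some e.1) && decide (entry C b a = some e.2)).head?) (some i)

@[fun_prop]
theorem primrec_walkEnd {C : α → List (List (Option ℕ))} {i : α → ℕ} {p : α → PortPath}
    (hC : Primrec C) (hi : Primrec i) (hp : Primrec p) :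
    Primrec fun x => walkEnd (C x) (i x) (p x) := by
  unfold walkEnd; fun_prop

/-- The arc from `u` to `v` is represented by `a` in the label of `y`. -/
def isArc (C : List (List (Option ℕ))) (y u v : ℕ) (a : Option ℕ × Option ℕ × ℕ) : Bool :=
  decide (a = (entry C y u, entry C y v, (entry C u v).getD 0))

@[fun_prop]
theorem primrec_isArc {C : α → List (List (Option ℕ))} {y u v : α → ℕ}
    {a : α → Option ℕ × Option ℕ × ℕ} (hC : Primrec C) (hy : Primrec y) (hu : Primrec u)
    (hv : Primrec v) (ha : Primrec a) : Primrec fun x => isArc (C x) (y x) (u x) (v x) (a x) := by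
  unfold isArc; fun_prop

/-- The label of `y` has an arc from `u` to `v`. -/
def hasArc (C : List (List (Option ℕ))) (y u v : ℕ) : Bool :=
  (decide (u = y) || (entry C y u).isSome) && (decide (v = y) || (entry C y v).isSome) &&
    (entry C u v).isSome

@[fun_prop]
theorem primrec_hasArc {C : α → List (List (Option ℕ))} {y u v : α → ℕ}
    (hC : Primrec C) (hy : Primrec y) (hu : Primrec u) (hv : Primrec v) :
    Primrec fun x => hasArc (C x) (y x) (u x) (v x) := by
  unfold hasArc; fun_prop

/-- `L` is the label of `y`. -/
def isLabel (C : List (List (Option ℕ))) (y : ℕ) (L : Label) : Bool :=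
  ((List.range L.length).all fun i => (List.range i).all fun j =>
    decide (Encodable.encode L[j]? < Encodable.encode L[i]?)) &&
  (L.all fun a => (List.range C.length).any fun u => (List.range C.length).any fun v =>
    hasArc C y u v && isArc C y u v a) &&
  ((List.range C.length).all fun u => (List.range C.length).all fun v =>
    !hasArc C y u v || L.any fun a => isArc C y u v a)

@[fun_prop]
theorem primrec_isLabel {C : α → List (List (Option ℕ))} {y : α → ℕ} {L : α → Label}
    (hC : Primrec C) (hy : Primrec y) (hL : Primrec L) :
    Primrec fun x => isLabel (C x) (y x) (L x) := by
  unfold isLabel; fun_prop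

/-- `s` is the view of `i` at depth `d`, and all vertices occur in it. -/
def isView (d : ℕ) (s : List (PortPath × Label)) (C : List (List (Option ℕ))) (i : ℕ) : Bool :=
  (s.any fun e => decide (e.1 = [])) &&
  (s.all fun e => decide (e.1.length ≤ d) && (List.range C.length).any fun y =>
    decide (walkEnd C i e.1 = some y) && isLabel C y e.2 && (!decide (e.1.length < d) ||
      (List.range C.length).all fun z => !(entry C y z).isSome || s.any fun e' =>
        decide (e'.1 = e.1 ++ [((entry C y z).getD 0, (entry C z y).getD 0)]))) &&
  -- Certifies that the matrix describes a connected graph. For a network with fewer than k vertices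
  -- and d = 2k it holds automatically.
  ((List.range C.length).all fun j => s.any fun e => decide (walkEnd C i e.1 = some j))

@[fun_prop]
theorem primrec_isView {d : α → ℕ} {s : α → List (PortPath × Label)}
    {C : α → List (List (Option ℕ))} {i : α → ℕ} (hd : Primrec d) (hs : Primrec s)
    (hC : Primrec C) (hi : Primrec i) : Primrec fun x => isView (d x) (s x) (C x) (i x) := by
  unfold isView; fun_prop

/-- Elementary moves at a given place. -/
def isMoveAt (C : List (List (Option ℕ))) (c c' x y : List ℕ) (a b d : ℕ) : Bool :=
  ((entry C a b).isSome && decide (c = x ++ a :: y) && decide (c' = x ++ a :: b :: a :: y)) ||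
  ((entry C a b).isSome && (entry C b d).isSome && (entry C d a).isSome &&
    decide (c = x ++ a :: y) && decide (c' = x ++ a :: b :: d :: a :: y)) ||
  ((entry C a b).isSome && (entry C b d).isSome && (entry C d a).isSome &&
    decide (c = x ++ a :: b :: y) && decide (c' = x ++ a :: d :: b :: y)) ||
  (decide (c = x ++ a :: y) && decide (c' = x ++ a :: a :: y))

@[fun_prop]
theorem primrec_isMoveAt {C : α → List (List (Option ℕ))} {c c' x y : α → List ℕ} {a b d : α → ℕ}
    (hC : Primrec C) (hc : Primrec c) (hc' : Primrec c') (hx : Primrec x) (hy : Primrec y)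
    (ha : Primrec a) (hb : Primrec b) (hd : Primrec d) :
    Primrec fun z => isMoveAt (C z) (c z) (c' z) (x z) (y z) (a z) (b z) (d z) := by
  unfold isMoveAt; fun_prop

/-- Elementary moves between paths in the list `l`. -/
def isMove (C : List (List (Option ℕ))) (l : List (List ℕ)) (c c' : List ℕ) : Bool :=
  l.any fun x => l.any fun y => (List.range C.length).any fun a =>
    (List.range C.length).any fun b => (List.range C.length).any fun d => isMoveAt C c c' x y a b d

@[fun_prop]
theorem primrec_isMove {C : α → List (List (Option ℕ))} {l : α → List (List ℕ)}
    {c c' : α → List ℕ} (hC : Primrec C) (hl : Primrec l) (hc : Primrec c) (hc' : Primrec c') :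
    Primrec fun x => isMove (C x) (l x) (c x) (c' x) := by
  unfold isMove; fun_prop

/-- The paths in the list `l` that can be reduced to a vertex by `k` elementary homotopies
within `l`. -/
def contractible (C : List (List (Option ℕ))) (l : List (List ℕ)) : ℕ → List (List ℕ)
  | 0 => l.filter fun c => decide (c.length = 1)
  | k + 1 => l.filter fun c => decide (c.length = 1) ||
      (contractible C l k).any fun c' => isMove C l c c' || isMove C l c' c

@[fun_prop]
theorem primrec_contractible {C : α → List (List (Option ℕ))} {l : α → List (List ℕ)}
    {k : α → ℕ} (hC : Primrec C) (hl : Primrec l) (hk : Primrec k) :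
    Primrec fun x => contractible (C x) (l x) (k x) := by
  refine (primrec_natRec (g := fun x => (l x).filter fun c => decide (c.length = 1))
    (h := fun x _ r => (l x).filter fun c => decide (c.length = 1) || r.any fun c' =>
      isMove (C x) (l x) c c' || isMove (C x) (l x) c' c)
    hk (by fun_prop) (by fun_prop)).of_eq fun x => ?_
  generalize k x = m
  induction m with
  | zero => rfl
  | succ m ih => simp only [contractible, ← ih]

/-- `w` is a simple cycle. -/
def isCycle (C : List (List (Option ℕ))) (w : List ℕ) : Bool :=
  decide (0 < w.length) && decide (w.head? = w.getLast?) &&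
  ((List.range (w.length - 1)).all fun i =>
    (entry C ((w[i]?).getD 0) (w[i + 1]?.getD 0)).isSome) &&
  ((List.range (w.length - 1)).all fun i => (List.range i).all fun j => !decide (w[j]? = w[i]?))

@[fun_prop]
theorem primrec_isCycle {C : α → List (List (Option ℕ))} {c : α → List ℕ} (hC : Primrec C)
    (hc : Primrec c) : Primrec fun x => isCycle (C x) (c x) := by
  unfold isCycle; fun_prop

/-- The test of phase `k`. -/
def test (k : ℕ) (s : List (PortPath × Label)) (C : List (List (Option ℕ))) : Bool :=
  decide (C.length < k) && isMatrix C && ((List.range C.length).any (isView (2 * k) s C)) &&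
  -- A loop that contracts in k moves has at most 3k + 1 entries, and so has every loop on the way.
  ((listsUpTo (List.range C.length) (3 * k + 1)).all fun c => !isCycle C c ||
    (contractible C (listsUpTo (List.range C.length) (3 * k + 1)) k).any fun c' => decide (c' = c))

@[fun_prop]
theorem primrec_test {k : α → ℕ} {s : α → List (PortPath × Label)}
    {C : α → List (List (Option ℕ))} (hk : Primrec k) (hs : Primrec s) (hC : Primrec C) :
    Primrec fun x => test (k x) (s x) (C x) := by
  unfold test; fun_prop

/-- The matrices to which the test is applied. -/
def candidates (k : ℕ) (s : List (PortPath × Label)) : List (List (List (Option ℕ))) :=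
  -- Every edge of an accepted network lies on a recorded path, so the recorded port numbers suffice
  -- as matrix entries.
  (listsUpTo (listsUpTo (none :: s.flatMap fun e => e.1.map fun q => some q.1) k) k).filter
    (test k s)

@[fun_prop]
theorem primrec_candidates {k : α → ℕ} {s : α → List (PortPath × Label)} (hk : Primrec k)
    (hs : Primrec s) : Primrec fun x => candidates (k x) (s x) := by
  unfold candidates; fun_prop

/-- The first matrix that passes the test. -/
def firstCandidate (k : ℕ) (s : List (PortPath × Label)) : Option (List (List (Option ℕ))) :=
  ((candidates k s).filter fun C => (candidates k s).all fun C' =>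
    decide (Encodable.encode C ≤ Encodable.encode C')).head?

@[fun_prop]
theorem primrec_firstCandidate {k : α → ℕ} {s : α → List (PortPath × Label)} (hk : Primrec k)
    (hs : Primrec s) : Primrec fun x => firstCandidate (k x) (s x) := by
  unfold firstCandidate; fun_prop

end

/-! ### Correctness of the test -/

section

variable {n : ℕ} {H : Network (Fin n)}

namespace Network

theorem length_code : H.code.length = n := by simp [code]

theorem entry_code (i j : Fin n) :
    entry H.code i j = open Classical in if H.graph.Adj i j then some (H.port i j) else none := by
  simp [entry, code]

theorem entry_code_of_adj {i j : Fin n} (h : H.graph.Adj i j) :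
    entry H.code i j = some (H.port i j) := by rw [entry_code, if_pos h]

theorem isSome_entry_code (i j : Fin n) : (entry H.code i j).isSome ↔ H.graph.Adj i j := by
  rw [entry_code]; split_ifs with h <;> simp [h]

theorem entry_code_eq_some {i j : Fin n} {p : ℕ} :
    entry H.code i j = some p ↔ H.graph.Adj i j ∧ H.port i j = p := by
  rw [entry_code]; split_ifs with h <;> simp [h]

/-- Outside the matrix, `entry` takes the default value `none`. -/
theorem lt_of_isSome_entry {i j : ℕ} (h : (entry H.code i j).isSome) : i < n ∧ j < n := by
  constructor
  · by_contra hi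
    have : H.code[i]? = none := by rw [List.getElem?_eq_none_iff, length_code]; omega
    simp [entry, this] at h
  · by_contra hj
    by_cases hi : i < n
    · simp [entry, code, hi, hj] at h
    · have : H.code[i]? = none := by rw [List.getElem?_eq_none_iff, length_code]; omega
      simp [entry, this] at h

theorem forall_range_code {p : ℕ → Bool} :
    (List.range H.code.length).all p = true ↔ ∀ i : Fin n, p i = true := by
  simp [length_code, Fin.forall_iff]

theorem exists_range_code {p : ℕ → Bool} :
    (List.range H.code.length).any p = true ↔ ∃ i : Fin n, p i = true := by
  simp [length_code, Fin.exists_iff]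

theorem isMatrix_code (H : Network (Fin n)) : isMatrix H.code = true := by
  simp only [isMatrix, Bool.and_eq_true, forall_range_code, Bool.or_eq_true, Bool.not_eq_true',
    ← Bool.not_eq_true, isSome_entry_code, decide_eq_true_eq]
  refine ⟨?_, fun i => ⟨by simp [entry_code], fun j => ⟨?_, fun l => ?_⟩⟩⟩
  · rw [length_code]
    simp [code]
  · by_cases h : H.graph.Adj i j
    · exact Or.inr h.symm
    · exact Or.inl h
  · by_cases h : H.graph.Adj i j
    · by_cases e : entry H.code i j = entry H.code i l
      · rw [entry_code_of_adj h, eq_comm, entry_code_eq_some] at e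
        exact Or.inr (congrArg Fin.val (eq_of_port_eq h e.1 e.2.symm))
      · exact Or.inl (Or.inr e)
    · exact Or.inl (Or.inl h)

theorem walkEnd_concat (C : List (List (Option ℕ))) (i : ℕ) (p : PortPath) (e : ℕ × ℕ) :
    walkEnd C i (p ++ [e]) = (walkEnd C i p).bind fun a => ((List.range C.length).filter fun b =>
      decide (entry C a b = some e.1) && decide (entry C b a = some e.2)).head? := by
  simp [walkEnd]

/-- Ports at a vertex are distinct, so at most one index passes the filter and taking the head
involves no choice. -/
theorem walkEnd_code {x : Fin n} {p : PortPath} {j : ℕ} :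
    walkEnd H.code x p = some j ↔ ∃ y : Fin n, (y : ℕ) = j ∧ H.Follows x p y := by
  induction p using List.reverseRecOn generalizing j with
  | nil => simp [walkEnd, Follows]
  | append_singleton p e ih =>
    rw [walkEnd_concat, Option.bind_eq_some_iff]
    simp only [follows_append, follows_singleton, ih]
    constructor
    · rintro ⟨a, ⟨y, rfl, hy⟩, h⟩
      have h := List.mem_of_head? h
      simp only [List.mem_filter, List.mem_range, length_code, Bool.and_eq_true,
        decide_eq_true_eq] at h
      obtain ⟨hj, h1, h2⟩ := h
      lift j to Fin n using hj
      rw [entry_code_eq_some] at h1 h2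
      exact ⟨j, rfl, y, hy, h1.1, Prod.ext h1.2 h2.2⟩
    · rintro ⟨z, rfl, y, hy, hyz, rfl⟩
      refine ⟨y, ⟨y, rfl, hy⟩, ?_⟩
      have hz : (z : ℕ) ∈ (List.range H.code.length).filter fun b =>
          decide (entry H.code y b = some (H.port y z)) &&
            decide (entry H.code b y = some (H.port z y)) := by
        simp [length_code, entry_code_of_adj hyz, entry_code_of_adj hyz.symm]
      cases hh : ((List.range H.code.length).filter fun b =>
          decide (entry H.code y b = some (H.port y z)) &&
            decide (entry H.code b y = some (H.port z y))).head? with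
      | none =>
        rw [List.head?_eq_none_iff] at hh
        simp [hh] at hz
      | some b =>
        have h := List.mem_of_head? hh
        simp only [List.mem_filter, List.mem_range, length_code, Bool.and_eq_true,
          decide_eq_true_eq] at h
        obtain ⟨hb, h1, -⟩ := h
        lift b to Fin n using hb
        rw [entry_code_eq_some] at h1
        rw [eq_of_port_eq h1.1 hyz h1.2]

theorem hasArc_code {y u v : Fin n} : hasArc H.code y u v = true ↔
    u ∈ H.closedNbhd y ∧ v ∈ H.closedNbhd y ∧ H.graph.Adj u v := by
  simp only [hasArc, Bool.and_eq_true, Bool.or_eq_true, isSome_entry_code, decide_eq_true_eq,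
    Fin.val_inj, mem_closedNbhd, and_assoc]

theorem entry_eq_name {y u : Fin n} (h : u ∈ H.closedNbhd y) :
    entry H.code y u = H.name y u := by
  rcases h with rfl | h
  · rw [name_self, entry_code, if_neg (SimpleGraph.irrefl _)]
  · rw [name_of_adj h, entry_code_of_adj h]

theorem mem_arcs_code {y : Fin n} {a : Option ℕ × Option ℕ × ℕ} : a ∈ H.arcs y ↔
    ∃ u v : Fin n, hasArc H.code y u v = true ∧ isArc H.code y u v a = true := by
  simp only [hasArc_code, isArc, decide_eq_true_eq]
  constructor
  · rintro ⟨u, hu, v, hv, huv, rfl⟩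
    refine ⟨u, v, ⟨hu, hv, huv⟩, ?_⟩
    rw [entry_eq_name hu, entry_eq_name hv, entry_code_of_adj huv]
    rfl
  · rintro ⟨u, v, ⟨hu, hv, huv⟩, rfl⟩
    refine ⟨u, hu, v, hv, huv, ?_⟩
    rw [entry_eq_name hu, entry_eq_name hv, entry_code_of_adj huv]
    rfl

theorem pairwise_encode_lt {L : Label} :
    ((List.range L.length).all fun i => (List.range i).all fun j =>
      decide (Encodable.encode L[j]? < Encodable.encode L[i]?)) = true ↔
    L.Pairwise fun a b => Encodable.encode a < Encodable.encode b := by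
  simp only [List.all_eq_true, List.mem_range, decide_eq_true_eq, List.pairwise_iff_getElem]
  constructor
  · intro h j i hj hi hji
    have := h i hi j hji
    rw [List.getElem?_eq_getElem hj, List.getElem?_eq_getElem hi] at this
    simpa [Encodable.encode_some] using this
  · intro h i hi j hji
    have := h j i (hji.trans hi) hi hji
    rw [List.getElem?_eq_getElem hi, List.getElem?_eq_getElem (hji.trans hi)]
    simpa [Encodable.encode_some] using this

theorem pairwise_label {V : Type u} (N : Network V) (x : V) :
    (N.label x).Pairwise fun a b => Encodable.encode a < Encodable.encode b := by
  have h1 : (N.label x).Pairwise (Encodable.encode' _ ⁻¹'o (· ≤ ·)) :=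
    Finset.pairwise_sort _ _
  have h2 : (N.label x).Nodup := Finset.sort_nodup _ _
  refine (h1.and h2).imp ?_
  rintro a b ⟨h, hne⟩
  exact lt_of_le_of_ne h fun e => hne (Encodable.encode_injective e)

/-- Both lists have strictly increasing codes, so it suffices that they have the same elements. -/
theorem isLabel_code {y : Fin n} {L : Label} :
    isLabel H.code y L = true ↔ L = H.label y := by
  have hmem : ∀ a, (List.range H.code.length).any (fun u => (List.range H.code.length).any fun v =>
      hasArc H.code y u v && isArc H.code y u v a) = true ↔ a ∈ H.label y := by
    intro a
    rw [mem_label, mem_arcs_code]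
    simp only [exists_range_code, Bool.and_eq_true]
  have hmem' : ((List.range H.code.length).all fun u => (List.range H.code.length).all fun v =>
      !hasArc H.code y u v || L.any fun a => isArc H.code y u v a) = true ↔
      ∀ a ∈ H.label y, a ∈ L := by
    simp only [forall_range_code, Bool.or_eq_true, Bool.not_eq_true', List.any_eq_true, mem_label,
      mem_arcs_code]
    constructor
    · rintro h a ⟨u, v, h1, h2⟩
      rcases h u v with h3 | ⟨b, hb, h3⟩
      · rw [h1] at h3; simp at h3
      · simp only [isArc, decide_eq_true_eq] at h2 h3
        rwa [h2, ← h3]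
    · intro h u v
      cases huv : hasArc H.code y u v
      · exact Or.inl rfl
      · exact Or.inr ⟨_, h (entry H.code y u, entry H.code y v, (entry H.code u v).getD 0)
          ⟨u, v, huv, by simp [isArc]⟩, by simp [isArc]⟩
  rw [isLabel, Bool.and_eq_true, Bool.and_eq_true, pairwise_encode_lt, hmem', List.all_eq_true]
  simp only [hmem]
  constructor
  · rintro ⟨⟨h1, h2⟩, h3⟩
    refine List.Perm.eq_of_pairwise (le := fun a b => Encodable.encode a < Encodable.encode b)
      (fun a b _ _ h h' => (lt_asymm h h').elim) h1 (pairwise_label H y) ?_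
    rw [List.perm_ext_iff_of_nodup]
    · exact fun a => ⟨h2 a, h3 a⟩
    · exact h1.imp fun h e => by simp [e] at h
    · exact (pairwise_label H y).imp fun h e => by simp [e] at h
  · rintro rfl
    exact ⟨⟨pairwise_label H y, fun _ h => h⟩, fun _ h => h⟩

/-- The test makes s contain the empty path and, with a path shorter than d, all its extensions by
an edge. By induction s contains every path of length at most d, and uniqueness of ends determines
the labels. -/
theorem isView_code {d : ℕ} {s : List (PortPath × Label)} {x : Fin n} :
    isView d s H.code x = true ↔
      H.view d x = {e | e ∈ s} ∧ ∀ y, ∃ e ∈ s, H.Follows x e.1 y := by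
  have hany : ∀ p : PortPath × Label → Bool, s.any p = true ↔ ∃ e ∈ s, p e = true := fun p =>
    List.any_eq_true
  have hall : ∀ p : PortPath × Label → Bool, s.all p = true ↔ ∀ e ∈ s, p e = true := fun p =>
    List.all_eq_true
  simp only [isView, Bool.and_eq_true, Bool.or_eq_true, Bool.not_eq_true', hany, hall,
    forall_range_code, exists_range_code, decide_eq_true_eq, isLabel_code,
    walkEnd_code, Fin.val_inj, exists_eq_left, ← Bool.not_eq_true,
    isSome_entry_code]
  refine and_congr ⟨?_, ?_⟩ Iff.rfl
  · rintro ⟨⟨e₀, he₀, hnil⟩, hs⟩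
    ext ⟨p, L⟩
    rw [mem_view]
    constructor
    · rintro ⟨hp, y, hy, rfl⟩
      have key : ∀ p : PortPath, p.length ≤ d → (∃ y, H.Follows x p y) → ∃ e ∈ s, e.1 = p := by
        intro p
        induction p using List.reverseRecOn with
        | nil => exact fun _ _ => ⟨e₀, he₀, hnil⟩
        | append_singleton p a ih =>
          rintro hp ⟨z, hz⟩
          obtain ⟨y, hy, ha⟩ := follows_append.1 hz
          obtain ⟨hyz, rfl⟩ := follows_singleton.1 ha
          rw [List.length_append, List.length_singleton] at hp
          obtain ⟨e, he, rfl⟩ := ih (by omega) ⟨y, hy⟩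
          obtain ⟨-, y', ⟨hy', -⟩, h⟩ := hs e he
          obtain rfl := hy.unique hy'
          obtain ⟨e', he', h'⟩ := (h.resolve_left (by omega) z).resolve_left (by simpa using hyz)
          refine ⟨e', he', ?_⟩
          rw [h', entry_code_of_adj hyz, entry_code_of_adj hyz.symm]
          rfl
      obtain ⟨⟨p', L⟩, he, rfl⟩ := key p hp ⟨y, hy⟩
      obtain ⟨-, y', ⟨hy', hL⟩, -⟩ := hs _ he
      obtain rfl := hy.unique hy'
      simp only at hL
      rwa [Set.mem_ofPred_eq, ← hL]
    · intro he
      obtain ⟨h1, y, ⟨h2, h3⟩, -⟩ := hs _ he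
      exact ⟨h1, y, h2, h3⟩
  · intro h
    have hmem : ∀ e, e ∈ s ↔ e ∈ H.view d x := fun e => by rw [h]; rfl
    refine ⟨⟨([], H.label x), (hmem _).2 (mem_view.2 ⟨by simp, x, rfl, rfl⟩), rfl⟩, ?_⟩
    rintro ⟨p, L⟩ he
    rw [hmem, mem_view] at he
    obtain ⟨hp, y, hy, rfl⟩ := he
    refine ⟨hp, y, ⟨hy, rfl⟩, ?_⟩
    by_cases hd : p.length < d
    · refine Or.inr fun z => ?_
      by_cases hyz : H.graph.Adj y z
      · refine Or.inr ⟨(p ++ [(H.port y z, H.port z y)], H.label z), (hmem _).2 (mem_view.2 ⟨?_, z,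
          follows_append.2 ⟨y, hy, follows_singleton.2 ⟨hyz, rfl⟩⟩, rfl⟩), ?_⟩
        · simpa using hd
        · rw [entry_code_of_adj hyz, entry_code_of_adj hyz.symm]
          rfl
      · exact Or.inl hyz
    · exact Or.inl hd

end Network

/-! ### Matrices of networks -/

theorem isMatrix_iff {C : List (List (Option ℕ))} : isMatrix C = true ↔
    (∀ r ∈ C, r.length = C.length) ∧ ∀ i < C.length, entry C i i = none ∧
      ∀ j < C.length, ((entry C i j).isSome → (entry C j i).isSome) ∧
        ∀ l < C.length, (entry C i j).isSome → entry C i j = entry C i l → j = l := by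
  simp only [isMatrix, Bool.and_eq_true, List.all_eq_true, List.mem_range, Bool.or_eq_true,
    Bool.not_eq_true', ← Bool.not_eq_true, decide_eq_true_eq, ← imp_iff_not_or]
  have e : ∀ P Q R : Prop, ((P → ¬ Q) ∨ R) ↔ (P → Q → R) := by intros; tauto
  simp only [e]

/-- Connectedness is the only property not visible entrywise; it comes from the paths that reach
every index from x. -/
theorem exists_network_of_isMatrix {C : List (List (Option ℕ))} (hC : isMatrix C = true) {x : ℕ}
    (hx : x < C.length) (hconn : ∀ j < C.length, ∃ p, walkEnd C x p = some j) :
    ∃ H : Network (Fin C.length), H.code = C := by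
  rw [isMatrix_iff] at hC
  obtain ⟨hrow, hC⟩ := hC
  let G : SimpleGraph (Fin C.length) :=
    { Adj := fun i j => (entry C i j).isSome
      symm := ⟨fun i j h => ((hC i i.2).2 j j.2).1 h⟩
      loopless := ⟨fun i h => by simp [(hC i i.2).1] at h⟩ }
  have hreach : ∀ (p : PortPath) (j : Fin C.length), walkEnd C x p = some (j : ℕ) →
      G.Reachable ⟨x, hx⟩ j := by
    intro p
    induction p using List.reverseRecOn with
    | nil =>
      intro j h
      obtain rfl : (⟨x, hx⟩ : Fin C.length) = j := Fin.ext (by simpa [walkEnd] using h)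
      exact .rfl
    | append_singleton p e ih =>
      intro j h
      rw [Network.walkEnd_concat, Option.bind_eq_some_iff] at h
      obtain ⟨a, ha, h⟩ := h
      have h := List.mem_of_head? h
      simp only [List.mem_filter, Bool.and_eq_true, decide_eq_true_eq] at h
      have haC : a < C.length := by
        by_contra hlt
        have : C[a]? = none := by rw [List.getElem?_eq_none_iff]; omega
        simp [entry, this] at h
      refine (ih ⟨a, haC⟩ ha).trans (SimpleGraph.Adj.reachable ?_)
      change (entry C a j).isSome
      rw [h.2.1]; rfl
  have hG : G.Connected := by
    have : Nonempty (Fin C.length) := ⟨⟨x, hx⟩⟩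
    have key : ∀ j, G.Reachable ⟨x, hx⟩ j := fun j =>
      let ⟨p, hp⟩ := hconn j j.2
      hreach p j hp
    exact ⟨fun i j => (key i).symm.trans (key j)⟩
  have hinj : ∀ x : Fin C.length,
      Set.InjOn (fun y : Fin C.length => (entry C x y).getD 0) (G.neighborSet x) := by
    intro x y hy z hz h
    change (entry C x y).isSome at hy
    change (entry C x z).isSome at hz
    refine Fin.ext (((hC x x.2).2 y y.2).2 z z.2 hy ?_)
    obtain ⟨a, ha⟩ := Option.isSome_iff_exists.1 hy
    obtain ⟨b, hb⟩ := Option.isSome_iff_exists.1 hz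
    simp only [ha, hb, Option.getD_some] at h
    rw [ha, hb, h]
  refine ⟨⟨G, hG, fun _ => Set.toFinite _, fun i j => (entry C i j).getD 0, hinj⟩, ?_⟩
  have hent : ∀ i j : Fin C.length, (open Classical in
      if G.Adj i j then some ((entry C i j).getD 0) else none) = entry C i j := by
    intro i j
    change (if (entry C i j).isSome then _ else _) = _
    cases entry C i j <;> simp
  refine List.ext_getElem (by simp [Network.code]) fun i h1 h2 => ?_
  have hri := hrow _ (List.getElem_mem h2)
  refine List.ext_getElem (by simp [Network.code, hri]) fun j h3 h4 => ?_
  have := hent ⟨i, h2⟩ ⟨j, by rwa [← hri]⟩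
  simp only [Network.code, List.getElem_ofFn]
  rw [this]
  simp [entry, h2, h4]

/-! ### Contractibility of cycles -/

namespace Network

/-- The graph of a network on `Fin n`, with isolated vertices added. -/
def natGraph (H : Network (Fin n)) : SimpleGraph ℕ where
  Adj i j := (entry H.code i j).isSome
  symm := ⟨fun i j h => by
    obtain ⟨hi, hj⟩ := lt_of_isSome_entry h
    lift i to Fin n using hi
    lift j to Fin n using hj
    rw [isSome_entry_code] at h ⊢
    exact h.symm⟩
  loopless := ⟨fun i h => by
    obtain ⟨hi, -⟩ := lt_of_isSome_entry h
    lift i to Fin n using hi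
    rw [isSome_entry_code] at h
    exact h.ne rfl⟩

theorem natGraph_adj {i j : Fin n} : H.natGraph.Adj i j ↔ H.graph.Adj i j := isSome_entry_code i j

/-- The added vertices are isolated, so the inclusion is a covering onto its image. Contractions can
thus be transferred to lists of natural numbers and back. -/
theorem isCliqueCovering_natGraph (H : Network (Fin n)) :
    IsCliqueCovering H.graph H.natGraph (fun i : Fin n => (i : ℕ)) where
  adj h := natGraph_adj.2 h
  inj _ _ h := Fin.ext h
  surj {x b} h := by
    obtain ⟨-, hb⟩ := lt_of_isSome_entry h
    lift b to Fin n using hb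
    exact ⟨b, natGraph_adj.1 h, rfl⟩
  triangle _ _ h := natGraph_adj.1 h

theorem isCycle_code {w : List ℕ} : isCycle H.code w = true ↔ IsSimpleCycle H.natGraph w := by
  simp only [isCycle, Bool.and_eq_true, decide_eq_true_eq, List.all_eq_true, List.mem_range,
    Bool.not_eq_true', decide_eq_false_iff_not]
  have h1 : (∀ i < w.length - 1, (entry H.code ((w[i]?).getD 0) ((w[i + 1]?).getD 0)).isSome) ↔
      w.IsChain H.natGraph.Adj := by
    rw [List.isChain_iff_getElem]
    constructor
    · intro h i hi
      have := h i (by omega)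
      rwa [List.getElem?_eq_getElem hi, List.getElem?_eq_getElem (by omega)] at this
    · intro h i hi
      rw [List.getElem?_eq_getElem (by omega), List.getElem?_eq_getElem (by omega)]
      exact h i (by omega)
  have h2 : (∀ i < w.length - 1, ∀ j < i, ¬ (w[j]? = w[i]?)) ↔ w.dropLast.Nodup := by
    rw [List.Nodup, List.pairwise_iff_getElem]
    simp only [List.length_dropLast, List.getElem_dropLast]
    constructor
    · intro h j i hj hi hji e
      refine h i hi j hji ?_
      rw [List.getElem?_eq_getElem (by omega), List.getElem?_eq_getElem (by omega), e]
    · intro h i hi j hji e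
      rw [List.getElem?_eq_getElem (by omega), List.getElem?_eq_getElem (by omega)] at e
      exact h j i (by omega) hi hji (Option.some.inj e)
  rw [h1, h2]
  constructor
  · rintro ⟨⟨⟨h, h'⟩, h''⟩, h'''⟩
    exact ⟨List.length_pos_iff.1 h, h', h'', h'''⟩
  · rintro ⟨h, h', h'', h'''⟩
    exact ⟨⟨⟨List.length_pos_iff.2 h, h'⟩, h''⟩, h'''⟩

theorem isMove_code {m : ℕ} {c c' : List ℕ}
    (hc : c ∈ listsUpTo (List.range H.code.length) m)
    (hc' : c' ∈ listsUpTo (List.range H.code.length) m) :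
    isMove H.code (listsUpTo (List.range H.code.length) m) c c' = true ↔
      ElementaryMove H.natGraph c c' := by
  simp only [isMove, isMoveAt, List.any_eq_true, Bool.or_eq_true, Bool.and_eq_true,
    decide_eq_true_eq]
  constructor
  · rintro ⟨x, -, y, -, a, -, b, -, d, -, h⟩
    rcases h with ((⟨⟨h1, rfl⟩, rfl⟩ | ⟨⟨⟨⟨h1, h2⟩, h3⟩, rfl⟩, rfl⟩) |
      ⟨⟨⟨⟨h1, h2⟩, h3⟩, rfl⟩, rfl⟩) | ⟨rfl, rfl⟩
    · exact .backtrack x y h1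
    · exact .pushVertex x y h1 h2 h3
    · exact .pushEdge x y h1 h2 h3
    · exact .stutter x y a
  · rw [mem_listsUpTo] at hc hc'
    simp only [mem_listsUpTo]
    intro h
    cases h with
    | @backtrack x y a b hab =>
      simp only [List.mem_append, List.mem_cons, List.length_append, List.length_cons] at hc hc'
      -- A backtrack has no third vertex; a fills the spare slot, as it does in the stutter case.
      exact ⟨x, ⟨by omega, fun a h => hc.2 a (by simp [h])⟩, y,
        ⟨by omega, fun a h => hc.2 a (by simp [h])⟩, a, hc.2 a (by simp), b, hc'.2 b (by simp),
        a, hc.2 a (by simp), Or.inl (Or.inl (Or.inl ⟨⟨hab, rfl⟩, rfl⟩))⟩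
    | @pushVertex x y a b d hab hbd hda =>
      simp only [List.mem_append, List.mem_cons, List.length_append, List.length_cons] at hc hc'
      exact ⟨x, ⟨by omega, fun a h => hc.2 a (by simp [h])⟩, y,
        ⟨by omega, fun a h => hc.2 a (by simp [h])⟩, a, hc.2 a (by simp), b, hc'.2 b (by simp),
        d, hc'.2 d (by simp), Or.inl (Or.inl (Or.inr ⟨⟨⟨⟨hab, hbd⟩, hda⟩, rfl⟩, rfl⟩))⟩
    | @pushEdge x y a b d hab hbd hda =>
      simp only [List.mem_append, List.mem_cons, List.length_append, List.length_cons] at hc hc'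
      exact ⟨x, ⟨by omega, fun a h => hc.2 a (by simp [h])⟩, y,
        ⟨by omega, fun a h => hc.2 a (by simp [h])⟩, a, hc.2 a (by simp), b, hc'.2 b (by simp),
        d, hc'.2 d (by simp), Or.inl (Or.inr ⟨⟨⟨⟨hab, hbd⟩, hda⟩, rfl⟩, rfl⟩)⟩
    | stutter x y a =>
      simp only [List.mem_append, List.mem_cons, List.length_append, List.length_cons] at hc hc'
      exact ⟨x, ⟨by omega, fun a h => hc.2 a (by simp [h])⟩, y,
        ⟨by omega, fun a h => hc.2 a (by simp [h])⟩, a, hc.2 a (by simp), a, hc.2 a (by simp),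
        a, hc.2 a (by simp), Or.inr ⟨rfl, rfl⟩⟩

/-- Every inserted vertex is already on the path or an end of an edge, and edges only join indices
below n. -/
theorem forall_lt_of_homotopy {c c' : List ℕ} (h : ElementaryHomotopy H.natGraph c c')
    (hc : ∀ a ∈ c, a < n) : ∀ a ∈ c', a < n := by
  have hlt : ∀ {a b}, H.natGraph.Adj a b → b < n := fun h => (lt_of_isSome_entry h).2
  rcases h with h | h
  · cases h with
    | backtrack x y hab =>
      have := hlt hab
      simp only [List.mem_append, List.mem_cons] at hc ⊢
      grind
    | pushVertex x y hab hbc hca =>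
      have := hlt hab
      have := hlt hbc
      simp only [List.mem_append, List.mem_cons] at hc ⊢
      grind
    | pushEdge x y hab hbc hca =>
      have := hlt hbc
      simp only [List.mem_append, List.mem_cons] at hc ⊢
      grind
    | stutter x y a =>
      simp only [List.mem_append, List.mem_cons] at hc ⊢
      grind
  · intro a ha
    refine hc a ?_
    cases h <;> simp only [List.mem_append, List.mem_cons] at ha ⊢ <;> grind

/-- With k moves left a loop has at most 3k + 1 ≤ m entries, so confining the contraction to the
listed loops loses nothing. -/
theorem mem_contractible_code {m k : ℕ} (hk : 3 * k + 1 ≤ m) {c : List ℕ} :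
    c ∈ contractible H.code (listsUpTo (List.range H.code.length) m) k ↔
      c ∈ listsUpTo (List.range H.code.length) m ∧ KContractible H.natGraph k c := by
  induction k generalizing c with
  | zero =>
    simp only [contractible, List.mem_filter, decide_eq_true_eq]
    refine and_congr_right fun _ => ⟨fun h => ?_, fun h => ?_⟩
    · obtain ⟨a, rfl⟩ := List.length_eq_one_iff.1 h
      exact .vertex 0 a
    · cases h; rfl
  | succ k ih =>
    simp only [contractible, List.mem_filter, Bool.or_eq_true, List.any_eq_true,
      decide_eq_true_eq]
    refine and_congr_right fun hc => ⟨?_, fun h => ?_⟩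
    · rintro (h | ⟨c', hc', h⟩)
      · obtain ⟨a, rfl⟩ := List.length_eq_one_iff.1 h
        exact .vertex _ a
      · obtain ⟨hc', hk'⟩ := (ih (by omega)).1 hc'
        rw [isMove_code hc hc', isMove_code hc' hc] at h
        exact .step h hk'
    · cases h with
      | vertex _ a => exact Or.inl rfl
      | @step _ _ c' h hk' =>
        have hc' : c' ∈ listsUpTo (List.range H.code.length) m := by
          rw [mem_listsUpTo] at hc ⊢
          simp only [List.mem_range, length_code] at hc ⊢
          exact ⟨hk'.length_le.trans (by omega), forall_lt_of_homotopy h hc.2⟩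
        refine Or.inr ⟨c', (ih (by omega)).2 ⟨hc', hk'⟩, ?_⟩
        rwa [isMove_code hc hc', isMove_code hc' hc]

theorem isSimpleCycle_map_val {c : List (Fin n)} :
    IsSimpleCycle H.natGraph (c.map fun i : Fin n => (i : ℕ)) ↔ IsSimpleCycle H.graph c := by
  have h1 : (c.map fun i : Fin n => (i : ℕ)).IsChain H.natGraph.Adj ↔ c.IsChain H.graph.Adj := by
    simp only [List.isChain_map, natGraph_adj]
  have h2 : (c.map fun i : Fin n => (i : ℕ)).head? = (c.map fun i : Fin n => (i : ℕ)).getLast? ↔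
      c.head? = c.getLast? := by
    rw [List.head?_map, List.getLast?_map]
    exact (Option.map_injective Fin.val_injective).eq_iff
  have h3 : (c.map fun i : Fin n => (i : ℕ)).dropLast.Nodup ↔ c.dropLast.Nodup := by
    rw [← List.map_dropLast]
    exact List.nodup_map_iff Fin.val_injective
  constructor
  · rintro ⟨h, h', h'', h'''⟩
    exact ⟨by simpa using h, h2.1 h', h1.1 h'', h3.1 h'''⟩
  · rintro ⟨h, h', h'', h'''⟩
    exact ⟨by simpa using h, h2.2 h', h1.2 h'', h3.2 h'''⟩

/-- Simple cycles have at most n + 1 ≤ k entries, so all of them are listed. -/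
theorem cycles_code {k : ℕ} (hn : n < k) :
    ((listsUpTo (List.range H.code.length) (3 * k + 1)).all fun c => !isCycle H.code c ||
      (contractible H.code (listsUpTo (List.range H.code.length) (3 * k + 1)) k).any
        fun c' => decide (c' = c)) = true ↔
    ∀ c, IsSimpleCycle H.graph c → KContractible H.graph k c := by
  simp only [List.all_eq_true, Bool.or_eq_true, Bool.not_eq_true', ← Bool.not_eq_true,
    isCycle_code, List.any_eq_true, decide_eq_true_eq, exists_eq_right,
    mem_contractible_code (le_refl (3 * k + 1)), ← imp_iff_not_or]
  constructor
  · intro h c hc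
    refine H.isCliqueCovering_natGraph.kContractible_of_map hc.isLazyPath ?_
    refine (h _ ?_ (isSimpleCycle_map_val.2 hc)).2
    have := hc.length_le
    rw [Nat.card_eq_fintype_card, Fintype.card_fin] at this
    rw [mem_listsUpTo]
    refine ⟨by rw [List.length_map]; omega, fun a ha => ?_⟩
    obtain ⟨i, -, rfl⟩ := List.mem_map.1 ha
    simp [length_code]
  · intro h c hc hc'
    refine ⟨hc, ?_⟩
    rw [mem_listsUpTo] at hc
    have hlt : ∀ a ∈ c, a < n := by simpa [length_code] using hc.2
    lift c to List (Fin n) using hlt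
    exact (h c (isSimpleCycle_map_val.1 hc')).map H.isCliqueCovering_natGraph.adj

end Network

end

/-! ### Equivalence of the search with a bounded search -/

theorem test_iff {k : ℕ} {s : List (PortPath × Label)} {C : List (List (Option ℕ))} :
    test k s C = true ↔ ∃ (n : ℕ) (H : Network (Fin n)), H.code = C ∧ PassesTest k s H := by
  constructor
  · intro h
    simp only [test, Bool.and_eq_true, decide_eq_true_eq] at h
    obtain ⟨⟨⟨hk, hC⟩, hx⟩, hcyc⟩ := h
    obtain ⟨n, H, rfl⟩ : ∃ (n : ℕ) (H : Network (Fin n)), H.code = C := by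
      obtain ⟨x, hx, hv⟩ := List.any_eq_true.1 hx
      simp only [isView, Bool.and_eq_true, List.all_eq_true, List.any_eq_true, List.mem_range,
        decide_eq_true_eq] at hv hx
      obtain ⟨H, hH⟩ := exists_network_of_isMatrix hC hx fun j hj =>
        let ⟨e, _, he⟩ := hv.2 j hj
        ⟨e.1, he⟩
      exact ⟨_, H, hH⟩
    rw [Network.length_code] at hk
    rw [Network.exists_range_code] at hx
    obtain ⟨x, hx⟩ := hx
    exact ⟨n, H, rfl, hk, ⟨x, (Network.isView_code.1 hx).1⟩, (Network.cycles_code hk).1 hcyc⟩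
  · rintro ⟨n, H, rfl, hk, ⟨x, hx⟩, hcyc⟩
    simp only [test, Bool.and_eq_true, decide_eq_true_eq]
    refine ⟨⟨⟨by rwa [Network.length_code], H.isMatrix_code⟩, Network.exists_range_code.2 ⟨x,
      Network.isView_code.2 ⟨hx, fun y => ?_⟩⟩⟩, (Network.cycles_code hk).2 hcyc⟩
    -- Since n < k, every vertex is reached within depth 2k and therefore occurs in the record.
    obtain ⟨p, hp, hf⟩ := exists_follows_lt H x y
    have hmem : (p, H.label y) ∈ {e | e ∈ s} := by
      rw [← hx]
      exact Network.mem_view.2 ⟨by omega, y, hf, rfl⟩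
    exact ⟨_, hmem, hf⟩

/-- The source of an edge is reached from the root in fewer than n steps, so a path of at most n ≤
2k steps ends with this edge and its port number is in the record. -/
theorem mem_candidates {k : ℕ} {s : List (PortPath × Label)} {C : List (List (Option ℕ))} :
    C ∈ candidates k s ↔ test k s C = true := by
  rw [candidates, List.mem_filter]
  refine and_iff_right_of_imp fun h => ?_
  obtain ⟨n, H, rfl, hk, ⟨x, hx⟩, -⟩ := test_iff.1 h
  rw [mem_listsUpTo, Network.length_code]
  refine ⟨hk.le, fun r hr => ?_⟩
  obtain ⟨i, rfl⟩ := (List.mem_ofFn' _ _).1 hr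
  rw [mem_listsUpTo, List.length_ofFn]
  refine ⟨hk.le, fun o ho => ?_⟩
  obtain ⟨j, rfl⟩ := (List.mem_ofFn' _ _).1 ho
  simp only
  split_ifs with hij
  · obtain ⟨p, hp, hf⟩ := exists_follows_lt H x i
    have hmem : (p ++ [(H.port i j, H.port j i)], H.label j) ∈ {e | e ∈ s} := by
      rw [← hx]
      refine Network.mem_view.2 ⟨by simp; omega, j, ?_, rfl⟩
      exact Network.follows_append.2 ⟨i, hf, Network.follows_singleton.2 ⟨hij, rfl⟩⟩
    refine List.mem_cons_of_mem _ (List.mem_flatMap.2 ⟨_, hmem, ?_⟩)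
    simp
  · simp

/-- The decidability instance is left arbitrary, to be unified with the one inside
`Encodable.choose`. -/
theorem exists_eq_find_le {P : ℕ → Prop} {_ : DecidablePred P} (h : ∃ n, P n)
    (_ : P (Nat.find h)) {n : ℕ} (hn : P n) : ∃ m ≤ n, Nat.find h = m :=
  ⟨_, Nat.find_min' h hn, rfl⟩

/-- `Encodable.choose` decodes the least number that decodes to a solution. In a denumerable type
decoding inverts encoding on both sides, so this number is the code of the chosen element. -/
theorem encode_choose_le {α : Type*} [Denumerable α] {p : α → Prop} [DecidablePred p]
    (h : ∃ x, p x) {y : α} (hy : p y) :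
    Encodable.encode (Encodable.choose h) ≤ Encodable.encode y := by
  unfold Encodable.choose Encodable.chooseX
  generalize_proofs h1 h2
  dsimp only
  have h3 := h2 h1
  obtain ⟨m, hle, hm⟩ := exists_eq_find_le h1 h3 (n := Encodable.encode y)
    (by rw [Encodable.encodek]; exact hy)
  generalize_proofs
  revert h3
  rw [hm]
  generalize hd : Encodable.decode (α := α) m = o
  intro h3
  cases o with
  | none => exact h3.elim
  | some a =>
    rw [Denumerable.decode_eq_ofNat, Option.some_inj] at hd
    change Encodable.encode a ≤ _
    rwa [← hd, Denumerable.encode_ofNat]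

/-- Both sides select the accepted matrix with the least code, and codes are injective. -/
theorem search_eq_firstCandidate (k : ℕ) (s : List (PortPath × Label)) :
    search k s = firstCandidate k s := by
  classical
  have hmem : ∀ C, C ∈ candidates k s ↔
      ∃ (n : ℕ) (H : Network (Fin n)), H.code = C ∧ PassesTest k s H := fun C =>
    mem_candidates.trans test_iff
  rw [search, firstCandidate]
  split_ifs with h
  · have hmin : ∀ C' ∈ candidates k s, Encodable.encode (Encodable.choose h) ≤
        Encodable.encode C' := fun C' hC' => encode_choose_le h ((hmem C').1 hC')
    have hspec := (hmem _).2 (Encodable.choose_spec h)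
    symm
    generalize hl : ((candidates k s).filter fun C => (candidates k s).all fun C' =>
      decide (Encodable.encode C ≤ Encodable.encode C')) = l
    have hl' : Encodable.choose h ∈ l := by
      rw [← hl, List.mem_filter]
      refine ⟨hspec, ?_⟩
      simpa using hmin
    cases l with
    | nil => simp at hl'
    | cons C l =>
      have hC : C ∈ C :: l := by simp
      rw [← hl, List.mem_filter] at hC
      simp only [List.all_eq_true, decide_eq_true_eq] at hC
      rw [List.head?_cons, Encodable.encode_injective
        (le_antisymm (hC.2 _ hspec) (hmin C hC.1))]
  · have : candidates k s = [] :=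
      List.eq_nil_iff_forall_not_mem.2 fun C hC => h ⟨C, (hmem C).1 hC⟩
    simp [this]

/-! ### Computability of the algorithm -/

section

variable {α : Type*} [Primcodable α]

@[fun_prop]
theorem primrec_search {k : α → ℕ} {s : α → List (PortPath × Label)} (hk : Primrec k)
    (hs : Primrec s) : Primrec fun x => search (k x) (s x) := by
  simp only [search_eq_firstCandidate]
  fun_prop

@[fun_prop]
theorem primrec_edges {L : α → Label} (hL : Primrec L) : Primrec fun x => Label.edges (L x) := by
  have h : Primrec fun x => (L x).flatMap fun a => (L x).filterMap fun b =>
      bif decide (a.1 = none) && a.2.1.isSome && decide (b.2.1 = none) && decide (a.2.1 = b.1)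
      then some (a.2.1.getD 0, b.2.2) else none := by fun_prop
  refine h.of_eq fun x => ?_
  unfold Label.edges
  congr 1
  funext a
  congr 1
  funext b
  obtain ⟨_ | a1, _ | a2, a3⟩ := a <;> obtain ⟨_ | b1, _ | b2, b3⟩ := b <;> simp

theorem primrec_memory {m : α → Memory} :
    Primrec m ↔ Primrec fun x => Memory.equiv (m x) :=
  (Primrec.of_equiv_iff Memory.equiv).symm

@[fun_prop]
theorem primrec_memory_mk {f1 : α → ℕ} {f2 : α → List PortPath}
    {f3 : α → List (PortPath × Label)} {f4 : α → List ℕ} {f5 : α → Bool}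
    {f6 : α → Option (List (List (Option ℕ)))} (h1 : Primrec f1) (h2 : Primrec f2)
    (h3 : Primrec f3) (h4 : Primrec f4) (h5 : Primrec f5) (h6 : Primrec f6) :
    Primrec fun x => Memory.mk (f1 x) (f2 x) (f3 x) (f4 x) (f5 x) (f6 x) := by
  rw [primrec_memory]
  change Primrec fun x => (f1 x, f2 x, f3 x, f4 x, f5 x, f6 x)
  fun_prop

@[fun_prop]
theorem primrec_phase {m : α → Memory} (hm : Primrec m) : Primrec fun x => (m x).phase :=
  Primrec.fst.comp (primrec_memory.1 hm)

@[fun_prop]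
theorem primrec_queue {m : α → Memory} (hm : Primrec m) : Primrec fun x => (m x).queue :=
  Primrec.fst.comp (Primrec.snd.comp (primrec_memory.1 hm))

@[fun_prop]
theorem primrec_seen {m : α → Memory} (hm : Primrec m) : Primrec fun x => (m x).seen :=
  Primrec.fst.comp (Primrec.snd.comp (Primrec.snd.comp (primrec_memory.1 hm)))

@[fun_prop]
theorem primrec_todo {m : α → Memory} (hm : Primrec m) : Primrec fun x => (m x).todo :=
  Primrec.fst.comp (Primrec.snd.comp (Primrec.snd.comp (Primrec.snd.comp (primrec_memory.1 hm))))

@[fun_prop]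
theorem primrec_outbound {m : α → Memory} (hm : Primrec m) : Primrec fun x => (m x).outbound :=
  Primrec.fst.comp (Primrec.snd.comp (Primrec.snd.comp (Primrec.snd.comp (Primrec.snd.comp
    (primrec_memory.1 hm)))))

@[fun_prop]
theorem primrec_found {m : α → Memory} (hm : Primrec m) : Primrec fun x => (m x).found :=
  Primrec.snd.comp (Primrec.snd.comp (Primrec.snd.comp (Primrec.snd.comp (Primrec.snd.comp
    (primrec_memory.1 hm)))))

@[fun_prop]
theorem primrec_move {p : α → ℕ} (hp : Primrec p) : Primrec fun x => Action.move (p x) := by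
  rw [← Primrec.of_equiv_iff Action.equiv]
  change Primrec fun x => some (some (p x))
  fun_prop

/-- The last step of a phase. -/
noncomputable def searchStep (m : Memory) : Memory × Action :=
  Option.casesOn (motive := fun _ => Memory × Action) (search m.phase m.seen)
    (.mk (m.phase + 1) [[]] [] [] true none, .stay)
    fun C => (.mk m.phase m.queue m.seen m.todo m.outbound (some C), .halt)

@[fun_prop]
theorem primrec_searchStep {m : α → Memory} (hm : Primrec m) :
    Primrec fun x => searchStep (m x) :=
  Primrec.option_casesOn (by fun_prop) (by fun_prop) (by unfold Primrec₂; fun_prop)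

/-- The step in which a path is recorded or started. -/
def pathStep (m : Memory) (L : Label) (p : PortPath) (q : List PortPath) : Memory × Action :=
  bif m.outbound then
    (.mk m.phase (q ++ bif decide (p.length < 2 * m.phase)
      then (Label.edges L).map (fun e => p ++ [e]) else []) (m.seen ++ [(p, L)])
      (p.map Prod.snd).reverse false m.found, .stay)
  else (.mk m.phase m.queue m.seen (p.map Prod.fst) true m.found, .stay)

@[fun_prop]
theorem primrec_pathStep {m : α → Memory} {L : α → Label} {p : α → PortPath}
    {q : α → List PortPath} (hm : Primrec m) (hL : Primrec L) (hp : Primrec p) (hq : Primrec q) :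
    Primrec fun x => pathStep (m x) (L x) (p x) (q x) := by
  unfold pathStep; fun_prop

/-- The steps at the ends of paths. -/
noncomputable def queueStep (m : Memory) (L : Label) : Memory × Action :=
  List.casesOn (motive := fun _ => Memory × Action) m.queue (searchStep m) (pathStep m L)

@[fun_prop]
theorem primrec_queueStep {m : α → Memory} {L : α → Label} (hm : Primrec m) (hL : Primrec L) :
    Primrec fun x => queueStep (m x) (L x) :=
  Primrec.list_casesOn (h := fun x q => pathStep (m x) (L x) q.1 q.2) (by fun_prop) (by fun_prop)
    (by unfold Primrec₂; fun_prop)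

/-- The transition function of `fntAgent`. -/
noncomputable def fntStep (m : Memory) (L : Label) : Memory × Action :=
  List.casesOn (motive := fun _ => Memory × Action) m.todo (queueStep m L)
    fun p t => (.mk m.phase m.queue m.seen t m.outbound m.found, .move p)

theorem primrec_fntStep {m : α → Memory} {L : α → Label} (hm : Primrec m) (hL : Primrec L) :
    Primrec fun x => fntStep (m x) (L x) :=
  Primrec.list_casesOn (h := fun x q => (Memory.mk (m x).phase (m x).queue (m x).seen q.2
    (m x).outbound (m x).found, Action.move q.1)) (by fun_prop) (by fun_prop)
    (by unfold Primrec₂; fun_prop)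

end

theorem fntAgent_step (m : Memory) (e : Option ℕ) (L : Label) :
    fntAgent.step m e L = fntStep m L := by
  obtain ⟨k, q, s, t, b, f⟩ := m
  cases t with
  | cons p ps => rfl
  | nil =>
    cases q with
    | nil =>
      simp only [fntAgent, fntStep, queueStep, searchStep]
      cases search k s <;> rfl
    | cons p q =>
      cases b
      · rfl
      · simp only [fntAgent, fntStep, queueStep, pathStep, cond_true, Bool.cond_decide]

theorem isComputable_fntAgent : fntAgent.IsComputable := by
  have h : Computable fun x : Memory × Option ℕ × Label => fntStep x.1 x.2.2 :=
    (primrec_fntStep Primrec.fst (Primrec.snd.comp Primrec.snd)).to_comp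
  have e : (fun x : Memory × Option ℕ × Label => fntStep x.1 x.2.2) =
      fun x => fntAgent.step x.1 x.2.1 x.2.2 := funext fun x => (fntAgent_step _ _ _).symm
  rw [e] at h
  exact h

end BinocularExploration

/-! ### The main theorem -/

open BinocularExploration in
theorem mainTheorem3 :
    -- the algorithm is an Exploration algorithm that halts on every graph of FNT
    Agent.Explores.{u} fntAgent (fun {V : Type u} (G : SimpleGraph V) => FNT G) ∧
    ∀ {V : Type u} (N : Network V) (x₀ : V),
      -- it never halts on the other graphs
      (¬ FNT N.graph → ∀ t, ¬ (fntAgent.run N x₀ t).halted) ∧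
      -- whenever it halts, it has visited all vertices, and the network that it found is the
      -- universal cover, by a covering that respects the port numbers
      ∀ t, (fntAgent.run N x₀ t).halted →
        (∀ y, ∃ s ≤ t, (fntAgent.run N x₀ s).pos = y) ∧
        ∃ (k n : ℕ) (H : Network (Fin n)) (h₀ : Fin n) (μ : Fin n → V),
          (fntAgent.run N x₀ t).memory.phase = k ∧
          (fntAgent.run N x₀ t).memory.found = some H.code ∧
          n < k ∧ H.view (2 * k) h₀ = N.view (2 * k) x₀ ∧
          (∀ c, IsSimpleCycle H.graph c → KContractible H.graph k c) ∧
          IsUniversalCover (cliqueComplex H.graph) (cliqueComplex N.graph) μ ∧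
          ∀ x y, H.graph.Adj x y → N.port (μ x) (μ y) = H.port x y := by
  refine ⟨⟨⟨isComputable_fntAgent, fun N x₀ => ?_⟩, fun N x₀ h => halts_of_FNT N x₀ h⟩,
    fun N x₀ => ⟨fun h t ht => h ?_, fun t ht => result_of_halted ht⟩⟩
  · by_cases h : ∃ t, (fntAgent.run N x₀ t).halted
    · obtain ⟨t, ht⟩ := h
      exact Or.inl ⟨t, ht, (result_of_halted ht).1⟩
    · exact Or.inr (not_exists.1 h)
  -- A halting execution exhibits a finite universal cover.
  · obtain ⟨-, k, n, H, h₀, μ, -, -, -, -, -, huniv, -⟩ := result_of_halted ht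
    exact Network.FNT_of_isUniversalCover huniv
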